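/- **Setting.** Fix an integer $k\ge 2$ and constants $\varepsilon>0$, $c>0$. For every $n\ge 1$ let $\beta=\beta_n\in\mathbb R$ and let $v=v_n$, $u=u_n$, $a=a_n$ be deterministic unit vectors in $\mathbb R^n$. Let $X=\beta v^{\otimes k}+Z\in\otimes^k\mathbb R^n$, where the $n^k$ entries of the noise tensor $Z$ are i.i.d. $N(0,1/n)$ (no symmetry). For a $k$-tensor $X$ and a vector $x$ let $X[x^{\otimes (k-1)}]\in\mathbb R^n$ be the vector with entries $\sum_{i_1,\dots,i_{k-1}}X_{i i_1\cdots i_{k-1}}x(i_1)\cdots x(i_{k-1})$, and $X[x^{\otimes k}]=\langle X,x^{\otimes k}\rangle$. Power iteration is $u_0=u$, $u_{t+1}=X[u_t^{\otimes(k-1)}]/\|X[u_t^{\otimes(k-1)}]\|$. For a deterministic time $T=T_n$ put $\hat v=u_T$ and $\hat\beta=X[\hat v^{\otimes k}]$. **Assumptions.** For all large $n$: $|\langle u,v\rangle|\ge c/\sqrt n$, $\;|\beta\langle u,v\rangle^{k-2}|\ge n^{\varepsilon}$, and $$T\ \ge\ 1+\frac1\varepsilon\Big(\frac12+\frac{2\log|\beta|}{\log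 n}\Big).$$ Moreover, with $a^\perp=a-\langle a,v\rangle v$, as $n\to\infty$, $$|\langle a,v\rangle|=o\Big(\frac{|\beta|^3}{\sqrt n}\,\|a^\perp\|\Big),\qquad |\langle a,v\rangle|=o\big(|\beta|\,\|a^\perp\|\big).$$ (If $\|a^\perp\|$ is bounded away from $0$, i.e. $\limsup_n|\langle a,v\rangle|<1$, these two conditions together just say $|\langle a,v\rangle|=o(|\beta|^3/\sqrt n)$.) **Conclusion.** As $n\to\infty$, $$\frac{\sqrt n\,\hat\beta}{\sqrt{\langle a,(I_n-\hat v\hat v^{\top})a\rangle}}\left[\Big(1-\frac1{2\hat\beta^2}\Big)^{-1}\langle a,\hat v\rangle-\langle a,w\rangle\right]\ \xrightarrow{\ d\ }\ N(0,1),$$ where $w=w_n$ is the limit of the iteration in each of the four cases: 1. $w=v$ if $k$ is odd and $\beta>0$ for all large $n$; 2. $w=-v$ if $k$ is odd and $\beta<0$ for all large $n$; 3. $w=\operatorname{sgn}(\langle u,v\rangle)\,v$ if $k$ is even and $\beta>0$ for all large $n$; 4. $w=(-1)^T\operatorname{sgn}(\langle u,v\rangle)\,v$ if $k$ is even and $\beta<0$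 for all large $n$. -/

import Mathlib

open MeasureTheory ProbabilityTheory Filter Asymptotics Topology
open scoped RealInnerProductSpace

noncomputable section

namespace SpikedTensor

/-- Real tensors of order `k` over `ℝⁿ`, as arrays of entries. -/
abbrev Tensor (k n : ℕ) : Type := (Fin k → Fin n) → ℝ

/-- The rank-one tensor `v^{⊗k}`. -/
def tpow {n : ℕ} (k : ℕ) (v : EuclideanSpace ℝ (Fin n)) : Tensor k n :=
  fun I => ∏ j, v (I j)

/-- The entrywise inner product of two tensors of the same order. -/
def tinner {k n : ℕ} (τ η : Tensor k n) : ℝ := ∑ I, τ I * η I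

/-- The action `τ[η]` of a tensor of order `k + 1` on a tensor of order `k`: the vector
`τ[η](i) = ⟨τ, e_i ⊗ η⟩ = ∑ τ_{i i₁ … i_k} η_{i₁ … i_k}`. -/
def act {k n : ℕ} (τ : Tensor (k + 1) n) (η : Tensor k n) : EuclideanSpace ℝ (Fin n) :=
  WithLp.toLp 2 fun i => ∑ I : Fin k → Fin n, τ (Fin.cons i I) * η I

/-- The spiked tensor `X = β v^{⊗k} + Z`. -/
def spiked {k n : ℕ} (β : ℝ) (v : EuclideanSpace ℝ (Fin n)) (Z : Tensor k n) : Tensor k n :=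
  β • tpow k v + Z

/-- Power iteration for a tensor `X` of order `k + 1`:
`u₀ = u`, `u_{t+1} = X[u_t^{⊗k}] / ‖X[u_t^{⊗k}]‖`. -/
def powerIter {k n : ℕ} (X : Tensor (k + 1) n) (u : EuclideanSpace ℝ (Fin n)) :
    ℕ → EuclideanSpace ℝ (Fin n)
  | 0 => u
  | t + 1 => ‖act X (tpow k (powerIter X u t))‖⁻¹ • act X (tpow k (powerIter X u t))

/-- The estimator `β̂ = ⟨X, v̂^{⊗(k+1)}⟩` of the signal size, where `v̂ = u_T`. -/
def betaHat {k n : ℕ} (X : Tensor (k + 1) n) (u : EuclideanSpace ℝ (Fin n)) (T : ℕ) : ℝ :=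
  tinner X (tpow (k + 1) (powerIter X u T))

/-- The studentized statistic
`√n β̂ / √⟨a, (I - v̂ v̂ᵀ) a⟩ * ((1 - 1/(2β̂²))⁻¹ ⟨a, v̂⟩ - ⟨a, w⟩)` with `v̂ = u_T`,
where `w` is the vector that `v̂` is compared with. -/
def studentized {k n : ℕ} (X : Tensor (k + 1) n) (u : EuclideanSpace ℝ (Fin n)) (T : ℕ)
    (a w : EuclideanSpace ℝ (Fin n)) : ℝ :=
  √(n : ℝ) * betaHat X u T /
      √⟪a, a - ⟪powerIter X u T, a⟫ • powerIter X u T⟫ *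
    ((1 - 1 / (2 * betaHat X u T ^ 2))⁻¹ * ⟪a, powerIter X u T⟫ - ⟪a, w⟫)

/-- `Z` is a noise tensor: its entries are independent with law `N(0, 1/n)`. -/
structure IsNoise {k n : ℕ} {Ω : Type*} [MeasurableSpace Ω] (Z : Ω → Tensor k n)
    (P : Measure Ω) : Prop where
  indep : iIndepFun (fun (I : Fin k → Fin n) (ω : Ω) => Z ω I) P
  law : ∀ I : Fin k → Fin n, HasLaw (fun ω => Z ω I) (gaussianReal 0 ((n : NNReal)⁻¹)) P

/-- Convergence in distribution to `N(0, 1)` of a sequence of real random variables, the `n`-th of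
which lives on its own probability space. -/
def TendstoStdNormal {Ω : ℕ → Type*} [∀ n, MeasurableSpace (Ω n)] (P : ∀ n, Measure (Ω n))
    [∀ n, IsProbabilityMeasure (P n)] (S : ∀ n, Ω n → ℝ) : Prop :=
  TendstoInDistribution S atTop (id : ℝ → ℝ) P (gaussianReal 0 1)

end SpikedTensor

end

noncomputable section

namespace SpikedTensor

/-- The law of a noise tensor: independent `N(0, 1/n)` entries. -/
def noise (k n : ℕ) : Measure (Tensor k n) :=
  Measure.pi fun _ => gaussianReal 0 ((n : NNReal)⁻¹)

instance (k n : ℕ) : IsProbabilityMeasure (noise k n) := by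
  unfold noise; infer_instance

theorem IsNoise.hasLaw {k n : ℕ} {Ω : Type*} [MeasurableSpace Ω] {Z : Ω → Tensor k n}
    {P : Measure Ω} (h : IsNoise Z P) : HasLaw Z (noise k n) P :=
  h.indep.hasLaw_pi h.law

theorem hasLaw_eval_noise {k n : ℕ} (I : Fin k → Fin n) :
    HasLaw (fun Z : Tensor k n => Z I) (gaussianReal 0 ((n : NNReal)⁻¹)) (noise k n) :=
  (measurePreserving_eval (fun _ : Fin k → Fin n => gaussianReal 0 ((n : NNReal)⁻¹)) I).hasLaw

theorem iIndepFun_eval_noise (k n : ℕ) :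
    iIndepFun (fun (I : Fin k → Fin n) (Z : Tensor k n) => Z I) (noise k n) :=
  iIndepFun_pi (X := fun (_ : Fin k → Fin n) (x : ℝ) => x) (fun _ => aemeasurable_id)

theorem hasGaussianLaw_noise (k n : ℕ) :
    HasGaussianLaw (fun Z : Tensor k n => Z) (noise k n) :=
  iIndepFun.hasGaussianLaw (fun I => (hasLaw_eval_noise I).hasGaussianLaw)
    (iIndepFun_eval_noise k n)

theorem memLp_eval_noise {k n : ℕ} (I : Fin k → Fin n) :
    MemLp (fun Z : Tensor k n => Z I) 2 (noise k n) :=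
  (hasLaw_eval_noise I).hasGaussianLaw.memLp_two

theorem covariance_eval_noise {k n : ℕ} (I J : Fin k → Fin n) :
    cov[fun Z : Tensor k n => Z I, fun Z => Z J; noise k n] = if I = J then (n : ℝ)⁻¹ else 0 := by
  split_ifs with h
  · subst h
    rw [covariance_self (hasLaw_eval_noise I).aemeasurable, (hasLaw_eval_noise I).variance_eq,
      variance_id_gaussianReal]
    simp
  · exact ((iIndepFun_eval_noise k n).indepFun h).covariance_eq_zero (memLp_eval_noise I)
      (memLp_eval_noise J)

theorem covariance_tinner_noise {k n : ℕ} (η η' : Tensor k n) :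
    cov[fun Z : Tensor k n => tinner Z η, fun Z => tinner Z η'; noise k n] =
      tinner η η' / n := by
  unfold tinner
  rw [covariance_fun_sum_fun_sum (fun I => (memLp_eval_noise I).mul_const _)
    (fun I => (memLp_eval_noise I).mul_const _)]
  simp only [covariance_mul_const_left, covariance_mul_const_right, covariance_eval_noise]
  simp only [Finset.sum_ite_eq, Finset.mem_univ, if_true, ite_mul, zero_mul,
    Finset.sum_div]
  exact Finset.sum_congr rfl fun I _ => by ring

/-- Pairing with a fixed tensor, as a continuous linear functional. -/
def tinnerCLM {k n : ℕ} (η : Tensor k n) : Tensor k n →L[ℝ] ℝ :=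
  LinearMap.toContinuousLinearMap
    { toFun := fun Z => tinner Z η
      map_add' := fun x y => by simp [tinner, add_mul, Finset.sum_add_distrib]
      map_smul' := fun c x => by simp [tinner, Finset.mul_sum, mul_assoc] }

theorem integral_tinner_noise {k n : ℕ} (η : Tensor k n) :
    ∫ Z : Tensor k n, tinner Z η ∂noise k n = 0 := by
  unfold tinner
  rw [integral_finsetSum _ fun I _ => ((memLp_eval_noise I).integrable one_le_two).mul_const _]
  refine Finset.sum_eq_zero fun I _ => ?_
  rw [integral_mul_const, (hasLaw_eval_noise I).integral_eq]
  simp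

theorem tinner_self_nonneg {k n : ℕ} (η : Tensor k n) : 0 ≤ tinner η η :=
  Finset.sum_nonneg fun _ _ => mul_self_nonneg _

theorem hasLaw_tinner_noise {k n : ℕ} (η : Tensor k n) :
    HasLaw (fun Z : Tensor k n => tinner Z η)
      (gaussianReal 0 (tinner η η / n).toNNReal) (noise k n) := by
  have h : HasGaussianLaw (fun Z : Tensor k n => tinner Z η) (noise k n) :=
    (hasGaussianLaw_noise k n).map_fun (tinnerCLM η)
  refine ⟨h.aemeasurable, ?_⟩
  rw [h.map_eq_gaussianReal, integral_tinner_noise, ← covariance_self h.aemeasurable,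
    covariance_tinner_noise]

theorem noise_tinner_chebyshev {k n : ℕ} (η : Tensor k n) {L : ℝ} (hL : 0 < L) :
    noise k n {Z | L ≤ |tinner Z η|} ≤ ENNReal.ofReal (tinner η η / n / L ^ 2) := by
  have h : HasGaussianLaw (fun Z : Tensor k n => tinner Z η) (noise k n) :=
    (hasGaussianLaw_noise k n).map_fun (tinnerCLM η)
  have := meas_ge_le_variance_div_sq h.memLp_two hL
  rwa [integral_tinner_noise, ← covariance_self h.aemeasurable,
    covariance_tinner_noise, show {Z : Tensor k n | L ≤ |tinner Z η - 0|} =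
      {Z | L ≤ |tinner Z η|} by simp] at this

theorem noise_tinner_tail {k n : ℕ} (η : Tensor k n) {L : ℝ} (hL : 0 ≤ L) {s : ℝ}
    (hs : tinner η η / n ≤ s) (hs0 : 0 < s) :
    noise k n {Z | L ≤ |tinner Z η|} ≤ ENNReal.ofReal (2 * Real.exp (-L ^ 2 / (2 * s))) := by
  have key : ∀ η : Tensor k n, tinner η η / n ≤ s →
      (noise k n).real {Z | L ≤ tinner Z η} ≤ Real.exp (-L ^ 2 / (2 * s)) := by
    intro η hs
    have hsub : HasSubgaussianMGF (fun Z : Tensor k n => tinner Z η) s.toNNReal (noise k n) := by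
      constructor
      · intro t
        have := integrable_exp_mul_gaussianReal (μ := 0) (v := (tinner η η / n).toNNReal) t
        rw [← (hasLaw_tinner_noise η).map_eq] at this
        exact this.comp_aemeasurable (hasLaw_tinner_noise η).aemeasurable
      · intro t
        rw [mgf_gaussianReal (hasLaw_tinner_noise η).map_eq]
        rw [Real.coe_toNNReal _ hs0.le, Real.coe_toNNReal _ (div_nonneg (tinner_self_nonneg η)
          (Nat.cast_nonneg n)), zero_mul, zero_add]
        gcongr
    have := hsub.measure_ge_le hL
    rwa [Real.coe_toNNReal _ hs0.le] at this
  have h1 := key η hs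
  have h2 := key (-η) (by simpa [tinner] using hs)
  have hsub : {Z : Tensor k n | L ≤ |tinner Z η|} ⊆
      {Z | L ≤ tinner Z η} ∪ {Z | L ≤ tinner Z (-η)} := by
    intro Z hZ
    have : tinner Z (-η) = -tinner Z η := by simp [tinner]
    simp only [Set.mem_ofPred_eq, Set.mem_union, this] at hZ ⊢
    exact le_abs.mp hZ
  refine (ENNReal.le_ofReal_iff_toReal_le (measure_ne_top _ _) (by positivity)).mpr ?_
  change (noise k n).real _ ≤ _
  calc (noise k n).real {Z | L ≤ |tinner Z η|} ≤ _ := measureReal_mono hsub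
    _ ≤ _ := measureReal_union_le _ _
    _ ≤ _ := by linarith

/-- The tensor `b ⊗ η`. -/
def outer {k n : ℕ} (b : EuclideanSpace ℝ (Fin n)) (η : Tensor k n) : Tensor (k + 1) n :=
  fun J => b (J 0) * η (Fin.tail J)

theorem sum_tensor_succ {k n : ℕ} (f : (Fin (k + 1) → Fin n) → ℝ) :
    ∑ J, f J = ∑ i : Fin n, ∑ I : Fin k → Fin n, f (Fin.cons i I) := by
  rw [← Fintype.sum_prod_type', ← (Fin.consEquiv fun _ : Fin (k + 1) => Fin n).sum_comp]
  rfl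

theorem inner_eq_sum {n : ℕ} (x y : EuclideanSpace ℝ (Fin n)) : ⟪x, y⟫ = ∑ i, x i * y i := by
  simp [PiLp.inner_apply, mul_comm]

theorem inner_single {n : ℕ} (i : Fin n) (x : EuclideanSpace ℝ (Fin n)) :
    ⟪EuclideanSpace.single i (1 : ℝ), x⟫ = x i := by
  rw [inner_eq_sum]
  simp

theorem hasGaussianLaw_tinner_family {k n : ℕ} {κ : Type*} [Fintype κ] (η : κ → Tensor k n) :
    HasGaussianLaw (fun (Z : Tensor k n) j => tinner Z (η j)) (noise k n) := by
  have := (hasGaussianLaw_noise k n).map_fun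
    (F := κ → ℝ) (ContinuousLinearMap.pi fun j => tinnerCLM (η j))
  exact this

theorem hasGaussianLaw_tinner_pair {k n : ℕ} {κ κ' : Type*} [Fintype κ] [Fintype κ']
    (η : κ → Tensor k n) (η' : κ' → Tensor k n) :
    HasGaussianLaw (fun Z : Tensor k n => (fun j => tinner Z (η j), fun j => tinner Z (η' j)))
      (noise k n) := by
  have := (hasGaussianLaw_noise k n).map_fun
    (F := (κ → ℝ) × (κ' → ℝ)) ((ContinuousLinearMap.pi fun j => tinnerCLM (η j)).prod
      (ContinuousLinearMap.pi fun j => tinnerCLM (η' j)))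
  exact this

theorem inner_act {k n : ℕ} (b : EuclideanSpace ℝ (Fin n)) (Z : Tensor (k + 1) n)
    (η : Tensor k n) : ⟪b, act Z η⟫ = tinner Z (outer b η) := by
  rw [inner_eq_sum, tinner, sum_tensor_succ]
  refine Finset.sum_congr rfl fun i _ => ?_
  simp only [act, outer, Finset.mul_sum, Fin.cons_zero, Fin.tail_cons]
  exact Finset.sum_congr rfl fun I _ => by ring

theorem tinner_outer {k n : ℕ} (b b' : EuclideanSpace ℝ (Fin n)) (η η' : Tensor k n) :
    tinner (outer b η) (outer b' η') = ⟪b, b'⟫ * tinner η η' := by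
  rw [inner_eq_sum, tinner, tinner, sum_tensor_succ, Finset.sum_mul_sum]
  refine Finset.sum_congr rfl fun i _ => Finset.sum_congr rfl fun I _ => ?_
  simp only [outer, Fin.cons_zero, Fin.tail_cons]
  ring

theorem act_apply {k n : ℕ} (Z : Tensor (k + 1) n) (η : Tensor k n) (i : Fin n) :
    act Z η i = tinner Z (outer (EuclideanSpace.single i 1) η) := by
  rw [← inner_act, inner_single]

/-- The part of `Z` whose action vanishes on the line of the unit tensor `e`. -/
def residual {k n : ℕ} (e : Tensor k n) (Z : Tensor (k + 1) n) : Tensor (k + 1) n :=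
  fun J => Z J - act Z e (J 0) * e (Fin.tail J)

@[fun_prop]
theorem measurable_act {k n : ℕ} (η : Tensor k n) :
    Measurable fun Z : Tensor (k + 1) n => act Z η := by
  unfold act; fun_prop

@[fun_prop]
theorem measurable_residual {k n : ℕ} (e : Tensor k n) : Measurable (residual e) := by
  unfold residual act; fun_prop

theorem residual_apply {k n : ℕ} (e : Tensor k n) (Z : Tensor (k + 1) n)
    (J : Fin (k + 1) → Fin n) :
    residual e Z J =
      tinner Z (Pi.single J 1 - e (Fin.tail J) • outer (EuclideanSpace.single (J 0) 1) e) := by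
  rw [residual, act_apply]
  simp [tinner, mul_sub, Finset.sum_sub_distrib, Pi.single_apply, Finset.sum_mul]
  exact Finset.sum_congr rfl fun I _ => by ring

theorem indepFun_residual_act {k n : ℕ} {e : Tensor k n} (he : tinner e e • e = e) :
    IndepFun (residual e) (fun Z => act Z e) (noise (k + 1) n) := by
  have h : IndepFun (fun (Z : Tensor (k + 1) n) J => residual e Z J) (fun Z i => act Z e i)
      (noise (k + 1) n) := by
    refine HasGaussianLaw.indepFun_of_covariance_eval ?_ fun J i => ?_
    · simp only [residual_apply, act_apply]
      exact hasGaussianLaw_tinner_pair _ _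
    · simp only [residual_apply, act_apply, covariance_tinner_noise]
      have h1 : tinner (Pi.single J 1) (outer (EuclideanSpace.single i 1) e) =
          (EuclideanSpace.single i (1 : ℝ) (J 0)) * e (Fin.tail J) := by
        rw [tinner, Finset.sum_eq_single J (fun I _ hI => by simp [hI]) (by simp)]
        simp [outer]
      have h2 : tinner (outer (EuclideanSpace.single (J 0) 1) e)
          (outer (EuclideanSpace.single i 1) e) =
          (EuclideanSpace.single i (1 : ℝ) (J 0)) * tinner e e := by
        rw [tinner_outer, inner_single]
      have h3 := congrFun he (Fin.tail J)
      simp only [Pi.smul_apply, smul_eq_mul] at h3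
      have : tinner (Pi.single J 1 - e (Fin.tail J) • outer (EuclideanSpace.single (J 0) 1) e)
          (outer (EuclideanSpace.single i 1) e) =
          tinner (Pi.single J 1) (outer (EuclideanSpace.single i 1) e) - e (Fin.tail J) *
          tinner (outer (EuclideanSpace.single (J 0) 1) e)
          (outer (EuclideanSpace.single i 1) e) := by
        simp only [tinner, Finset.mul_sum, ← Finset.sum_sub_distrib]
        exact Finset.sum_congr rfl fun I _ => by
          simp only [Pi.sub_apply, Pi.smul_apply, smul_eq_mul]; ring
      rw [this, h1, h2]
      rw [show ∀ x y z : ℝ, x * y - y * (x * z) = x * (y - z * y) by intros; ring, h3]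
      simp
  exact h.comp (φ := id) (ψ := WithLp.toLp 2) measurable_id (by fun_prop)

/-- An event that depends on `Z` through `residual e Z` and `act Z e` only is at most as probable
as its worst section with `act Z e` frozen. -/
theorem noise_le_of_frozen {k n : ℕ} {e : Tensor k n} (he : tinner e e • e = e)
    {B : Set (Tensor (k + 1) n × EuclideanSpace ℝ (Fin n))} (hB : MeasurableSet B)
    (hinv : ∀ Z γ, (residual e Z, γ) ∈ B ↔ (Z, γ) ∈ B) {δ : ENNReal}
    (hδ : ∀ γ, noise (k + 1) n {Z | (Z, γ) ∈ B} ≤ δ) :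
    noise (k + 1) n {Z | (Z, act Z e) ∈ B} ≤ δ := by
  have h1 : {Z : Tensor (k + 1) n | (Z, act Z e) ∈ B} =
      (fun Z => (residual e Z, act Z e)) ⁻¹' B := by
    ext Z; exact (hinv Z _).symm
  have hm : Measurable fun Z : Tensor (k + 1) n => (residual e Z, act Z e) := by fun_prop
  have hpr : IsProbabilityMeasure ((noise (k + 1) n).map fun Z => act Z e) :=
    Measure.isProbabilityMeasure_map (by fun_prop)
  rw [h1, ← Measure.map_apply hm hB, (indepFun_iff_map_prod_eq_prod_map_map (by fun_prop)
    (by fun_prop)).mp (indepFun_residual_act he), Measure.prod_apply_symm hB]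
  calc _ ≤ ∫⁻ _, δ ∂((noise (k + 1) n).map fun Z => act Z e) := by
        refine lintegral_mono fun γ => ?_
        rw [Measure.map_apply (by fun_prop) (measurable_prodMk_right hB)]
        convert hδ γ using 3 with Z
        ext Z
        exact hinv Z γ
    _ = δ := by simp

theorem variance_sq_gaussianReal (v : NNReal) :
    Var[fun x => x ^ 2; gaussianReal 0 v] = v ^ 2 * Var[fun x => x ^ 2; gaussianReal 0 1] := by
  have h : gaussianReal 0 v = (gaussianReal 0 1).map (fun x => √(v : ℝ) * x) := by
    rw [gaussianReal_map_const_mul]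
    congr
    · simp
    · ext; simp
  rw [h, variance_map (by fun_prop) (by fun_prop)]
  have : ((fun x : ℝ => x ^ 2) ∘ fun x => √(v : ℝ) * x) = fun x => (v : ℝ) * x ^ 2 := by
    ext x; simp [mul_pow]
  rw [this, variance_const_mul]

theorem memLp_sq_gaussianReal (v : NNReal) : MemLp (fun x : ℝ => x ^ 2) 2 (gaussianReal 0 v) := by
  have h := memLp_id_gaussianReal' (μ := 0) (v := v) 4 (by simp)
  rw [memLp_two_iff_integrable_sq (by fun_prop)]
  have := h.integrable_norm_pow (p := 4) (by simp)
  refine this.congr (ae_of_all _ fun x => ?_)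
  simp only [id, Real.norm_eq_abs, ← pow_mul]
  exact Even.pow_abs (by decide) x

theorem noise_norm_act_sq {k n : ℕ} (hn : n ≠ 0) {e : Tensor k n} (he : tinner e e = 1) {L : ℝ}
    (hL : 0 < L) :
    noise (k + 1) n {Z | L ≤ |‖act Z e‖ ^ 2 - 1|} ≤
      ENNReal.ofReal (Var[fun x => x ^ 2; gaussianReal 0 1] / n / L ^ 2) := by
  have hlaw : ∀ i : Fin n, HasLaw (fun Z : Tensor (k + 1) n => act Z e i)
      (gaussianReal 0 ((n : NNReal)⁻¹)) (noise (k + 1) n) := by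
    intro i
    simp only [act_apply]
    convert hasLaw_tinner_noise (outer (EuclideanSpace.single i 1) e) using 2
    rw [tinner_outer, he, inner_single]
    ext
    simp
  have hind : iIndepFun (fun (i : Fin n) (Z : Tensor (k + 1) n) => act Z e i)
      (noise (k + 1) n) := by
    refine HasGaussianLaw.iIndepFun_of_covariance_eq_zero ?_ fun i j hij => ?_
    · simp only [act_apply]
      exact hasGaussianLaw_tinner_family _
    · simp only [act_apply, covariance_tinner_noise, tinner_outer]
      rw [inner_single]
      simp [hij]
  have hL2 : ∀ i : Fin n, MemLp (fun Z : Tensor (k + 1) n => act Z e i ^ 2) 2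
      (noise (k + 1) n) := by
    intro i
    have := memLp_sq_gaussianReal ((n : NNReal)⁻¹)
    rw [← (hlaw i).map_eq] at this
    exact this.comp_of_map (hlaw i).aemeasurable
  have hmean : ∀ i : Fin n, ∫ Z : Tensor (k + 1) n, act Z e i ^ 2 ∂noise (k + 1) n
      = (n : ℝ)⁻¹ := by
    intro i
    have h1 := variance_of_integral_eq_zero (hlaw i).aemeasurable
      (by rw [(hlaw i).integral_eq]; simp)
    rw [← h1, (hlaw i).variance_eq, variance_id_gaussianReal]
    simp
  have hvar : ∀ i : Fin n, Var[fun Z : Tensor (k + 1) n => act Z e i ^ 2; noise (k + 1) n] =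
      ((n : ℝ)⁻¹) ^ 2 * Var[fun x => x ^ 2; gaussianReal 0 1] := by
    intro i
    have := variance_map (X := fun x : ℝ => x ^ 2) (μ := noise (k + 1) n) (by fun_prop)
      (hlaw i).aemeasurable
    rw [(hlaw i).map_eq, variance_sq_gaussianReal] at this
    simpa [Function.comp_def] using this.symm
  have hsum : ∀ Z : Tensor (k + 1) n, ‖act Z e‖ ^ 2 = (∑ i, fun Z => act Z e i ^ 2) Z := by
    intro Z
    rw [EuclideanSpace.norm_sq_eq, Finset.sum_apply]
    simp
  have hV : Var[∑ i : Fin n, fun Z : Tensor (k + 1) n => act Z e i ^ 2; noise (k + 1) n] =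
      Var[fun x => x ^ 2; gaussianReal 0 1] / n := by
    rw [IndepFun.variance_sum (fun i _ => hL2 i) fun i _ j _ hij =>
      (hind.indepFun hij).comp (φ := fun x => x ^ 2) (ψ := fun x => x ^ 2) (by fun_prop)
        (by fun_prop)]
    simp only [hvar]
    simp
    field_simp
  have hE : ∫ Z : Tensor (k + 1) n, (∑ i, fun Z : Tensor (k + 1) n => act Z e i ^ 2) Z
      ∂noise (k + 1) n = 1 := by
    simp only [Finset.sum_apply]
    rw [integral_finsetSum _ fun i _ => (hL2 i).integrable one_le_two]
    simp only [hmean]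
    simp [hn]
  have := meas_ge_le_variance_div_sq (memLp_finsetSum' Finset.univ fun i _ => hL2 i) hL
  rw [hE, hV] at this
  simpa only [hsum] using this

/-- An adaptive strategy: in state `s` the tensor `Z` is queried at `Q s`, and the answer
`act Z (Q s)` is used to update the state. -/
def run {k n : ℕ} {S : Type} (Q : S → Tensor k n) (U : S → EuclideanSpace ℝ (Fin n) → S)
    (Z : Tensor (k + 1) n) (s : S) : ℕ → S
  | 0 => s
  | t + 1 => U (run Q U Z s t) (act Z (Q (run Q U Z s t)))

theorem run_succ' {k n : ℕ} {S : Type} (Q : S → Tensor k n)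
    (U : S → EuclideanSpace ℝ (Fin n) → S) (Z : Tensor (k + 1) n) (s : S) (t : ℕ) :
    run Q U Z s (t + 1) = run Q U Z (U s (act Z (Q s))) t := by
  induction t with
  | zero => rfl
  | succ t ih => rw [run, ih]; rfl

@[fun_prop]
theorem measurable_act_uncurry {k n : ℕ} :
    Measurable fun p : Tensor (k + 1) n × Tensor k n => act p.1 p.2 := by
  unfold act; fun_prop

@[fun_prop]
theorem measurable_tinner_uncurry {k n : ℕ} :
    Measurable fun p : Tensor k n × Tensor k n => tinner p.1 p.2 := by
  unfold tinner; fun_prop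

theorem measurable_run {k n : ℕ} {S : Type} [MeasurableSpace S] {Q : S → Tensor k n}
    {U : S → EuclideanSpace ℝ (Fin n) → S} (hQ : Measurable Q)
    (hU : Measurable fun p : S × EuclideanSpace ℝ (Fin n) => U p.1 p.2) (t : ℕ) :
    Measurable fun p : Tensor (k + 1) n × S => run Q U p.1 p.2 t := by
  induction t with
  | zero => exact measurable_snd
  | succ t ih =>
    exact hU.comp (ih.prodMk (measurable_act_uncurry.comp (measurable_fst.prodMk (hQ.comp ih))))

/-- The triples `(Z, s, b)` for which one of the first `K` answers, when the strategy is started in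
`s`, is atypically large in the direction `b`. -/
def atypical {k n : ℕ} {S : Type} (Q : S → Tensor k n) (U : S → EuclideanSpace ℝ (Fin n) → S)
    (L : ℝ) (K : ℕ) : Set (Tensor (k + 1) n × S × EuclideanSpace ℝ (Fin n)) :=
  {p | ∃ t < K, ((t : ℝ) + 1) * L * √(tinner (Q (run Q U p.1 p.2.1 t)) (Q (run Q U p.1 p.2.1 t))) <
    |⟪p.2.2, act p.1 (Q (run Q U p.1 p.2.1 t))⟫|}

theorem measurableSet_atypical {k n : ℕ} {S : Type} [MeasurableSpace S] {Q : S → Tensor k n}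
    {U : S → EuclideanSpace ℝ (Fin n) → S} (hQ : Measurable Q)
    (hU : Measurable fun p : S × EuclideanSpace ℝ (Fin n) => U p.1 p.2) (L : ℝ) (K : ℕ) :
    MeasurableSet (atypical Q U L K) := by
  have h : atypical Q U L K = ⋃ t ∈ Set.Iio K,
      {p | ((t : ℝ) + 1) * L * √(tinner (Q (run Q U p.1 p.2.1 t)) (Q (run Q U p.1 p.2.1 t))) <
        |⟪p.2.2, act p.1 (Q (run Q U p.1 p.2.1 t))⟫|} := by
    ext p; simp [atypical]
  rw [h]
  refine MeasurableSet.biUnion (Set.to_countable _) fun t _ => ?_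
  have hr : Measurable fun p : Tensor (k + 1) n × S × EuclideanSpace ℝ (Fin n) =>
      Q (run Q U p.1 p.2.1 t) :=
    hQ.comp ((measurable_run hQ hU t).comp
      (measurable_fst.prodMk (measurable_fst.comp measurable_snd)))
  have hact : Measurable fun p : Tensor (k + 1) n × S × EuclideanSpace ℝ (Fin n) =>
      act p.1 (Q (run Q U p.1 p.2.1 t)) :=
    measurable_act_uncurry.comp (measurable_fst.prodMk hr)
  have htin : Measurable fun p : Tensor (k + 1) n × S × EuclideanSpace ℝ (Fin n) =>
      tinner (Q (run Q U p.1 p.2.1 t)) (Q (run Q U p.1 p.2.1 t)) :=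
    measurable_tinner_uncurry.comp (hr.prodMk hr)
  refine measurableSet_lt ?_ ?_
  · exact htin.sqrt.const_mul _
  · exact ((measurable_snd.comp measurable_snd).inner hact).abs

theorem tinner_comm {k n : ℕ} (η η' : Tensor k n) : tinner η η' = tinner η' η :=
  Finset.sum_congr rfl fun _ _ => mul_comm _ _

theorem tinner_sub_right {k n : ℕ} (η η₁ η₂ : Tensor k n) :
    tinner η (η₁ - η₂) = tinner η η₁ - tinner η η₂ := by
  simp [tinner, mul_sub, Finset.sum_sub_distrib]

theorem tinner_smul_right {k n : ℕ} (c : ℝ) (η η' : Tensor k n) :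
    tinner η (c • η') = c * tinner η η' := by
  simp [tinner, Finset.mul_sum, mul_left_comm]

theorem tinner_smul_left {k n : ℕ} (c : ℝ) (η η' : Tensor k n) :
    tinner (c • η) η' = c * tinner η η' := by
  rw [tinner_comm, tinner_smul_right, tinner_comm]

theorem tinner_sub_left {k n : ℕ} (η η₁ η₂ : Tensor k n) :
    tinner (η₁ - η₂) η = tinner η₁ η - tinner η₂ η := by
  simp [tinner, sub_mul, Finset.sum_sub_distrib]

theorem act_add_right {k n : ℕ} (Z : Tensor (k + 1) n) (η η' : Tensor k n) :
    act Z (η + η') = act Z η + act Z η' := by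
  ext i; simp [act, mul_add, Finset.sum_add_distrib]

theorem act_smul_right {k n : ℕ} (Z : Tensor (k + 1) n) (c : ℝ) (η : Tensor k n) :
    act Z (c • η) = c • act Z η := by
  ext i; simp [act, Finset.mul_sum, mul_left_comm]

theorem act_residual {k n : ℕ} (e : Tensor k n) (Z : Tensor (k + 1) n) (η : Tensor k n) :
    act (residual e Z) η = act Z η - tinner e η • act Z e := by
  ext i
  simp only [act, residual, tinner, Fin.cons_zero, Fin.tail_cons, PiLp.sub_apply, PiLp.smul_apply,
    smul_eq_mul, sub_mul, Finset.sum_sub_distrib]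
  congr 1
  rw [Finset.sum_mul]
  exact Finset.sum_congr rfl fun I _ => by ring

/-- The projection of `η` along the tensor `e`. -/
def projT {k n : ℕ} (e η : Tensor k n) : Tensor k n := η - tinner e η • e

theorem tinner_projT {k n : ℕ} {e : Tensor k n} (he : tinner e e • e = e) (η : Tensor k n) :
    tinner e (projT e η) = 0 := by
  have h : tinner (tinner e e • e) η = tinner e η := by rw [he]
  rw [tinner_smul_left] at h
  rw [projT, tinner_sub_right, tinner_smul_right]
  linarith

theorem tinner_projT_self {k n : ℕ} {e : Tensor k n} (he : tinner e e • e = e) (η : Tensor k n) :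
    tinner (projT e η) (projT e η) = tinner η η - tinner e η ^ 2 := by
  have h := tinner_projT he η
  conv_lhs => enter [1]; rw [projT]
  rw [tinner_sub_left, tinner_smul_left, h, projT, tinner_sub_right, tinner_smul_right,
    tinner_comm η e]
  ring

theorem act_residual_projT {k n : ℕ} {e : Tensor k n} (he : tinner e e • e = e)
    (Z : Tensor (k + 1) n) (η : Tensor k n) :
    act (residual e Z) (projT e η) = act Z (projT e η) := by
  rw [act_residual, tinner_projT he]; simp

theorem act_projT_add {k n : ℕ} (e : Tensor k n) (Z : Tensor (k + 1) n) (η : Tensor k n) :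
    act Z (projT e η) + tinner e η • act Z e = act Z η := by
  rw [← act_smul_right, ← act_add_right]; simp [projT]

@[fun_prop]
theorem measurable_projT {k n : ℕ} (e : Tensor k n) : Measurable (projT e) := by
  unfold projT tinner; fun_prop

theorem run_residual {k n : ℕ} {S : Type} {e : Tensor k n} (he : tinner e e • e = e)
    {Q : S → Tensor k n} {U : S → EuclideanSpace ℝ (Fin n) → S}
    (Z : Tensor (k + 1) n) (s : S) (t : ℕ) :
    run (fun s => projT e (Q s)) U (residual e Z) s t = run (fun s => projT e (Q s)) U Z s t := by
  induction t with
  | zero => rfl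
  | succ t ih => simp only [run, ih, act_residual_projT he]

theorem residual_mem_atypical {k n : ℕ} {S : Type} {e : Tensor k n} (he : tinner e e • e = e)
    {Q : S → Tensor k n} {U : S → EuclideanSpace ℝ (Fin n) → S} {L : ℝ} {K : ℕ}
    (Z : Tensor (k + 1) n) (s : S) (b : EuclideanSpace ℝ (Fin n)) :
    (residual e Z, s, b) ∈ atypical (fun s => projT e (Q s)) U L K ↔
      (Z, s, b) ∈ atypical (fun s => projT e (Q s)) U L K := by
  simp only [atypical, Set.mem_ofPred_eq, run_residual he, act_residual_projT he]

/-- Update of a strategy that remembers the answer `γ` to a first query at `e` and asks only for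
the part of its queries orthogonal to `e`. -/
def frozenUpdate {k n : ℕ} {S : Type} (e : Tensor k n) (Q : S → Tensor k n)
    (U : S → EuclideanSpace ℝ (Fin n) → S) (s : S × EuclideanSpace ℝ (Fin n))
    (y : EuclideanSpace ℝ (Fin n)) : S × EuclideanSpace ℝ (Fin n) :=
  (U s.1 (y + tinner e (Q s.1) • s.2), s.2)

theorem run_frozen {k n : ℕ} {S : Type} (e : Tensor k n) (Q : S → Tensor k n)
    (U : S → EuclideanSpace ℝ (Fin n) → S) (Z : Tensor (k + 1) n) (s : S) (t : ℕ) :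
    run (fun s => projT e (Q s.1)) (frozenUpdate e Q U) Z (s, act Z e) t =
      (run Q U Z s t, act Z e) := by
  induction t with
  | zero => rfl
  | succ t ih => simp only [run, ih, frozenUpdate, act_projT_add]

theorem measurable_frozenUpdate {k n : ℕ} {S : Type} [MeasurableSpace S] (e : Tensor k n)
    {Q : S → Tensor k n} {U : S → EuclideanSpace ℝ (Fin n) → S} (hQ : Measurable Q)
    (hU : Measurable fun p : S × EuclideanSpace ℝ (Fin n) => U p.1 p.2) :
    Measurable fun p : (S × EuclideanSpace ℝ (Fin n)) × EuclideanSpace ℝ (Fin n) =>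
      frozenUpdate e Q U p.1 p.2 := by
  have h1 : Measurable fun p : (S × EuclideanSpace ℝ (Fin n)) × EuclideanSpace ℝ (Fin n) =>
      tinner e (Q p.1.1) :=
    measurable_tinner_uncurry.comp (measurable_const.prodMk
      (hQ.comp (measurable_fst.comp measurable_fst)))
  have h2 : Measurable fun p : (S × EuclideanSpace ℝ (Fin n)) × EuclideanSpace ℝ (Fin n) =>
      p.2 + tinner e (Q p.1.1) • p.1.2 :=
    measurable_snd.add (h1.smul (measurable_snd.comp measurable_fst))
  have h3 : Measurable fun p : (S × EuclideanSpace ℝ (Fin n)) × EuclideanSpace ℝ (Fin n) =>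
      p.1.1 := measurable_fst.comp measurable_fst
  exact (hU.comp (h3.prodMk h2)).prodMk (measurable_snd.comp measurable_fst)

theorem noise_frozen_le {k n : ℕ} {W : Type} [MeasurableSpace W] {e : Tensor k n}
    (he : tinner e e • e = e) {A : Set (Tensor (k + 1) n × W)} (hA : MeasurableSet A)
    (hinv : ∀ Z w, (residual e Z, w) ∈ A ↔ (Z, w) ∈ A)
    {f : EuclideanSpace ℝ (Fin n) → W} (hf : Measurable f) {δ : ENNReal}
    (hδ : ∀ γ, noise (k + 1) n {Z | (Z, f γ) ∈ A} ≤ δ) :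
    noise (k + 1) n {Z | (Z, f (act Z e)) ∈ A} ≤ δ :=
  noise_le_of_frozen he (B := (fun p => (p.1, f p.2)) ⁻¹' A)
    ((measurable_fst.prodMk (hf.comp measurable_snd)) hA) (fun Z γ => hinv Z (f γ)) hδ

theorem noise_frozen_atypical_le {k n : ℕ} {S : Type} [MeasurableSpace S] {e : Tensor k n}
    (he : tinner e e • e = e) {Q : S → Tensor k n} {U : S → EuclideanSpace ℝ (Fin n) → S}
    (hQ : Measurable Q) (hU : Measurable fun p : S × EuclideanSpace ℝ (Fin n) => U p.1 p.2)
    {L : ℝ} {K : ℕ} {σ : EuclideanSpace ℝ (Fin n) → S} (hσ : Measurable σ)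
    {b : EuclideanSpace ℝ (Fin n) → EuclideanSpace ℝ (Fin n)} (hb : Measurable b) {δ : ENNReal}
    (hδ : ∀ γ, noise (k + 1) n
      {Z | (Z, σ γ, b γ) ∈ atypical (fun s => projT e (Q s)) U L K} ≤ δ) :
    noise (k + 1) n {Z | (Z, σ (act Z e), b (act Z e)) ∈
      atypical (fun s => projT e (Q s)) U L K} ≤ δ :=
  noise_frozen_le he (measurableSet_atypical ((measurable_projT e).comp hQ) hU L K)
    (fun Z w => residual_mem_atypical he Z w.1 w.2) (f := fun γ => (σ γ, b γ))
    (hσ.prodMk hb) hδ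

/-- Along an adaptive strategy, the answers of a noise tensor have only components of order
`n^{-1/2}` in a fixed direction. -/
theorem noise_atypical_le {k n : ℕ} {S : Type} [MeasurableSpace S] {Q : S → Tensor k n}
    {U : S → EuclideanSpace ℝ (Fin n) → S} (hQ : Measurable Q)
    (hU : Measurable fun p : S × EuclideanSpace ℝ (Fin n) => U p.1 p.2) {L : ℝ} (hL : 0 < L)
    (K : ℕ) (s : S) {b : EuclideanSpace ℝ (Fin n)} (hb : ‖b‖ ≤ 1) :
    noise (k + 1) n {Z | (Z, s, b) ∈ atypical Q U L K} ≤ K * ENNReal.ofReal (1 / n / L ^ 2) := by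
  induction K generalizing S with
  | zero => simp [atypical]
  | succ K ih =>
    set c : ℝ := √(tinner (Q s) (Q s)) with hc
    set e : Tensor k n := c⁻¹ • Q s with he_def
    have hc2 : c * c = tinner (Q s) (Q s) := Real.mul_self_sqrt (tinner_self_nonneg _)
    have hee : tinner e e = c⁻¹ * c⁻¹ * (c * c) := by
      rw [he_def, tinner_smul_left, tinner_smul_right, hc2]; ring
    have he : tinner e e • e = e := by
      rw [hee, he_def, smul_smul]
      rcases eq_or_ne c 0 with h | h
      · simp [h]
      · congr 1; field_simp
    have hee1 : tinner e e ≤ 1 := by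
      rw [hee]
      rcases eq_or_ne c 0 with h | h
      · simp [h]
      · exact le_of_eq (by field_simp)
    have hQe : Q s = c • e := by
      rcases eq_or_ne c 0 with h | h
      · have h0 : tinner (Q s) (Q s) = 0 := by rw [← hc2, h]; simp
        rw [tinner, Finset.sum_eq_zero_iff_of_nonneg fun _ _ => mul_self_nonneg _] at h0
        rw [h, zero_smul]
        ext I
        exact mul_self_eq_zero.mp (h0 I (Finset.mem_univ I))
      · rw [he_def, smul_smul, mul_inv_cancel₀ h, one_smul]
    have hQ' : Measurable fun s : S × EuclideanSpace ℝ (Fin n) => projT e (Q s.1) := by fun_prop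
    have hU' := measurable_frozenUpdate e hQ hU
    have hσ : Measurable fun γ : EuclideanSpace ℝ (Fin n) => U s (c • γ) :=
      hU.comp (measurable_const.prodMk (measurable_id.const_smul c))
    have h1 := noise_frozen_atypical_le he (hQ.comp measurable_fst) hU' (L := L) (K := K)
      (hσ.prodMk measurable_id) (measurable_const (a := b)) (fun γ => ih hQ' hU' (U s (c • γ), γ))
    have h2 : noise (k + 1) n {Z | L ≤ |tinner Z (outer b e)|} ≤
        ENNReal.ofReal (1 / n / L ^ 2) := by
      refine (noise_tinner_chebyshev _ hL).trans (ENNReal.ofReal_le_ofReal ?_)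
      rw [tinner_outer, real_inner_self_eq_norm_sq]
      gcongr
      exact mul_le_one₀ (pow_le_one₀ (norm_nonneg b) hb) (tinner_self_nonneg e) hee1
    have hsub : {Z | (Z, s, b) ∈ atypical Q U L (K + 1)} ⊆
        {Z | (Z, (U s (c • act Z e), act Z e), b) ∈
          atypical (fun s => projT e (Q s.1)) (frozenUpdate e Q U) L K} ∪ {Z | L ≤ |tinner Z (outer b e)|} := by
      rintro Z ⟨t, ht, hlt⟩
      simp only at hlt
      by_contra hcon
      simp only [Set.mem_union, Set.mem_ofPred_eq, not_or, not_le] at hcon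
      obtain ⟨hZ1, hZ2⟩ := hcon
      rw [← inner_act] at hZ2
      cases t with
      | zero =>
        simp only [run, Nat.cast_zero, zero_add, one_mul, ← hc] at hlt
        rw [hQe, act_smul_right, real_inner_smul_right, abs_mul,
          abs_of_nonneg (Real.sqrt_nonneg _)] at hlt
        nlinarith [mul_le_mul_of_nonneg_left hZ2.le (Real.sqrt_nonneg (tinner (Q s) (Q s)))]
      | succ t =>
        apply hZ1
        refine ⟨t, by omega, ?_⟩
        have hU1 : U s (c • act Z e) = U s (act Z (Q s)) := by
          conv_rhs => rw [hQe, act_smul_right]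
        simp only
        rw [hU1, run_frozen]
        rw [run_succ'] at hlt
        set s' := run Q U Z (U s (act Z (Q s))) t
        rw [← act_projT_add e Z (Q s'), inner_add_right, real_inner_smul_right] at hlt
        have h3 := tinner_projT_self he (Q s')
        have h4 : √(tinner (projT e (Q s')) (projT e (Q s'))) ≤ √(tinner (Q s') (Q s')) :=
          Real.sqrt_le_sqrt (by nlinarith [sq_nonneg (tinner e (Q s'))])
        have h5 : |tinner e (Q s')| ≤ √(tinner (Q s') (Q s')) :=
          Real.abs_le_sqrt (by nlinarith [tinner_self_nonneg (projT e (Q s'))])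
        have h6 : |tinner e (Q s') * ⟪b, act Z e⟫| ≤ √(tinner (Q s') (Q s')) * L := by
          rw [abs_mul]
          gcongr
        have h7 := abs_add_le ⟪b, act Z (projT e (Q s'))⟫ (tinner e (Q s') * ⟪b, act Z e⟫)
        push_cast at hlt
        have h8 : ((t : ℝ) + 1) * L * √(tinner (projT e (Q s')) (projT e (Q s'))) ≤
            ((t : ℝ) + 1) * L * √(tinner (Q s') (Q s')) := by gcongr
        linarith
    calc _ ≤ _ := measure_mono hsub
      _ ≤ _ := measure_union_le _ _
      _ ≤ _ := add_le_add h1 h2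
      _ = _ := by push_cast; ring

/-- The elementary tensor `x₁ ⊗ ⋯ ⊗ x_k`. -/
def elementary {k n : ℕ} (x : Fin k → EuclideanSpace ℝ (Fin n)) : Tensor k n :=
  fun I => ∏ j, x j (I j)

theorem tinner_elementary {k n : ℕ} (x y : Fin k → EuclideanSpace ℝ (Fin n)) :
    tinner (elementary x) (elementary y) = ∏ j, ⟪x j, y j⟫ := by
  simp only [inner_eq_sum, tinner, elementary]
  rw [Finset.prod_univ_sum]
  simp [Finset.prod_mul_distrib]

theorem tinner_tpow {k n : ℕ} (x y : EuclideanSpace ℝ (Fin n)) :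
    tinner (tpow k x) (tpow k y) = ⟪x, y⟫ ^ k := by
  have := tinner_elementary (k := k) (fun _ => x) (fun _ => y)
  rw [Finset.prod_const, Finset.card_univ, Fintype.card_fin] at this
  exact this

/-- The multilinear form attached to a tensor. -/
def mform {k n : ℕ} (Z : Tensor k n) :
    MultilinearMap ℝ (fun _ : Fin k => EuclideanSpace ℝ (Fin n)) ℝ :=
  ∑ I, Z I • (MultilinearMap.mkPiAlgebra ℝ (Fin k) ℝ).compLinearMap
    (fun j => (EuclideanSpace.proj (I j) : EuclideanSpace ℝ (Fin n) →L[ℝ] ℝ).toLinearMap)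

theorem mform_apply {k n : ℕ} (Z : Tensor k n) (x : Fin k → EuclideanSpace ℝ (Fin n)) :
    mform Z x = tinner Z (elementary x) := by
  simp [mform, tinner, elementary]

/-- The points of the lattice `n^{-1/2} ℤⁿ` of norm at most `3/2`. -/
def latticeNet (n : ℕ) : Finset (EuclideanSpace ℝ (Fin n)) :=
  ((Fintype.piFinset fun _ : Fin n => Finset.Icc (-(2 * n : ℤ)) (2 * n)).filter
    (fun z : Fin n → ℤ => 4 * ∑ i, z i ^ 2 ≤ 9 * (n : ℤ))).image
    fun z => WithLp.toLp 2 fun i => (z i : ℝ) / √(n : ℝ)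

theorem norm_le_of_mem_latticeNet {n : ℕ} {y : EuclideanSpace ℝ (Fin n)}
    (hy : y ∈ latticeNet n) : ‖y‖ ≤ 3 / 2 := by
  simp only [latticeNet, Finset.mem_image, Finset.mem_filter] at hy
  obtain ⟨z, ⟨-, hz⟩, rfl⟩ := hy
  refine le_of_sq_le_sq ?_ (by norm_num)
  rw [EuclideanSpace.norm_sq_eq]
  simp only [Real.norm_eq_abs, sq_abs, div_pow, Real.sq_sqrt (Nat.cast_nonneg n),
    ← Finset.sum_div]
  have : (4 : ℝ) * ∑ i, (z i : ℝ) ^ 2 ≤ 9 * n := by exact_mod_cast hz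
  exact div_le_of_le_mul₀ (Nat.cast_nonneg n) (by norm_num) (by linarith)

theorem exists_mem_latticeNet {n : ℕ} {x : EuclideanSpace ℝ (Fin n)} (hx : ‖x‖ ≤ 1) :
    ∃ y ∈ latticeNet n, ‖x - y‖ ≤ 1 / 2 := by
  rcases Nat.eq_zero_or_pos n with rfl | hn
  · exact ⟨0, by simp [latticeNet, Subsingleton.elim _ (0 : EuclideanSpace ℝ (Fin 0))],
      by simp [Subsingleton.elim x 0]⟩
  have hn' : (0 : ℝ) < n := by exact_mod_cast hn
  have hs : 0 < √(n : ℝ) := Real.sqrt_pos.mpr hn'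
  set z : Fin n → ℤ := fun i => round (√(n : ℝ) * x i) with hz
  set y : EuclideanSpace ℝ (Fin n) := WithLp.toLp 2 fun i => (z i : ℝ) / √(n : ℝ) with hy
  have hxy : ‖x - y‖ ≤ 1 / 2 := by
    refine le_of_sq_le_sq ?_ (by norm_num)
    rw [EuclideanSpace.norm_sq_eq]
    calc ∑ i, ‖(x - y) i‖ ^ 2 ≤ ∑ _i : Fin n, 1 / (4 * (n : ℝ)) := by
          refine Finset.sum_le_sum fun i _ => ?_
          have h1 : (x - y) i = (√(n : ℝ) * x i - z i) / √(n : ℝ) := by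
            simp only [hy, PiLp.sub_apply]; field_simp
          have h2 := abs_sub_round (√(n : ℝ) * x i)
          rw [h1, norm_div, div_pow, Real.norm_eq_abs, Real.norm_eq_abs, sq_abs √(n : ℝ),
            Real.sq_sqrt hn'.le, div_le_div_iff₀ hn' (by positivity)]
          have : |√(n : ℝ) * x i - z i| ^ 2 ≤ (1 / 2) ^ 2 := by gcongr
          nlinarith
      _ = (1 / 2) ^ 2 := by simp; field_simp; norm_num
  have hyn : ‖y‖ ≤ 3 / 2 := by
    have := norm_sub_norm_le y x
    rw [norm_sub_rev] at this
    linarith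
  have hsum : 4 * ∑ i, z i ^ 2 ≤ 9 * (n : ℤ) := by
    have h1 : ‖y‖ ^ 2 ≤ (3 / 2) ^ 2 := by gcongr
    rw [EuclideanSpace.norm_sq_eq] at h1
    simp only [hy, Real.norm_eq_abs, sq_abs, div_pow, Real.sq_sqrt hn'.le,
      ← Finset.sum_div] at h1
    rw [div_le_iff₀ hn'] at h1
    have : (4 : ℝ) * ∑ i, (z i : ℝ) ^ 2 ≤ 9 * n := by linarith
    exact_mod_cast this
  refine ⟨y, Finset.mem_image.mpr ⟨z, Finset.mem_filter.mpr ⟨Fintype.mem_piFinset.mpr fun i => ?_,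
    hsum⟩, rfl⟩, hxy⟩
  have h1 : z i ^ 2 ≤ ∑ i, z i ^ 2 :=
    Finset.single_le_sum (f := fun i => z i ^ 2) (fun i _ => sq_nonneg _) (Finset.mem_univ i)
  have hn1 : (1 : ℤ) ≤ n := by exact_mod_cast hn
  have h2 : z i ^ 2 ≤ (2 * n : ℤ) ^ 2 := by nlinarith
  exact Finset.mem_Icc.mpr (abs_le.mp (abs_le_of_sq_le_sq h2 (by positivity)))

theorem exists_card_latticeNet_le : ∃ D : ℝ, 1 ≤ D ∧ ∀ n : ℕ, ((latticeNet n).card : ℝ) ≤ D ^ n := by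
  have hs : Summable fun z : ℤ => (1 / 2 : ℝ) ^ z.natAbs := by
    refine Summable.of_nat_of_neg ?_ ?_ <;> simpa using summable_geometric_two
  set C := ∑' z : ℤ, (1 / 2 : ℝ) ^ z.natAbs
  have hC : 1 ≤ C := by
    simpa only [Int.natAbs_zero, pow_zero] using hs.le_tsum 0 (fun _ _ => by positivity)
  refine ⟨8 * C, by linarith, fun n => ?_⟩
  set s := Fintype.piFinset fun _ : Fin n => Finset.Icc (-(2 * n : ℤ)) (2 * n)
  calc ((latticeNet n).card : ℝ)
      ≤ ((s.filter (fun z : Fin n → ℤ => 4 * ∑ i, z i ^ 2 ≤ 9 * (n : ℤ))).card : ℝ) := by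
        exact_mod_cast Finset.card_image_le
    _ = ∑ z ∈ s.filter (fun z : Fin n → ℤ => 4 * ∑ i, z i ^ 2 ≤ 9 * (n : ℤ)), (1 : ℝ) := by simp
    _ ≤ ∑ z ∈ s.filter (fun z : Fin n → ℤ => 4 * ∑ i, z i ^ 2 ≤ 9 * (n : ℤ)),
          8 ^ n * ∏ i, (1 / 2 : ℝ) ^ (z i).natAbs := by
        refine Finset.sum_le_sum fun z hz => ?_
        have h1 := (Finset.mem_filter.mp hz).2
        have h2 : ∑ i, (z i).natAbs ≤ 3 * n := by
          have : ∀ i, ((z i).natAbs : ℤ) ≤ z i ^ 2 := fun i => by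
            rw [← Int.natAbs_sq]
            exact_mod_cast Nat.le_self_pow two_ne_zero _
          have h3 := Finset.sum_le_sum fun i (_ : i ∈ Finset.univ) => this i
          zify
          push_cast at h1 h3 ⊢
          omega
        rw [Finset.prod_pow_eq_pow_sum, show (8 : ℝ) = 2 ^ 3 by norm_num, ← pow_mul, one_div,
          inv_pow]
        rw [← div_eq_mul_inv, le_div_iff₀ (by positivity), one_mul]
        exact pow_le_pow_right₀ (by norm_num) h2
    _ ≤ ∑ z ∈ s, 8 ^ n * ∏ i, (1 / 2 : ℝ) ^ (z i).natAbs :=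
        Finset.sum_le_sum_of_subset_of_nonneg (Finset.filter_subset _ _)
          fun _ _ _ => by positivity
    _ = 8 ^ n * ∏ _i : Fin n, ∑ z ∈ Finset.Icc (-(2 * n : ℤ)) (2 * n),
          (1 / 2 : ℝ) ^ z.natAbs := by
        rw [← Finset.mul_sum, Finset.prod_univ_sum]
    _ ≤ 8 ^ n * ∏ _i : Fin n, C := by
        gcongr
        exact hs.sum_le_tsum _ fun _ _ => by positivity
    _ = (8 * C) ^ n := by simp [mul_pow]

theorem abs_le_of_latticeNet {n : ℕ} (f : EuclideanSpace ℝ (Fin n) →L[ℝ] ℝ) {B : ℝ}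
    (hf : ∀ y ∈ latticeNet n, |f y| ≤ B) (x : EuclideanSpace ℝ (Fin n)) :
    |f x| ≤ 2 * B * ‖x‖ := by
  have hB : 0 ≤ B := by
    obtain ⟨y, hy, -⟩ := exists_mem_latticeNet (n := n) (x := 0) (by simp)
    exact (abs_nonneg _).trans (hf y hy)
  have h : ‖f‖ ≤ B + ‖f‖ * (1 / 2) := by
    refine ContinuousLinearMap.opNorm_le_of_unit_norm (by positivity) fun x hx => ?_
    obtain ⟨y, hy, hxy⟩ := exists_mem_latticeNet hx.le
    calc ‖f x‖ = ‖f y + f (x - y)‖ := by rw [← map_add]; simp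
      _ ≤ ‖f y‖ + ‖f (x - y)‖ := norm_add_le _ _
      _ ≤ B + ‖f‖ * (1 / 2) := by
        gcongr
        · exact hf y hy
        · exact (f.le_opNorm _).trans (by gcongr)
  exact (f.le_opNorm x).trans (by gcongr; linarith)

theorem abs_mform_le_of_latticeNet {k n : ℕ} (Z : Tensor k n) {B : ℝ}
    (hB : ∀ x : Fin k → EuclideanSpace ℝ (Fin n), (∀ j, x j ∈ latticeNet n) → |mform Z x| ≤ B)
    (x : Fin k → EuclideanSpace ℝ (Fin n)) : |mform Z x| ≤ 2 ^ k * B * ∏ j, ‖x j‖ := by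
  suffices h : ∀ (s : Finset (Fin k)) (x : Fin k → EuclideanSpace ℝ (Fin n)),
      (∀ j ∉ s, x j ∈ latticeNet n) → |mform Z x| ≤ 2 ^ s.card * B * ∏ j ∈ s, ‖x j‖ by
    simpa using h Finset.univ x (by simp)
  intro s
  induction s using Finset.induction_on with
  | empty => intro x hx; simpa using hB x fun j => hx j (by simp)
  | insert a s ha ih =>
    intro x hx
    have h := abs_le_of_latticeNet (((mform Z).toLinearMap x a).toContinuousLinearMap)
      (B := 2 ^ s.card * B * ∏ j ∈ s, ‖x j‖) (fun y hy => ?_) (x a)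
    · rw [LinearMap.coe_toContinuousLinearMap', MultilinearMap.toLinearMap_apply,
        Function.update_eq_self] at h
      rw [Finset.card_insert_of_notMem ha, Finset.prod_insert ha, pow_succ]
      linarith
    · rw [LinearMap.coe_toContinuousLinearMap', MultilinearMap.toLinearMap_apply]
      have h := ih (Function.update x a y) fun j hj => ?_
      · rwa [Finset.prod_congr rfl fun j hj => by
          rw [Function.update_of_ne (ne_of_mem_of_not_mem hj ha)]] at h
      · rcases eq_or_ne j a with rfl | hja
        · simpa using hy
        · rw [Function.update_of_ne hja]
          exact hx j (by simp [hja, hj])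

/-- The injective norm of a noise tensor is bounded, uniformly in the dimension. -/
theorem exists_noise_mform_le (k : ℕ) : ∃ M : ℝ, 1 ≤ M ∧ ∀ n : ℕ, 1 ≤ n →
    noise k n {Z | ∀ x, |mform Z x| ≤ M * ∏ j, ‖x j‖}ᶜ ≤ ENNReal.ofReal (2 * Real.exp (-n)) := by
  obtain ⟨D, hD1, hD⟩ := exists_card_latticeNet_le
  have hlog : 0 ≤ Real.log D := Real.log_nonneg hD1
  set L : ℝ := √(2 * (9 / 4) ^ k * (k * Real.log D + 1)) with hL
  have hL2 : L ^ 2 = 2 * (9 / 4) ^ k * (k * Real.log D + 1) := Real.sq_sqrt (by positivity)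
  refine ⟨2 ^ k * (L + 1), ?_, fun n hn => ?_⟩
  · have := one_le_pow₀ (M₀ := ℝ) one_le_two (n := k)
    nlinarith [Real.sqrt_nonneg (2 * (9 / 4) ^ k * (k * Real.log D + 1))]
  have hn' : (0 : ℝ) < n := by exact_mod_cast hn
  set N := Fintype.piFinset fun _ : Fin k => latticeNet n
  have hsub : {Z : Tensor k n | ∀ x, |mform Z x| ≤ 2 ^ k * (L + 1) * ∏ j, ‖x j‖}ᶜ ⊆
      ⋃ x ∈ N, {Z | L ≤ |tinner Z (elementary x)|} := by
    intro Z hZ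
    by_contra hcon
    simp only [Set.mem_iUnion, Set.mem_ofPred_eq, not_exists, not_le, ← mform_apply] at hcon
    refine hZ fun x => abs_mform_le_of_latticeNet Z (fun x hx => ?_) x
    have := hcon x (Fintype.mem_piFinset.mpr hx)
    linarith
  have htail : ∀ x ∈ N, noise k n {Z | L ≤ |tinner Z (elementary x)|} ≤
      ENNReal.ofReal (2 * Real.exp (-(n * (k * Real.log D + 1)))) := by
    intro x hx
    have h1 : tinner (elementary x) (elementary x) ≤ (9 / 4) ^ k := by
      rw [tinner_elementary]
      calc ∏ j, ⟪x j, x j⟫ ≤ ∏ _j : Fin k, (9 / 4 : ℝ) := by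
            refine Finset.prod_le_prod (fun j _ => real_inner_self_nonneg) fun j _ => ?_
            rw [real_inner_self_eq_norm_sq]
            have := norm_le_of_mem_latticeNet (Fintype.mem_piFinset.mp hx j)
            nlinarith [norm_nonneg (x j)]
        _ = (9 / 4) ^ k := by rw [Finset.prod_const, Finset.card_univ, Fintype.card_fin]
    convert noise_tinner_tail (elementary x) (L := L) (Real.sqrt_nonneg _)
      (s := (9 / 4) ^ k / n) (by gcongr) (by positivity) using 4
    rw [hL2]
    field_simp
  calc _ ≤ _ := measure_mono hsub
    _ ≤ ∑ x ∈ N, noise k n {Z | L ≤ |tinner Z (elementary x)|} := measure_biUnion_finset_le _ _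
    _ ≤ ∑ _x ∈ N, ENNReal.ofReal (2 * Real.exp (-(n * (k * Real.log D + 1)))) :=
        Finset.sum_le_sum htail
    _ = ENNReal.ofReal (N.card * (2 * Real.exp (-(n * (k * Real.log D + 1))))) := by
        rw [Finset.sum_const, nsmul_eq_mul, ENNReal.ofReal_mul (by positivity)]
        simp
    _ ≤ _ := by
        refine ENNReal.ofReal_le_ofReal ?_
        have h1 : (N.card : ℝ) ≤ Real.exp (n * (k * Real.log D)) := by
          have h2 : (N.card : ℝ) ≤ (D ^ n) ^ k := by
            simp only [N, Fintype.card_piFinset, Finset.prod_const, Finset.card_univ,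
              Fintype.card_fin, Nat.cast_pow]
            gcongr
            exact hD n
          rw [← Real.exp_log (by linarith : 0 < D)] at h2
          rwa [← Real.exp_nat_mul, ← Real.exp_nat_mul,
            show (k : ℝ) * (n * Real.log D) = n * (k * Real.log D) by ring] at h2
        calc (N.card : ℝ) * (2 * Real.exp (-(n * (k * Real.log D + 1))))
            ≤ Real.exp (n * (k * Real.log D)) *
              (2 * Real.exp (-(n * (k * Real.log D + 1)))) := by gcongr
          _ = 2 * (Real.exp (n * (k * Real.log D)) *
              Real.exp (-(n * (k * Real.log D + 1)))) := by ring
          _ = 2 * Real.exp (-n) := by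
            rw [← Real.exp_add]; ring_nf

theorem inner_act_tpow {k n : ℕ} (Z : Tensor (k + 1) n) (b u : EuclideanSpace ℝ (Fin n)) :
    ⟪b, act Z (tpow k u)⟫ = mform Z (Fin.cons b fun _ => u) := by
  rw [inner_act, mform_apply]
  congr 1
  ext J
  simp [outer, elementary, tpow, Fin.prod_univ_succ, Fin.tail]

theorem norm_act_tpow_le {k n : ℕ} {Z : Tensor (k + 1) n} {M : ℝ} (hM : 0 ≤ M)
    (hZ : ∀ x, |mform Z x| ≤ M * ∏ j, ‖x j‖) (u : EuclideanSpace ℝ (Fin n)) :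
    ‖act Z (tpow k u)‖ ≤ M * ‖u‖ ^ k := by
  have h : ‖act Z (tpow k u)‖ * ‖act Z (tpow k u)‖ ≤
      M * ‖u‖ ^ k * ‖act Z (tpow k u)‖ := by
    rw [← real_inner_self_eq_norm_mul_norm, inner_act_tpow]
    refine (le_abs_self _).trans ((hZ _).trans (le_of_eq ?_))
    rw [Fin.prod_univ_succ]
    simp
    ring
  rcases (norm_nonneg (act Z (tpow k u))).eq_or_lt with h0 | h0
  · rw [← h0]; positivity
  · exact le_of_mul_le_mul_right h h0

theorem norm_act_tpow_sub_le {k n : ℕ} {Z : Tensor (k + 1) n} {M : ℝ} (hM : 0 ≤ M)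
    (hZ : ∀ x, |mform Z x| ≤ M * ∏ j, ‖x j‖) {R : ℝ} (hR : 1 ≤ R)
    {u w : EuclideanSpace ℝ (Fin n)} (hu : ‖u‖ ≤ R) (hw : ‖w‖ ≤ R) :
    ‖act Z (tpow k u) - act Z (tpow k w)‖ ≤ M * (k + 1) * R ^ k * ‖u - w‖ := by
  have key : ∀ b : EuclideanSpace ℝ (Fin n), ‖b‖ = 1 →
      |⟪b, act Z (tpow k u) - act Z (tpow k w)⟫| ≤ M * (k + 1) * R ^ k * ‖u - w‖ := by
    intro b hb
    rw [inner_sub_right, inner_act_tpow, inner_act_tpow]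
    have h := (mform Z).norm_image_sub_le_of_bound hM (fun x => by simpa using hZ x)
      (Fin.cons b fun _ => u) (Fin.cons b fun _ => w)
    have hn : ∀ u : EuclideanSpace ℝ (Fin n), ‖u‖ ≤ R →
        ‖(Fin.cons b fun _ => u : Fin (k + 1) → EuclideanSpace ℝ (Fin n))‖ ≤ R := by
      intro u hu
      refine (pi_norm_le_iff_of_nonneg (by linarith)).mpr fun i => ?_
      refine Fin.cases ?_ (fun i => ?_) i
      · simpa [hb] using hR
      · simpa using hu
    have hd : ‖((Fin.cons b fun _ => u) - (Fin.cons b fun _ => w) :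
        Fin (k + 1) → EuclideanSpace ℝ (Fin n))‖ ≤ ‖u - w‖ := by
      refine (pi_norm_le_iff_of_nonneg (norm_nonneg _)).mpr fun i => ?_
      refine Fin.cases ?_ (fun i => ?_) i <;> simp
    rw [Fintype.card_fin, Nat.add_sub_cancel] at h
    calc _ ≤ _ := h
      _ ≤ _ := by
        push_cast
        gcongr
        exact max_le (hn u hu) (hn w hw)
  set y := act Z (tpow k u) - act Z (tpow k w)
  rcases eq_or_ne y 0 with h0 | h0
  · rw [h0, norm_zero]; positivity
  · have := key (‖y‖⁻¹ • y) (norm_smul_inv_norm h0)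
    rw [real_inner_smul_left, real_inner_self_eq_norm_sq, abs_of_nonneg (by positivity)] at this
    have h1 : ‖y‖ ≠ 0 := norm_ne_zero_iff.mpr h0
    rwa [show ‖y‖⁻¹ * ‖y‖ ^ 2 = ‖y‖ by field_simp] at this

section Dynamics

variable {E : Type*} [NormedAddCommGroup E] [InnerProductSpace ℝ E]

/-- `u` is the normalized iteration of `x ↦ β ⟪x, v⟫ ^ p • v + H x`, where `H` is homogeneous of
degree `p`, bounded by `M` on the unit ball and `Λ`-Lipschitz on the ball of radius `3`. -/
structure IsPowerIteration (H : E → E) (v : E) (β : ℝ) (p : ℕ) (M Λ : ℝ) (u : ℕ → E) : Prop where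
  norm_dir : ‖v‖ = 1
  hom : ∀ (c : ℝ) (x : E), H (c • x) = c ^ p • H x
  bound : ∀ x : E, ‖H x‖ ≤ M * ‖x‖ ^ p
  lip : ∀ x y : E, ‖x‖ ≤ 3 → ‖y‖ ≤ 3 → ‖H x - H y‖ ≤ Λ * ‖x - y‖
  norm_zero : ‖u 0‖ = 1
  step : ∀ t, u (t + 1) = ‖(β * ⟪u t, v⟫ ^ p) • v + H (u t)‖⁻¹ •
    ((β * ⟪u t, v⟫ ^ p) • v + H (u t))
  one_le : 1 ≤ M
  large : 8 * M * 3 ^ p ≤ |β|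

theorem overlap_step {v h : E} {y M : ℝ} (hv : ‖v‖ = 1) (hh : ‖h‖ ≤ M)
    (hy : 0 < |y|) (hν : |⟪v, h⟫| ≤ |y| / 8) :
    7 / 8 * (|y| / (|y| + M)) ≤ |⟪‖y • v + h‖⁻¹ • (y • v + h), v⟫| ∧
      Real.sign ⟪‖y • v + h‖⁻¹ • (y • v + h), v⟫ = Real.sign y := by
  have h1 : ⟪y • v + h, v⟫ = y + ⟪v, h⟫ := by
    rw [inner_add_left, real_inner_smul_left, real_inner_self_eq_norm_sq, hv, real_inner_comm]
    ring
  have h2 : 7 / 8 * |y| ≤ |y + ⟪v, h⟫| := by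
    have := abs_sub_abs_le_abs_sub y (-⟪v, h⟫)
    rw [abs_neg, sub_neg_eq_add] at this
    linarith
  have h3 : ‖y • v + h‖ ≤ |y| + M := by
    refine (norm_add_le _ _).trans ?_
    rw [norm_smul, hv, mul_one, Real.norm_eq_abs]
    linarith
  have h4 : 0 < ‖y • v + h‖ := by
    have := abs_real_inner_le_norm (y • v + h) v
    rw [h1, hv] at this
    linarith
  rw [real_inner_smul_left, h1]
  constructor
  · rw [abs_mul, abs_inv, abs_norm, ← div_eq_inv_mul, mul_div_assoc']
    gcongr
  · have hinv := inv_pos.mpr h4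
    rcases lt_or_gt_of_ne (abs_pos.mp hy) with h | h
    · rw [abs_of_neg h] at hν
      have := (abs_le.mp hν).2
      rw [Real.sign_of_neg h, Real.sign_of_neg (mul_neg_of_pos_of_neg hinv (by linarith))]
    · rw [abs_of_pos h] at hν
      have := (abs_le.mp hν).1
      rw [Real.sign_of_pos h, Real.sign_of_pos (mul_pos hinv (by linarith))]

namespace IsPowerIteration

variable {H : E → E} {v : E} {β M Λ : ℝ} {p : ℕ} {u : ℕ → E}

theorem norm_le_one (h : IsPowerIteration H v β p M Λ u) (t : ℕ) : ‖u t‖ ≤ 1 := by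
  cases t with
  | zero => exact h.norm_zero.le
  | succ t =>
    rw [h.step, norm_smul, norm_inv, norm_norm]
    exact inv_mul_le_one

theorem norm_H_le (h : IsPowerIteration H v β p M Λ u) (t : ℕ) : ‖H (u t)‖ ≤ M :=
  (h.bound _).trans (mul_le_of_le_one_right (by linarith [h.one_le])
    (pow_le_one₀ (norm_nonneg _) (h.norm_le_one t)))

theorem abs_inner_H_le (h : IsPowerIteration H v β p M Λ u) (t : ℕ) : |⟪v, H (u t)⟫| ≤ M := by
  have := abs_real_inner_le_norm v (H (u t))
  rw [h.norm_dir, one_mul] at this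
  exact this.trans (h.norm_H_le t)

theorem overlap_succ (h : IsPowerIteration H v β p M Λ u) {t : ℕ} (hy : 0 < |β * ⟪u t, v⟫ ^ p|)
    (hν : |⟪v, H (u t)⟫| ≤ |β * ⟪u t, v⟫ ^ p| / 8) :
    7 / 8 * (|β * ⟪u t, v⟫ ^ p| / (|β * ⟪u t, v⟫ ^ p| + M)) ≤ |⟪u (t + 1), v⟫| ∧
      Real.sign ⟪u (t + 1), v⟫ = Real.sign (β * ⟪u t, v⟫ ^ p) := by
  rw [h.step]
  exact overlap_step h.norm_dir (h.norm_H_le t) hy hν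

theorem overlap_succ_of_large (h : IsPowerIteration H v β p M Λ u) {t : ℕ}
    (ht : 1 / 3 ≤ |⟪u t, v⟫|) : 1 / 3 ≤ |⟪u (t + 1), v⟫| ∧
      Real.sign ⟪u (t + 1), v⟫ = Real.sign (β * ⟪u t, v⟫ ^ p) := by
  have hM := h.one_le
  have hy : 8 * M ≤ |β * ⟪u t, v⟫ ^ p| := by
    rw [abs_mul, abs_pow]
    calc 8 * M = 8 * M * 3 ^ p * (1 / 3) ^ p := by
          rw [mul_assoc, ← mul_pow]; norm_num
      _ ≤ _ := by gcongr; exact h.large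
  have h1 := h.overlap_succ (t := t) (by linarith) (by linarith [h.abs_inner_H_le t])
  refine ⟨le_trans ?_ h1.1, h1.2⟩
  have : 8 / 9 ≤ |β * ⟪u t, v⟫ ^ p| / (|β * ⟪u t, v⟫ ^ p| + M) := by
    rw [le_div_iff₀ (by linarith)]
    linarith
  linarith

/-- As long as the noise in the direction `v` is small, the overlap with `v` grows geometrically
until it is of order one; then it stays so, whatever the noise. -/
theorem overlap_growth {m : ℕ} (h : IsPowerIteration H v β (m + 1) M Λ u) {F ξ η : ℝ} {q : ℕ}
    (hF : 4 * M ≤ F) (hξ : 0 < ξ) (h0 : ξ ≤ |⟪u 0, v⟫|) (hβ : F ≤ |β * ⟪u 0, v⟫ ^ m|)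
    (hη : η ≤ F * ξ / 8) (hq : M ≤ F * (ξ * (F / (4 * M)) ^ q))
    (hν : ∀ t ≤ q, |⟪v, H (u t)⟫| ≤ η) :
    (∀ t, q + 1 ≤ t → 1 / 3 ≤ |⟪u t, v⟫|) ∧ (∀ t, ⟪u t, v⟫ ≠ 0) ∧
      ∀ t, Real.sign ⟪u (t + 1), v⟫ = Real.sign (β * ⟪u t, v⟫ ^ (m + 1)) := by
  have hM := h.one_le
  have hF0 : 0 < F := by linarith
  have hρ : 1 ≤ F / (4 * M) := by rw [one_le_div (by linarith)]; exact hF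
  have small : ∀ t, ξ * (F / (4 * M)) ^ t ≤ |⟪u t, v⟫| → F ≤ |β * ⟪u t, v⟫ ^ m| →
      |⟪v, H (u t)⟫| ≤ η →
      (1 / 3 ≤ |⟪u (t + 1), v⟫| ∨ (|β * ⟪u t, v⟫ ^ (m + 1)| < M ∧
        ξ * (F / (4 * M)) ^ (t + 1) ≤ |⟪u (t + 1), v⟫| ∧ F ≤ |β * ⟪u (t + 1), v⟫ ^ m|)) ∧
      Real.sign ⟪u (t + 1), v⟫ = Real.sign (β * ⟪u t, v⟫ ^ (m + 1)) := by
    intro t ht1 ht2 ht3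
    have hx : ξ ≤ |⟪u t, v⟫| := le_trans (le_mul_of_one_le_right hξ.le (one_le_pow₀ hρ)) ht1
    have hy1 : F * |⟪u t, v⟫| ≤ |β * ⟪u t, v⟫ ^ (m + 1)| := by
      rw [pow_succ, ← mul_assoc, abs_mul]
      gcongr
    have hy2 : F * ξ ≤ |β * ⟪u t, v⟫ ^ (m + 1)| := le_trans (by gcongr) hy1
    have hy0 : 0 < |β * ⟪u t, v⟫ ^ (m + 1)| := lt_of_lt_of_le (by positivity) hy2
    obtain ⟨h1, h2⟩ := h.overlap_succ hy0 (by linarith)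
    refine ⟨?_, h2⟩
    rcases le_or_gt M |β * ⟪u t, v⟫ ^ (m + 1)| with hc | hc
    · left
      have : 1 / 2 ≤ |β * ⟪u t, v⟫ ^ (m + 1)| / (|β * ⟪u t, v⟫ ^ (m + 1)| + M) := by
        rw [le_div_iff₀ (by linarith)]
        linarith
      linarith
    · right
      have h3 : F / (4 * M) * |⟪u t, v⟫| ≤ |⟪u (t + 1), v⟫| := by
        refine le_trans ?_ h1
        calc F / (4 * M) * |⟪u t, v⟫| = F * |⟪u t, v⟫| / (4 * M) := by ring
          _ ≤ |β * ⟪u t, v⟫ ^ (m + 1)| / (4 * M) := by gcongr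
          _ ≤ 7 / 8 * (|β * ⟪u t, v⟫ ^ (m + 1)| / (2 * M)) := by
              rw [mul_div_assoc', div_le_div_iff₀ (by positivity) (by positivity)]
              nlinarith [mul_nonneg hy0.le (zero_le_one.trans hM)]
          _ ≤ _ := by gcongr; linarith
      refine ⟨hc, ?_, ?_⟩
      · calc ξ * (F / (4 * M)) ^ (t + 1) = F / (4 * M) * (ξ * (F / (4 * M)) ^ t) := by ring
          _ ≤ F / (4 * M) * |⟪u t, v⟫| := by gcongr
          _ ≤ _ := h3
      · refine ht2.trans ?_
        rw [abs_mul, abs_mul, abs_pow, abs_pow]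
        have := le_trans (le_mul_of_one_le_left (abs_nonneg ⟪u t, v⟫) hρ) h3
        gcongr
  have main : ∀ t ≤ q, 1 / 3 ≤ |⟪u t, v⟫| ∨
      (ξ * (F / (4 * M)) ^ t ≤ |⟪u t, v⟫| ∧ F ≤ |β * ⟪u t, v⟫ ^ m|) := by
    intro t
    induction t with
    | zero => intro _; right; exact ⟨by simpa using h0, hβ⟩
    | succ t ih =>
      intro ht
      rcases ih (by omega) with h1 | ⟨h1, h2⟩
      · exact .inl (h.overlap_succ_of_large h1).1
      · rcases (small t h1 h2 (hν t (by omega))).1 with h3 | ⟨-, h3⟩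
        · exact .inl h3
        · exact .inr h3
  have hlate : ∀ t, q + 1 ≤ t → 1 / 3 ≤ |⟪u t, v⟫| := by
    intro t ht
    induction t, ht using Nat.le_induction with
    | base =>
      rcases main q le_rfl with h1 | ⟨h1, h2⟩
      · exact (h.overlap_succ_of_large h1).1
      · rcases (small q h1 h2 (hν q le_rfl)).1 with h3 | ⟨h3, -⟩
        · exact h3
        · exfalso
          have : F * (ξ * (F / (4 * M)) ^ q) ≤ |β * ⟪u q, v⟫ ^ (m + 1)| := by
            rw [show β * ⟪u q, v⟫ ^ (m + 1) = β * ⟪u q, v⟫ ^ m * ⟪u q, v⟫ by ring, abs_mul]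
            exact mul_le_mul h2 h1 (by positivity) (_root_.abs_nonneg _)
          linarith
    | succ t _ ih => exact (h.overlap_succ_of_large ih).1
  refine ⟨hlate, fun t => ?_, fun t => ?_⟩
  · rcases le_or_gt (q + 1) t with ht | ht
    · exact abs_pos.mp (lt_of_lt_of_le (by norm_num) (hlate t ht))
    · rcases main t (by omega) with h1 | ⟨h1, -⟩
      · exact abs_pos.mp (lt_of_lt_of_le (by norm_num) h1)
      · exact abs_pos.mp (lt_of_lt_of_le (by positivity) h1)
  · rcases le_or_gt (q + 1) t with ht | ht
    · exact (h.overlap_succ_of_large (hlate t ht)).2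
    · rcases main t (by omega) with h1 | ⟨h1, h2⟩
      · exact (h.overlap_succ_of_large h1).2
      · exact (small t h1 h2 (hν t (by omega))).2

/-- The iterates in the affine chart `⟪w, v⟫ = 1`. -/
def chart (v : E) (x : E) : E := ⟪x, v⟫⁻¹ • x

theorem norm_chart_le (h : IsPowerIteration H v β p M Λ u) {t : ℕ} (ht : 1 / 3 ≤ |⟪u t, v⟫|) :
    ‖chart v (u t)‖ ≤ 3 := by
  rw [chart, norm_smul, norm_inv, Real.norm_eq_abs]
  calc |⟪u t, v⟫|⁻¹ * ‖u t‖ ≤ (1 / 3)⁻¹ * 1 := by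
        gcongr
        exact h.norm_le_one t
    _ = 3 := by norm_num

theorem norm_H_le_of_norm_le (h : IsPowerIteration H v β p M Λ u) {w : E} (hw : ‖w‖ ≤ 3) :
    ‖H w‖ ≤ |β| / 8 := by
  have hM := h.one_le
  calc ‖H w‖ ≤ M * 3 ^ p := (h.bound w).trans (by gcongr)
    _ ≤ |β| / 8 := by linarith [h.large]

theorem half_le (h : IsPowerIteration H v β p M Λ u) {w : E} (hw : ‖w‖ ≤ 3) :
    |β| / 2 ≤ |β + ⟪v, H w⟫| := by
  have h1 := abs_real_inner_le_norm v (H w)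
  rw [h.norm_dir, one_mul] at h1
  have h2 := abs_sub_abs_le_abs_sub β (-⟪v, H w⟫)
  rw [abs_neg, sub_neg_eq_add] at h2
  linarith [h.norm_H_le_of_norm_le hw, abs_nonneg β]

theorem abs_beta_pos (h : IsPowerIteration H v β p M Λ u) : 0 < |β| := by
  have := h.one_le
  exact lt_of_lt_of_le (by positivity) h.large

theorem chart_succ (h : IsPowerIteration H v β p M Λ u) {t : ℕ} (ht : 1 / 3 ≤ |⟪u t, v⟫|) :
    chart v (u (t + 1)) - v = (β + ⟪v, H (chart v (u t))⟫)⁻¹ •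
      (H (chart v (u t)) - ⟪v, H (chart v (u t))⟫ • v) := by
  have hx : ⟪u t, v⟫ ≠ 0 := abs_pos.mp (lt_of_lt_of_le (by norm_num) ht)
  set w := chart v (u t) with hw
  have huw : u t = ⟪u t, v⟫ • w := by rw [hw, chart, smul_smul, mul_inv_cancel₀ hx, one_smul]
  have hc : β + ⟪v, H w⟫ ≠ 0 := by
    have := h.half_le (h.norm_chart_le ht)
    have := h.abs_beta_pos
    exact abs_pos.mp (by linarith)
  set x := ⟪u t, v⟫ with hx_def
  set Y := (β * x ^ p) • v + H (u t) with hY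
  have hY1 : Y = x ^ p • (β • v + H w) := by
    rw [hY, huw, h.hom, smul_add, smul_smul, mul_comm β]
  have hin : ⟪β • v + H w, v⟫ = β + ⟪v, H w⟫ := by
    rw [inner_add_left, real_inner_smul_left, real_inner_self_eq_norm_sq, h.norm_dir,
      real_inner_comm]
    ring
  have hYin : ⟪Y, v⟫ = x ^ p * (β + ⟪v, H w⟫) := by rw [hY1, real_inner_smul_left, hin]
  have hYne : ‖Y‖ ≠ 0 := by
    intro h0
    rw [norm_eq_zero.mp h0, inner_zero_left] at hYin
    exact mul_ne_zero (pow_ne_zero p hx) hc hYin.symm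
  have h1 : chart v (u (t + 1)) = (β + ⟪v, H w⟫)⁻¹ • (β • v + H w) := by
    rw [h.step, ← hx_def, ← hY, chart, real_inner_smul_left, smul_smul, hYin, hY1, smul_smul]
    rw [← hY1]
    congr 1
    have := pow_ne_zero p hx
    field_simp
  have h2 : H w - ⟪v, H w⟫ • v = (β • v + H w) - (β + ⟪v, H w⟫) • v := by
    rw [add_smul]; abel
  rw [h1, h2, smul_sub, smul_smul (β + ⟪v, H w⟫)⁻¹, inv_mul_cancel₀ hc, one_smul]

theorem norm_sub_inner_smul_le {v : E} (hv : ‖v‖ = 1) (y : E) : ‖y - ⟪v, y⟫ • v‖ ≤ ‖y‖ := by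
  refine le_of_sq_le_sq ?_ (norm_nonneg _)
  rw [norm_sub_sq_real, norm_smul, hv, real_inner_smul_right, real_inner_comm, mul_one,
    Real.norm_eq_abs, sq_abs]
  nlinarith [sq_nonneg ⟪v, y⟫]

theorem norm_chart_succ_sub_le (h : IsPowerIteration H v β p M Λ u) {t : ℕ}
    (ht : 1 / 3 ≤ |⟪u t, v⟫|) : ‖chart v (u (t + 1)) - v‖ ≤ 2 * M * 3 ^ p / |β| := by
  have hw := h.norm_chart_le ht
  have hβ := h.abs_beta_pos
  have hM := h.one_le
  rw [h.chart_succ ht, norm_smul, norm_inv, Real.norm_eq_abs, ← div_eq_inv_mul]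
  calc _ ≤ (M * 3 ^ p) / (|β| / 2) := by
        refine div_le_div₀ (by positivity) ?_ (by positivity) (h.half_le hw)
        exact (norm_sub_inner_smul_le h.norm_dir _).trans ((h.bound _).trans (by gcongr))
    _ = _ := by field_simp

theorem norm_chart_succ_sub_chart_succ_le (h : IsPowerIteration H v β p M Λ u) {s t : ℕ}
    (hs : 1 / 3 ≤ |⟪u s, v⟫|) (ht : 1 / 3 ≤ |⟪u t, v⟫|) :
    ‖chart v (u (s + 1)) - chart v (u (t + 1))‖ ≤
      3 * Λ / |β| * ‖chart v (u s) - chart v (u t)‖ := by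
  have hβ := h.abs_beta_pos
  have hs' := h.norm_chart_le hs
  have ht' := h.norm_chart_le ht
  set a := chart v (u s)
  set b := chart v (u t)
  have e : chart v (u (s + 1)) - chart v (u (t + 1)) =
      (chart v (u (s + 1)) - v) - (chart v (u (t + 1)) - v) := by abel
  rw [e, h.chart_succ hs, h.chart_succ ht]
  set c := β + ⟪v, H a⟫
  set d := β + ⟪v, H b⟫
  have hc : |β| / 2 ≤ |c| := h.half_le hs'
  have hd : |β| / 2 ≤ |d| := h.half_le ht'
  have hc0 : c ≠ 0 := abs_pos.mp (by linarith)
  have hd0 : d ≠ 0 := abs_pos.mp (by linarith)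
  have hlip := h.lip a b hs' ht'
  have hcd : |d - c| ≤ ‖H a - H b‖ := by
    have h1 := abs_real_inner_le_norm v (H a - H b)
    rw [h.norm_dir, one_mul, inner_sub_right, abs_sub_comm] at h1
    convert h1 using 2
    ring
  have e2 : c⁻¹ • (H a - ⟪v, H a⟫ • v) - d⁻¹ • (H b - ⟪v, H b⟫ • v) =
      c⁻¹ • ((H a - H b) - ⟪v, H a - H b⟫ • v) +
        ((d - c) * (c⁻¹ * d⁻¹)) • (H b - ⟪v, H b⟫ • v) := by
    have : (d - c) * (c⁻¹ * d⁻¹) = c⁻¹ - d⁻¹ := by field_simp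
    rw [this, inner_sub_right]
    module
  rw [e2]
  have h1 : |c|⁻¹ ≤ 2 / |β| := by
    rw [show 2 / |β| = (|β| / 2)⁻¹ by rw [inv_div]]
    gcongr
  have h2 : |d|⁻¹ ≤ 2 / |β| := by
    rw [show 2 / |β| = (|β| / 2)⁻¹ by rw [inv_div]]
    gcongr
  calc _ ≤ ‖c⁻¹ • ((H a - H b) - ⟪v, H a - H b⟫ • v)‖ +
        ‖((d - c) * (c⁻¹ * d⁻¹)) • (H b - ⟪v, H b⟫ • v)‖ := norm_add_le _ _
    _ ≤ 2 / |β| * ‖H a - H b‖ + ‖H a - H b‖ * (2 / |β| * (2 / |β|)) * (|β| / 8) := by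
        rw [norm_smul, norm_smul, Real.norm_eq_abs, Real.norm_eq_abs, abs_inv, abs_mul, abs_mul,
          abs_inv, abs_inv]
        gcongr
        · exact norm_sub_inner_smul_le h.norm_dir _
        · exact (norm_sub_inner_smul_le h.norm_dir _).trans (h.norm_H_le_of_norm_le ht')
    _ = 5 / 2 / |β| * ‖H a - H b‖ := by field_simp; ring
    _ ≤ 3 / |β| * (Λ * ‖a - b‖) := by gcongr; norm_num
    _ = _ := by ring

theorem norm_chart_sub_chart_le (h : IsPowerIteration H v β p M Λ u) {q : ℕ} (hΛ : 0 ≤ Λ)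
    (hq : ∀ t, q ≤ t → 1 / 3 ≤ |⟪u t, v⟫|) (j s : ℕ) :
    ‖chart v (u (q + s + j)) - chart v (u (q + j))‖ ≤ 6 * (3 * Λ / |β|) ^ j := by
  have hβ := h.abs_beta_pos
  induction j with
  | zero =>
    have h1 := h.norm_chart_le (hq (q + s) (by omega))
    have h2 := h.norm_chart_le (hq q le_rfl)
    have := norm_sub_le (chart v (u (q + s))) (chart v (u q))
    simp only [add_zero, pow_zero, mul_one]
    linarith
  | succ j ih =>
    calc _ ≤ 3 * Λ / |β| * ‖chart v (u (q + s + j)) - chart v (u (q + j))‖ :=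
          h.norm_chart_succ_sub_chart_succ_le (hq _ (by omega)) (hq _ (by omega))
      _ ≤ 3 * Λ / |β| * (6 * (3 * Λ / |β|) ^ j) := by gcongr
      _ = _ := by ring

theorem norm_eq_one (h : IsPowerIteration H v β p M Λ u) {t : ℕ} (ht : ⟪u t, v⟫ ≠ 0) :
    ‖u t‖ = 1 := by
  cases t with
  | zero => exact h.norm_zero
  | succ t =>
    rw [h.step] at ht ⊢
    refine norm_smul_inv_norm fun h0 => ht ?_
    rw [h0]
    simp

theorem inner_chart_sub (hv : ‖v‖ = 1) {x : E} (hx : ⟪x, v⟫ ≠ 0) : ⟪chart v x - v, v⟫ = 0 := by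
  rw [inner_sub_left, chart, real_inner_smul_left, real_inner_self_eq_norm_sq, hv,
    inv_mul_cancel₀ hx]
  norm_num

theorem overlap_sq (h : IsPowerIteration H v β p M Λ u) {t : ℕ} (ht : ⟪u t, v⟫ ≠ 0) :
    ⟪u t, v⟫ ^ 2 * (1 + ‖chart v (u t) - v‖ ^ 2) = 1 := by
  have h1 : u t = ⟪u t, v⟫ • (chart v (u t) - v + v) := by
    rw [sub_add_cancel, chart, smul_smul, mul_inv_cancel₀ ht, one_smul]
  have h2 := h.norm_eq_one ht
  have h3 : ‖u t‖ ^ 2 = 1 := by rw [h2]; norm_num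
  rw [h1, norm_smul, mul_pow, Real.norm_eq_abs, sq_abs, norm_add_sq_real,
    inner_chart_sub h.norm_dir ht, h.norm_dir] at h3
  linarith

theorem sqrt_one_sub_overlap_le (h : IsPowerIteration H v β p M Λ u) (hp : 1 ≤ p) {t : ℕ}
    (ht : ⟪u t, v⟫ ≠ 0) : √(1 - ⟪u t, v⟫ ^ (2 * p)) ≤ p * ‖chart v (u t) - v‖ := by
  have hsq := h.overlap_sq ht
  set x := ⟪u t, v⟫
  set r := ‖chart v (u t) - v‖
  have hr : 0 ≤ r := norm_nonneg _
  have hx1 : x ^ 2 ≤ 1 := by nlinarith [mul_nonneg (sq_nonneg x) (sq_nonneg r)]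
  have hb := one_add_mul_le_pow (a := x ^ 2 - 1) (by nlinarith [sq_nonneg x]) p
  have hp' : (1 : ℝ) ≤ p := by exact_mod_cast hp
  rw [show 1 + (x ^ 2 - 1) = x ^ 2 by ring, ← pow_mul] at hb
  refine Real.sqrt_le_iff.mpr ⟨by positivity, ?_⟩
  have h1 : 1 - x ^ 2 ≤ r ^ 2 := by nlinarith [mul_nonneg (sub_nonneg.mpr hx1) (sq_nonneg r)]
  calc 1 - x ^ (2 * p) ≤ p * (1 - x ^ 2) := by linarith
    _ ≤ p * r ^ 2 := by gcongr
    _ ≤ (p * r) ^ 2 := by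
      rw [mul_pow]
      gcongr
      nlinarith

/-- Comparison of `H` at a late iterate with `H v`, in a direction `b` in which the fluctuations
of `H` are small along the first iterates. -/
theorem abs_inner_H_chart_sub_le (h : IsPowerIteration H v β p M Λ u) (hp : 1 ≤ p) (hΛ : 0 ≤ Λ)
    {q : ℕ} (hq : ∀ t, q ≤ t → 1 / 3 ≤ |⟪u t, v⟫|) (J : ℕ) {b : E} {lam : ℝ} (hlam : 0 ≤ lam)
    (hb : ∀ t ≤ q + 1 + J, |⟪b, H (u t) - ⟪u t, v⟫ ^ p • H v⟫| ≤
      lam * √(1 - ⟪u t, v⟫ ^ (2 * p))) {t : ℕ} (ht : q + 1 ≤ t) :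
    |⟪b, H (chart v (u t)) - H v⟫| ≤
      lam * (3 ^ p * (p * (2 * M * 3 ^ p / |β|))) + ‖b‖ * (Λ * (6 * (3 * Λ / |β|) ^ J)) := by
  have hβ := h.abs_beta_pos
  have hM := h.one_le
  have early : ∀ s, q + 1 ≤ s → s ≤ q + 1 + J → |⟪b, H (chart v (u s)) - H v⟫| ≤
      lam * (3 ^ p * (p * (2 * M * 3 ^ p / |β|))) := by
    intro s hs1 hs2
    have hx := hq s (by omega)
    have hx0 : ⟪u s, v⟫ ≠ 0 := abs_pos.mp (by linarith)
    obtain ⟨s', rfl⟩ : ∃ s', s = s' + 1 := ⟨s - 1, by omega⟩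
    have hr := h.norm_chart_succ_sub_le (hq s' (by omega))
    have e : H (chart v (u (s' + 1))) - H v =
        (⟪u (s' + 1), v⟫⁻¹) ^ p • (H (u (s' + 1)) - ⟪u (s' + 1), v⟫ ^ p • H v) := by
      rw [chart, h.hom, smul_sub, smul_smul, ← mul_pow, inv_mul_cancel₀ hx0, one_pow, one_smul]
    rw [e, real_inner_smul_right, abs_mul, abs_pow, abs_inv]
    calc _ ≤ ((1 / 3 : ℝ)⁻¹) ^ p * (lam * (p * (2 * M * 3 ^ p / |β|))) := by
          gcongr
          refine (hb _ hs2).trans ?_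
          gcongr
          exact (h.sqrt_one_sub_overlap_le hp hx0).trans (by gcongr)
      _ = _ := by norm_num; ring
  rcases le_or_gt t (q + 1 + J) with hc | hc
  · refine (early t ht hc).trans (le_add_of_nonneg_right (by positivity))
  · have h1 := early (q + 1 + J) (by omega) le_rfl
    have h2 := h.norm_chart_sub_chart_le (q := q + 1) hΛ (fun t ht => hq t (by omega)) J
      (t - (q + 1 + J))
    rw [show q + 1 + (t - (q + 1 + J)) + J = t by omega] at h2
    have h3 : |⟪b, H (chart v (u t)) - H (chart v (u (q + 1 + J)))⟫| ≤
        ‖b‖ * (Λ * (6 * (3 * Λ / |β|) ^ J)) := by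
      refine (abs_real_inner_le_norm _ _).trans ?_
      gcongr
      refine (h.lip _ _ (h.norm_chart_le (hq t (by omega)))
        (h.norm_chart_le (hq _ (by omega)))).trans ?_
      gcongr
    have e : H (chart v (u t)) - H v = (H (chart v (u (q + 1 + J))) - H v) +
        (H (chart v (u t)) - H (chart v (u (q + 1 + J)))) := by abel
    rw [e, inner_add_right]
    exact (abs_add_le _ _).trans (add_le_add h1 h3)

theorem norm_H_chart_sub_le (h : IsPowerIteration H v β p M Λ u) (hΛ : 0 ≤ Λ)
    {q : ℕ} (hq : ∀ t, q ≤ t → 1 / 3 ≤ |⟪u t, v⟫|) {t : ℕ} (ht : q + 1 ≤ t) :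
    ‖H (chart v (u t)) - H v‖ ≤ Λ * (2 * M * 3 ^ p / |β|) := by
  obtain ⟨s, rfl⟩ : ∃ s, t = s + 1 := ⟨t - 1, by omega⟩
  refine (h.lip _ _ (h.norm_chart_le (hq _ (by omega))) (by rw [h.norm_dir]; norm_num)).trans ?_
  have := h.norm_chart_succ_sub_le (hq s (by omega))
  gcongr

end IsPowerIteration

end Dynamics

theorem tendsto_zero_mul_of_eventually_abs_le {ι : Type*} {l : Filter ι} {f g : ι → ℝ} {C : ℝ}
    (hf : Tendsto f l (𝓝 0)) (hg : ∀ᶠ i in l, |g i| ≤ C) :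
    Tendsto (fun i => f i * g i) l (𝓝 0) := by
  have h0 : Tendsto (fun i => |f i| * C) l (𝓝 0) := by
    simpa using hf.abs.mul_const C
  refine squeeze_zero_norm' ?_ h0
  filter_upwards [hg] with i hi
  rw [Real.norm_eq_abs, abs_mul]
  gcongr

/-- The asymptotics of the bias correction: `R = (1 - 1/(2β̂²))⁻¹ / √(1 + ρ)` is so close to `1`
that `√n B A (R - 1)` vanishes. -/
theorem tendsto_bias_correction {ι : Type*} {l : Filter ι} {n B A ρ e : ι → ℝ}
    (hB : Tendsto (fun i => |B i|) l atTop)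
    (hA3 : Tendsto (fun i => √(n i) * A i / B i ^ 3) l (𝓝 0))
    (hρ : Tendsto (fun i => B i ^ 2 * ρ i) l (𝓝 1))
    (hρA : Tendsto (fun i => (B i ^ 2 * ρ i - 1) * (√(n i) * A i / B i)) l (𝓝 0))
    (hρ0 : ∀ᶠ i in l, 0 ≤ ρ i)
    (he : Tendsto (fun i => e i / B i) l (𝓝 0))
    (heA : Tendsto (fun i => e i * (√(n i) * A i) / B i ^ 2) l (𝓝 0)) :
    Tendsto (fun i => (1 - 1 / (2 * (B i + e i) ^ 2))⁻¹ / √(1 + ρ i)) l (𝓝 1) ∧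
    Tendsto (fun i => √(n i) * B i * A i *
      ((1 - 1 / (2 * (B i + e i) ^ 2))⁻¹ / √(1 + ρ i) - 1)) l (𝓝 0) := by
  have hB0 : ∀ᶠ i in l, B i ≠ 0 := by
    filter_upwards [hB.eventually_gt_atTop 0] with i hi using abs_pos.mp hi
  have hB2 : Tendsto (fun i => (B i ^ 2)⁻¹) l (𝓝 0) := by
    have := (tendsto_pow_atTop two_ne_zero).comp hB
    simpa [Function.comp_def] using tendsto_inv_atTop_zero.comp this
  have ht1 : Tendsto (fun i => 1 + e i / B i) l (𝓝 1) := by simpa using he.const_add 1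
  have ht0 : ∀ᶠ i in l, 1 + e i / B i ≠ 0 := ht1.eventually_ne one_ne_zero
  have hq : Tendsto (fun i => ((1 + e i / B i) ^ 2)⁻¹) l (𝓝 1) := by
    simpa using (ht1.pow 2).inv₀ (by norm_num)
  have hκ : Tendsto (fun i => 1 / (2 * (B i + e i) ^ 2)) l (𝓝 0) := by
    have : Tendsto (fun i => (B i ^ 2)⁻¹ * ((1 + e i / B i) ^ 2)⁻¹ / 2) l (𝓝 0) := by
      simpa using (hB2.mul hq).div_const 2
    refine this.congr' ?_
    filter_upwards [hB0, ht0] with i hi hi'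
    have h1 : B i + e i = B i * (1 + e i / B i) := by field_simp
    rw [h1, mul_pow]
    field_simp
  have hρ' : Tendsto ρ l (𝓝 0) := by
    have : Tendsto (fun i => (B i ^ 2)⁻¹ * (B i ^ 2 * ρ i)) l (𝓝 0) := by
      simpa using hB2.mul hρ
    refine this.congr' ?_
    filter_upwards [hB0] with i hi
    field_simp
  have hs : Tendsto (fun i => √(1 + ρ i) * (1 - 1 / (2 * (B i + e i) ^ 2))) l (𝓝 1) := by
    simpa using ((hρ'.const_add 1).sqrt).mul (hκ.const_sub 1)
  have hR : Tendsto (fun i => (√(1 + ρ i) * (1 - 1 / (2 * (B i + e i) ^ 2)))⁻¹) l (𝓝 1) := by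
    simpa using hs.inv₀ one_ne_zero
  have heq : ∀ i, (1 - 1 / (2 * (B i + e i) ^ 2))⁻¹ / √(1 + ρ i) =
      (√(1 + ρ i) * (1 - 1 / (2 * (B i + e i) ^ 2)))⁻¹ := fun i => by
    rw [mul_inv, div_eq_mul_inv, mul_comm]
  simp only [heq]
  refine ⟨hR, ?_⟩
  have hz : Tendsto (fun i => (B i ^ 2 * ρ i - 1) * (√(n i) * A i / B i) +
      e i * (√(n i) * A i) / B i ^ 2 * ((2 + e i / B i) * ((1 + e i / B i) ^ 2)⁻¹) +
      √(n i) * A i / B i ^ 3 * (((1 + e i / B i) ^ 2)⁻¹ ^ 2 / 4 -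
        B i ^ 2 * ρ i * ((1 + e i / B i) ^ 2)⁻¹ +
        B i ^ 2 * ρ i * (1 / (2 * (B i + e i) ^ 2)) * ((1 + e i / B i) ^ 2)⁻¹ / 2))
      l (𝓝 0) := by
    have h1 := heA.mul ((he.const_add 2).mul hq)
    have h2 := hA3.mul ((((hq.pow 2).div_const 4).sub (hρ.mul hq)).add
      (((hρ.mul hκ).mul hq).div_const 2))
    simpa using (hρA.add h1).add h2
  have hfin : Tendsto (fun i => ((√(1 + ρ i) * (1 - 1 / (2 * (B i + e i) ^ 2))) *
      (1 + √(1 + ρ i) * (1 - 1 / (2 * (B i + e i) ^ 2))))⁻¹) l (𝓝 (1 / 2)) := by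
    have := (hs.mul (hs.const_add 1)).inv₀ (by norm_num)
    convert this using 2
    norm_num
  have := (hz.mul hfin).neg
  rw [zero_mul, neg_zero] at this
  refine this.congr' ?_
  filter_upwards [hB0, ht0, hρ0, hs.eventually_const_lt zero_lt_one] with i hi hi' hr hs0
  set s := √(1 + ρ i) * (1 - 1 / (2 * (B i + e i) ^ 2)) with hs_def
  have hs2 : s ^ 2 = (1 + ρ i) * (1 - 1 / (2 * (B i + e i) ^ 2)) ^ 2 := by
    rw [hs_def, mul_pow, Real.sq_sqrt (by linarith)]
  have h1 : s⁻¹ - 1 = -((s ^ 2 - 1) * (s * (1 + s))⁻¹) := by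
    field_simp
    ring
  suffices hZ : (B i ^ 2 * ρ i - 1) * (√(n i) * A i / B i) +
      e i * (√(n i) * A i) / B i ^ 2 * ((2 + e i / B i) * ((1 + e i / B i) ^ 2)⁻¹) +
      √(n i) * A i / B i ^ 3 * (((1 + e i / B i) ^ 2)⁻¹ ^ 2 / 4 -
        B i ^ 2 * ρ i * ((1 + e i / B i) ^ 2)⁻¹ +
        B i ^ 2 * ρ i * (1 / (2 * (B i + e i) ^ 2)) * ((1 + e i / B i) ^ 2)⁻¹ / 2) =
      √(n i) * B i * A i * (s ^ 2 - 1) by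
    rw [h1, hZ]; ring
  have h2 : B i + e i = B i * (1 + e i / B i) := by field_simp
  have h3 : e i = (1 + e i / B i - 1) * B i := by field_simp; ring
  rw [hs2, h2]
  generalize 1 + e i / B i = x at hi' h3 ⊢
  have h4 : e i / B i = x - 1 := by rw [h3]; field_simp
  rw [h4]
  conv_lhs => rw [h3]
  field_simp
  ring

/-- The studentized statistic as a function of scalar parameters that describe the position of the
iterate: `ρ` is the squared tangent of its angle to the signal direction, `δ` the component of the
error in the direction of interest, and `e` the error of the estimated signal size. -/
theorem studentized_scalar {ι : Type*} {l : Filter ι} {n B A b δ ρ e G μ o σ τ : ι → ℝ} {C : ℝ}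
    (hB : Tendsto (fun i => |B i|) l atTop)
    (hA1 : Tendsto (fun i => A i / B i) l (𝓝 0))
    (hA3 : Tendsto (fun i => √(n i) * A i / B i ^ 3) l (𝓝 0))
    (hb : ∀ᶠ i in l, 0 < b i ∧ b i ^ 2 * (1 + A i ^ 2) = 1)
    (hδ : ∀ᶠ i in l, |B i * δ i| ≤ C)
    (hδG : ∀ᶠ i in l, √(n i) * B i * δ i = μ i * G i + o i)
    (hμ : Tendsto μ l (𝓝 1)) (ho : Tendsto o l (𝓝 0))
    (hρ : Tendsto (fun i => B i ^ 2 * ρ i) l (𝓝 1))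
    (hρA : Tendsto (fun i => (B i ^ 2 * ρ i - 1) * (√(n i) * A i / B i)) l (𝓝 0))
    (hρ0 : ∀ᶠ i in l, 0 ≤ ρ i)
    (he : Tendsto (fun i => e i / B i) l (𝓝 0))
    (heA : Tendsto (fun i => e i * (√(n i) * A i) / B i ^ 2) l (𝓝 0))
    (hσ : ∀ᶠ i in l, σ i ^ 2 = 1) (hτ : ∀ᶠ i in l, τ i ^ 2 = 1) :
    ∃ μ' o' : ι → ℝ, Tendsto μ' l (𝓝 1) ∧ Tendsto o' l (𝓝 0) ∧ ∀ᶠ i in l,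
      √(n i) * (τ i * (B i + e i)) / √(1 - (σ i * (b i * (A i + δ i)) / √(1 + ρ i)) ^ 2) *
        ((1 - 1 / (2 * (τ i * (B i + e i)) ^ 2))⁻¹ * (σ i * (b i * (A i + δ i)) / √(1 + ρ i)) -
          σ i * (b i * A i)) = σ i * τ i * (μ' i * G i + o' i) := by
  obtain ⟨hR, hRA⟩ := tendsto_bias_correction hB hA3 hρ hρA hρ0 he heA
  have hB0 : ∀ᶠ i in l, B i ≠ 0 := by
    filter_upwards [hB.eventually_gt_atTop 0] with i hi using abs_pos.mp hi
  have hBi : Tendsto (fun i => (B i)⁻¹) l (𝓝 0) := by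
    rw [tendsto_zero_iff_abs_tendsto_zero]
    simpa [Function.comp_def, abs_inv] using tendsto_inv_atTop_zero.comp hB
  have hδ0 : Tendsto δ l (𝓝 0) := by
    refine (tendsto_zero_mul_of_eventually_abs_le hBi hδ).congr' ?_
    filter_upwards [hB0] with i hi
    field_simp
  have hAδ : Tendsto (fun i => A i * δ i) l (𝓝 0) := by
    refine (tendsto_zero_mul_of_eventually_abs_le hA1 hδ).congr' ?_
    filter_upwards [hB0] with i hi
    field_simp
  have hAρ : Tendsto (fun i => A i ^ 2 * ρ i) l (𝓝 0) := by
    have : Tendsto (fun i => (A i / B i) ^ 2 * (B i ^ 2 * ρ i)) l (𝓝 0) := by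
      simpa using (hA1.pow 2).mul hρ
    refine this.congr' ?_
    filter_upwards [hB0] with i hi
    field_simp
  have hρ' : Tendsto ρ l (𝓝 0) := by
    have : Tendsto (fun i => (B i)⁻¹ ^ 2 * (B i ^ 2 * ρ i)) l (𝓝 0) := by
      simpa using (hBi.pow 2).mul hρ
    refine this.congr' ?_
    filter_upwards [hB0] with i hi
    field_simp
  have hD : Tendsto (fun i => (1 + ρ i + A i ^ 2 * ρ i - 2 * (A i * δ i) - δ i ^ 2) / (1 + ρ i)) l
      (𝓝 1) := by
    have h1 := ((((hρ'.const_add 1).add hAρ).sub (hAδ.const_mul 2)).sub (hδ0.pow 2)).div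
      (hρ'.const_add 1) (by norm_num)
    simpa [Pi.div_def] using h1
  set D := fun i => (1 + ρ i + A i ^ 2 * ρ i - 2 * (A i * δ i) - δ i ^ 2) / (1 + ρ i) with hD_def
  set R := fun i => (1 - 1 / (2 * (B i + e i) ^ 2))⁻¹ / √(1 + ρ i) with hR_def
  have hpre : Tendsto (fun i => (1 + e i / B i) / √(D i)) l (𝓝 1) := by
    simpa [Pi.div_def] using (he.const_add 1).div hD.sqrt (by norm_num)
  refine ⟨fun i => (1 + e i / B i) / √(D i) * (R i * μ i),
    fun i => (1 + e i / B i) / √(D i) * (√(n i) * B i * A i * (R i - 1) + R i * o i), ?_, ?_, ?_⟩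
  · simpa using hpre.mul (hR.mul hμ)
  · have h1 := hpre.mul (hRA.add (hR.mul ho))
    rw [mul_zero, add_zero, mul_zero] at h1
    exact h1
  · filter_upwards [hB0, hb, hδG, hρ0, hσ, hτ] with i hi ⟨hb0, hb1⟩ hG hr hs ht
    have hr1 : 0 < 1 + ρ i := by linarith
    have hsq : √(1 + ρ i) ^ 2 = 1 + ρ i := Real.sq_sqrt hr1.le
    have hden : 1 - (σ i * (b i * (A i + δ i)) / √(1 + ρ i)) ^ 2 = b i ^ 2 * D i := by
      rw [div_pow, hsq, mul_pow, hs, hD_def]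
      field_simp
      linear_combination (-(1 + ρ i)) * hb1
    have htB : (τ i * (B i + e i)) ^ 2 = (B i + e i) ^ 2 := by rw [mul_pow, ht, one_mul]
    rw [hden, htB, Real.sqrt_mul (sq_nonneg _), Real.sqrt_sq hb0.le]
    have hRi : (1 - 1 / (2 * (B i + e i) ^ 2))⁻¹ * (σ i * (b i * (A i + δ i)) / √(1 + ρ i)) =
        σ i * (b i * (A i + δ i)) * R i := by
      rw [hR_def]; ring
    rw [hRi]
    have e1 : μ i * G i = √(n i) * B i * δ i - o i := by linarith
    have e2 : (1 + e i / B i) / √(D i) * (R i * μ i) * G i =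
        (1 + e i / B i) / √(D i) * (R i * (μ i * G i)) := by ring
    rw [e2, e1]
    rw [show √(n i) * (τ i * (B i + e i)) / (b i * √(D i)) =
      √(n i) * τ i * (B i * (1 + e i / B i)) / √(D i) * (b i)⁻¹ by
        field_simp]
    field_simp
    ring

namespace IsPowerIteration

variable {E : Type*} [NormedAddCommGroup E] [InnerProductSpace ℝ E]
variable {H : E → E} {v : E} {β M Λ : ℝ} {p : ℕ} {u : ℕ → E}

theorem chart_sub_eq (h : IsPowerIteration H v β p M Λ u) {t : ℕ} (ht : 1 / 3 ≤ |⟪u t, v⟫|) :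
    β • (chart v (u (t + 1)) - v) = (1 + ⟪v, H (chart v (u t))⟫ / β)⁻¹ •
      (H (chart v (u t)) - ⟪v, H (chart v (u t))⟫ • v) := by
  have hβ : β ≠ 0 := abs_pos.mp h.abs_beta_pos
  rw [h.chart_succ ht, smul_smul]
  congr 1
  rw [show β + ⟪v, H (chart v (u t))⟫ = β * (1 + ⟪v, H (chart v (u t))⟫ / β) by field_simp,
    mul_inv, ← mul_assoc, mul_inv_cancel₀ hβ, one_mul]

theorem sq_mul_norm_chart_sub_sq (h : IsPowerIteration H v β p M Λ u) {t : ℕ}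
    (ht : 1 / 3 ≤ |⟪u t, v⟫|) :
    β ^ 2 * ‖chart v (u (t + 1)) - v‖ ^ 2 = ((1 + ⟪v, H (chart v (u t))⟫ / β)⁻¹) ^ 2 *
      (‖H (chart v (u t))‖ ^ 2 - ⟪v, H (chart v (u t))⟫ ^ 2) := by
  have h1 : ‖β • (chart v (u (t + 1)) - v)‖ ^ 2 = β ^ 2 * ‖chart v (u (t + 1)) - v‖ ^ 2 := by
    rw [norm_smul, mul_pow, Real.norm_eq_abs, sq_abs]
  rw [← h1, h.chart_sub_eq ht, norm_smul, mul_pow, Real.norm_eq_abs, sq_abs, norm_sub_sq_real,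
    norm_smul, h.norm_dir, real_inner_smul_right, real_inner_comm, mul_one, Real.norm_eq_abs,
    sq_abs]
  ring

theorem eq_sign_div (h : IsPowerIteration H v β p M Λ u) {t : ℕ} (ht : ⟪u t, v⟫ ≠ 0) :
    ⟪u t, v⟫ = Real.sign ⟪u t, v⟫ / √(1 + ‖chart v (u t) - v‖ ^ 2) := by
  have hsq := h.overlap_sq ht
  have h1 : √(1 + ‖chart v (u t) - v‖ ^ 2) = |⟪u t, v⟫|⁻¹ := by
    have : 1 + ‖chart v (u t) - v‖ ^ 2 = (|⟪u t, v⟫|⁻¹) ^ 2 := by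
      rw [inv_pow, sq_abs]
      field_simp
      linarith
    rw [this, Real.sqrt_sq (by positivity)]
  rw [h1, div_inv_eq_mul]
  rcases lt_or_gt_of_ne ht with h0 | h0
  · rw [Real.sign_of_neg h0, abs_of_neg h0]; ring
  · rw [Real.sign_of_pos h0, abs_of_pos h0, one_mul]

/-- The estimated signal size `⟪X, û^{⊗(p+1)}⟫` in terms of the chart. -/
theorem betaHat_eq (h : IsPowerIteration H v β p M Λ u) {t : ℕ} (ht : ⟪u t, v⟫ ≠ 0) :
    β * ⟪u t, v⟫ ^ (p + 1) + ⟪u t, H (u t)⟫ =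
      Real.sign ⟪u t, v⟫ ^ (p + 1) * ((1 / √(1 + ‖chart v (u t) - v‖ ^ 2)) ^ (p + 1) *
        (β + ⟪chart v (u t), H (chart v (u t))⟫)) := by
  have hu : u t = ⟪u t, v⟫ • chart v (u t) := by
    rw [chart, smul_smul, mul_inv_cancel₀ ht, one_smul]
  have h1 : ⟪u t, H (u t)⟫ = ⟪u t, v⟫ ^ (p + 1) * ⟪chart v (u t), H (chart v (u t))⟫ := by
    conv_lhs => rw [hu, h.hom, real_inner_smul_left, real_inner_smul_right]
    ring
  rw [h1, ← mul_assoc, ← mul_pow, mul_one_div, ← h.eq_sign_div ht]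
  ring

theorem one_sub_pow_le {ρ : ℝ} (hρ : 0 ≤ ρ) (k : ℕ) : 1 - (1 / √(1 + ρ)) ^ k ≤ k * ρ := by
  have hs : 1 ≤ √(1 + ρ) := Real.one_le_sqrt.mpr (by linarith)
  have hsq : √(1 + ρ) ^ 2 = 1 + ρ := Real.sq_sqrt (by linarith)
  have h0 : 0 ≤ 1 / √(1 + ρ) := by positivity
  have hb := one_add_mul_le_pow (a := 1 / √(1 + ρ) - 1) (by linarith) k
  rw [add_sub_cancel] at hb
  have h1 : 1 - ρ ≤ 1 / √(1 + ρ) := by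
    rw [le_div_iff₀ (by linarith)]
    nlinarith
  have h2 : (k : ℝ) * (1 - 1 / √(1 + ρ)) ≤ k * ρ := by gcongr; linarith
  linarith

/-- The error of the estimated signal size. -/
theorem abs_betaHat_error_le (h : IsPowerIteration H v β p M Λ u) (hΛ : 0 ≤ Λ) {t : ℕ}
    (ht : 1 / 3 ≤ |⟪u t, v⟫|) (ht' : 1 / 3 ≤ |⟪u (t + 1), v⟫|) {lam : ℝ}
    (hlam : |⟪v, H v⟫| ≤ lam) :
    |(1 / √(1 + ‖chart v (u (t + 1)) - v‖ ^ 2)) ^ (p + 1) *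
      (β + ⟪chart v (u (t + 1)), H (chart v (u (t + 1)))⟫) - β| ≤
      ((p + 1) * (2 * M * 3 ^ p) ^ 2 + 2 * M * 3 ^ p * (M * 3 ^ p + Λ)) / |β| + lam := by
  have hβ := h.abs_beta_pos
  have hM := h.one_le
  have hr := h.norm_chart_succ_sub_le ht
  have hw := h.norm_chart_le ht'
  set w := chart v (u (t + 1))
  set s := (1 / √(1 + ‖w - v‖ ^ 2)) ^ (p + 1) with hs
  have hs1 := one_sub_pow_le (sq_nonneg ‖w - v‖) (p + 1)
  rw [← hs] at hs1
  have hs2 : s ≤ 1 := pow_le_one₀ (by positivity)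
    (div_le_one_of_le₀ (Real.one_le_sqrt.mpr (by nlinarith [sq_nonneg ‖w - v‖])) (by positivity))
  have hs0 : 0 ≤ s := by positivity
  have hin : |⟪w, H w⟫| ≤ lam + 2 * M * 3 ^ p / |β| * (M * 3 ^ p + Λ) := by
    have e : ⟪w, H w⟫ = ⟪v, H v⟫ + (⟪w - v, H w⟫ + ⟪v, H w - H v⟫) := by
      rw [inner_sub_left, inner_sub_right]; ring
    have h1 : |⟪w - v, H w⟫| ≤ 2 * M * 3 ^ p / |β| * (M * 3 ^ p) := by
      refine (abs_real_inner_le_norm _ _).trans ?_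
      gcongr
      exact (h.bound w).trans (by gcongr)
    have h2 : |⟪v, H w - H v⟫| ≤ 2 * M * 3 ^ p / |β| * Λ := by
      refine (abs_real_inner_le_norm _ _).trans ?_
      rw [h.norm_dir, one_mul, mul_comm]
      refine (h.lip w v hw (by rw [h.norm_dir]; norm_num)).trans ?_
      gcongr
    rw [e]
    calc _ ≤ |⟪v, H v⟫| + |⟪w - v, H w⟫ + ⟪v, H w - H v⟫| := abs_add_le _ _
      _ ≤ |⟪v, H v⟫| + (|⟪w - v, H w⟫| + |⟪v, H w - H v⟫|) := by gcongr; exact abs_add_le _ _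
      _ ≤ _ := by linarith
  have e : s * (β + ⟪w, H w⟫) - β = -((1 - s) * β) + s * ⟪w, H w⟫ := by ring
  rw [e]
  calc _ ≤ |(1 - s) * β| + |s * ⟪w, H w⟫| := by
        refine (abs_add_le _ _).trans ?_
        rw [abs_neg]
    _ ≤ (p + 1) * (2 * M * 3 ^ p / |β|) ^ 2 * |β| +
        1 * (lam + 2 * M * 3 ^ p / |β| * (M * 3 ^ p + Λ)) := by
        rw [abs_mul, abs_mul, abs_of_nonneg hs0, abs_of_nonneg (sub_nonneg.mpr hs2)]
        push_cast at hs1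
        gcongr
        exact hs1.trans (by gcongr)
    _ = _ := by field_simp; ring

end IsPowerIteration

open IsPowerIteration in
/-- Expansion of the studentized statistic of a late iterate along a filter: up to a sign it is
`μ' * (√n ⟪â, H v⟫) + o'` with `μ' → 1` and `o' → 0`. -/
theorem studentized_expansion {ι : Type*} {l : Filter ι} {E : ι → Type*}
    [∀ i, NormedAddCommGroup (E i)] [∀ i, InnerProductSpace ℝ (E i)] {H : ∀ i, E i → E i}
    {v a â : ∀ i, E i} {u : ∀ i, ℕ → E i} {T : ι → ℕ} {n β A b lam : ι → ℝ} {M Λ C : ℝ}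
    {p q J : ℕ} (hp : 1 ≤ p) (hΛ : 0 ≤ Λ)
    (hit : ∀ᶠ i in l, IsPowerIteration (H i) (v i) (β i) p M Λ (u i))
    (hq : ∀ᶠ i in l, ∀ t, q ≤ t → 1 / 3 ≤ |⟪u i t, v i⟫|)
    (hT : ∀ᶠ i in l, q + 2 ≤ T i)
    (hlam : ∀ᶠ i in l, 0 ≤ lam i)
    (hgv : ∀ᶠ i in l, |⟪v i, H i (v i)⟫| ≤ lam i)
    (hnv : ∀ᶠ i in l, ∀ t ≤ q + 1 + J, |⟪v i, H i (u i t) - ⟪u i t, v i⟫ ^ p • H i (v i)⟫| ≤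
      lam i * √(1 - ⟪u i t, v i⟫ ^ (2 * p)))
    (hna : ∀ᶠ i in l, ∀ t ≤ q + 1 + J, |⟪â i, H i (u i t) - ⟪u i t, v i⟫ ^ p • H i (v i)⟫| ≤
      lam i * √(1 - ⟪u i t, v i⟫ ^ (2 * p)))
    (hng : ∀ᶠ i in l, ∀ t ≤ q + 1 + J,
      |⟪H i (v i), H i (u i t) - ⟪u i t, v i⟫ ^ p • H i (v i)⟫| ≤
        lam i * ‖H i (v i)‖ * √(1 - ⟪u i t, v i⟫ ^ (2 * p)))
    (hg : Tendsto (fun i => ‖H i (v i)‖ ^ 2 - 1) l (𝓝 0))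
    (hgA : Tendsto (fun i => (‖H i (v i)‖ ^ 2 - 1) * (√(n i) * A i / β i)) l (𝓝 0))
    (ha : ∀ᶠ i in l, 0 < b i ∧ a i = b i • (A i • v i + â i) ∧ ‖a i‖ = 1 ∧ ‖â i‖ = 1 ∧
      ⟪â i, v i⟫ = 0)
    (hβ : Tendsto (fun i => |β i|) l atTop)
    (hA1 : Tendsto (fun i => A i / β i) l (𝓝 0))
    (hA3 : Tendsto (fun i => √(n i) * A i / β i ^ 3) l (𝓝 0))
    (hlam0 : Tendsto lam l (𝓝 0))
    (hlam1 : Tendsto (fun i => √(n i) * lam i / |β i|) l (𝓝 0))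
    (hlam2 : ∀ᶠ i in l, √(n i) * lam i ^ 2 ≤ C)
    (hJ : Tendsto (fun i => √(n i) * (3 * Λ / |β i|) ^ J) l (𝓝 0))
    (hn : ∀ᶠ i in l, 1 ≤ n i) :
    ∃ μ' o' : ι → ℝ, Tendsto μ' l (𝓝 1) ∧ Tendsto o' l (𝓝 0) ∧ ∀ᶠ i in l,
      √(n i) * (β i * ⟪u i (T i), v i⟫ ^ (p + 1) + ⟪u i (T i), H i (u i (T i))⟫) /
        √⟪a i, a i - ⟪u i (T i), a i⟫ • u i (T i)⟫ *
        ((1 - 1 / (2 * (β i * ⟪u i (T i), v i⟫ ^ (p + 1) +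
            ⟪u i (T i), H i (u i (T i))⟫) ^ 2))⁻¹ * ⟪a i, u i (T i)⟫ -
          ⟪a i, Real.sign ⟪u i (T i), v i⟫ • v i⟫) =
      Real.sign ⟪u i (T i), v i⟫ * Real.sign ⟪u i (T i), v i⟫ ^ (p + 1) *
        (μ' i * (√(n i) * ⟪â i, H i (v i)⟫) + o' i) := by
  set h : ∀ i, E i := fun i => H i (chart (v i) (u i (T i - 1))) with h_def
  set f : ∀ i, E i := fun i => h i - H i (v i) with f_def
  set r : ∀ i, E i := fun i => chart (v i) (u i (T i)) - v i with r_def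
  set ζ : ι → ℝ := fun i => ⟪v i, h i⟫ / β i with ζ_def
  set C₁ : ℝ := 2 * M * 3 ^ p with C₁_def
  set ψ : ι → ℝ := fun i => lam i * (3 ^ p * (p * (C₁ / |β i|))) + Λ * (6 * (3 * Λ / |β i|) ^ J)
    with ψ_def
  have hψ : Tendsto (fun i => √(n i) * ψ i) l (𝓝 0) := by
    have h1 := (hlam1.const_mul (3 ^ p * (p * C₁))).add (hJ.const_mul (Λ * 6))
    rw [mul_zero, mul_zero, add_zero] at h1
    refine h1.congr fun i => ?_
    rw [ψ_def]
    ring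
  have hβi : Tendsto (fun i => |β i|⁻¹) l (𝓝 0) := tendsto_inv_atTop_zero.comp hβ
  have hβ0 : ∀ᶠ i in l, β i ≠ 0 := by
    filter_upwards [hβ.eventually_gt_atTop 0] with i hi using abs_pos.mp hi
  have hfv : ∀ᶠ i in l, |⟪v i, f i⟫| ≤ ψ i := by
    filter_upwards [hit, hq, hT, hlam, hnv] with i h1 h2 h3 h4 h5
    have := h1.abs_inner_H_chart_sub_le hp hΛ h2 J h4 h5 (t := T i - 1) (by omega)
    rwa [h1.norm_dir, one_mul] at this
  have hfa : ∀ᶠ i in l, |⟪â i, f i⟫| ≤ ψ i := by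
    filter_upwards [hit, hq, hT, hlam, hna, ha] with i h1 h2 h3 h4 h5 h6
    have := h1.abs_inner_H_chart_sub_le hp hΛ h2 J h4 h5 (t := T i - 1) (by omega)
    rwa [h6.2.2.2.1, one_mul] at this
  have hg2 : ∀ᶠ i in l, ‖H i (v i)‖ ≤ 2 := by
    filter_upwards [hg.eventually_le_const one_pos] with i hi
    nlinarith [norm_nonneg (H i (v i))]
  have hfg : ∀ᶠ i in l, |⟪H i (v i), f i⟫| ≤ 2 * ψ i := by
    filter_upwards [hit, hq, hT, hlam, hng, hg2] with i h1 h2 h3 h4 h5 h6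
    have := h1.abs_inner_H_chart_sub_le hp hΛ h2 J (mul_nonneg h4 (norm_nonneg _)) h5
      (t := T i - 1) (by omega)
    have hM := h1.one_le
    calc _ ≤ _ := this
      _ = ‖H i (v i)‖ * ψ i := by rw [ψ_def]; ring
      _ ≤ 2 * ψ i := by gcongr
  have hfn : ∀ᶠ i in l, ‖f i‖ ≤ Λ * C₁ * |β i|⁻¹ := by
    filter_upwards [hit, hq, hT] with i h1 h2 h3
    refine (h1.norm_H_chart_sub_le hΛ h2 (t := T i - 1) (by omega)).trans (le_of_eq ?_)
    ring
  have hvh : ∀ᶠ i in l, |⟪v i, h i⟫| ≤ lam i + ψ i := by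
    filter_upwards [hfv, hgv] with i h1 h2
    have e : ⟪v i, h i⟫ = ⟪v i, H i (v i)⟫ + ⟪v i, f i⟫ := by
      rw [f_def, inner_sub_right]; ring
    rw [e]
    exact (abs_add_le _ _).trans (add_le_add h2 h1)
  have hψ0 : Tendsto ψ l (𝓝 0) := by
    have hψn : ∀ᶠ i in l, 0 ≤ ψ i := by
      filter_upwards [hfv] with i hi using (abs_nonneg _).trans hi
    refine squeeze_zero' hψn ?_ hψ
    filter_upwards [hn, hψn] with i h1 h2
    exact le_mul_of_one_le_left h2 (Real.one_le_sqrt.mpr h1)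
  have hvh0 : Tendsto (fun i => ⟪v i, h i⟫) l (𝓝 0) :=
    squeeze_zero_norm' hvh (by simpa using hlam0.add hψ0)
  have hζn : Tendsto (fun i => √(n i) * ζ i) l (𝓝 0) := by
    have h1 : Tendsto (fun i => √(n i) * lam i / |β i| + √(n i) * ψ i * |β i|⁻¹) l (𝓝 0) := by
      simpa using hlam1.add (hψ.mul hβi)
    refine squeeze_zero_norm' ?_ h1
    filter_upwards [hvh] with i hi
    rw [ζ_def, Real.norm_eq_abs, abs_mul, abs_div, abs_of_nonneg (Real.sqrt_nonneg _)]
    calc _ ≤ √(n i) * ((lam i + ψ i) / |β i|) := by gcongr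
      _ = _ := by ring
  have hζ : Tendsto ζ l (𝓝 0) := by
    refine squeeze_zero_norm' ?_ (by simpa only [abs_zero] using hζn.abs)
    filter_upwards [hn] with i h1
    rw [Real.norm_eq_abs, abs_mul, abs_of_nonneg (Real.sqrt_nonneg _)]
    exact le_mul_of_one_le_left (abs_nonneg _) (Real.one_le_sqrt.mpr h1)
  have hμ : Tendsto (fun i => (1 + ζ i)⁻¹) l (𝓝 1) := by
    simpa using (hζ.const_add 1).inv₀ (by norm_num)
  have hφ : ∀ i, ‖h i‖ ^ 2 - ⟪v i, h i⟫ ^ 2 - 1 =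
      (‖H i (v i)‖ ^ 2 - 1) + 2 * ⟪H i (v i), f i⟫ + ‖f i‖ ^ 2 - ⟪v i, h i⟫ ^ 2 := fun i => by
    have e : h i = H i (v i) + f i := (add_sub_cancel _ _).symm
    conv_lhs => rw [e, norm_add_sq_real, ← e]
    ring
  have hfn0 : Tendsto (fun i => ‖f i‖) l (𝓝 0) := by
    refine squeeze_zero' (Eventually.of_forall fun _ => norm_nonneg _) hfn ?_
    simpa using hβi.const_mul (Λ * C₁)
  have hgf0 : Tendsto (fun i => ⟪H i (v i), f i⟫) l (𝓝 0) :=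
    squeeze_zero_norm' hfg (by simpa using hψ0.const_mul 2)
  have hφ1 : Tendsto (fun i => ‖h i‖ ^ 2 - ⟪v i, h i⟫ ^ 2) l (𝓝 1) := by
    have h1 := (((hg.add (hgf0.const_mul 2)).add (hfn0.pow 2)).sub (hvh0.pow 2)).add_const 1
    have e : (0 : ℝ) + 2 * 0 + 0 ^ 2 - 0 ^ 2 + 1 = 1 := by norm_num
    rw [e] at h1
    refine h1.congr fun i => ?_
    rw [← hφ]
    ring
  have hsgf : Tendsto (fun i => √(n i) * ⟪H i (v i), f i⟫) l (𝓝 0) := by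
    refine squeeze_zero_norm' ?_ (by simpa using hψ.const_mul 2)
    filter_upwards [hfg] with i hi
    rw [Real.norm_eq_abs, abs_mul, abs_of_nonneg (Real.sqrt_nonneg _)]
    calc _ ≤ √(n i) * (2 * ψ i) := by gcongr
      _ = _ := by ring
  have hsfn : ∀ᶠ i in l, |‖f i‖ ^ 2 * β i ^ 2| ≤ (Λ * C₁) ^ 2 := by
    filter_upwards [hfn, hβ0] with i h1 h2
    rw [abs_of_nonneg (by positivity), ← sq_abs (β i), ← mul_pow]
    have : ‖f i‖ * |β i| ≤ Λ * C₁ := by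
      rwa [← div_eq_mul_inv, le_div_iff₀ (abs_pos.mpr h2)] at h1
    gcongr
  have hsvh : ∀ᶠ i in l, |√(n i) * ⟪v i, h i⟫ ^ 2| ≤ 2 * C + 2 := by
    filter_upwards [hvh, hlam2, hψ.eventually_le_const one_pos, hψ0.eventually_le_const one_pos,
      hfv] with i h1 h2 h3 h4 h5
    rw [abs_of_nonneg (by positivity), ← sq_abs ⟪v i, h i⟫]
    have hψn : 0 ≤ ψ i := (abs_nonneg _).trans h5
    have h6 : |⟪v i, h i⟫| ^ 2 ≤ 2 * lam i ^ 2 + 2 * ψ i := by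
      calc _ ≤ (lam i + ψ i) ^ 2 := by gcongr
        _ ≤ 2 * lam i ^ 2 + 2 * ψ i ^ 2 := by nlinarith [sq_nonneg (lam i - ψ i)]
        _ ≤ _ := by nlinarith
    calc _ ≤ √(n i) * (2 * lam i ^ 2 + 2 * ψ i) := by gcongr
      _ ≤ _ := by linarith
  have hφA : Tendsto (fun i => (‖h i‖ ^ 2 - ⟪v i, h i⟫ ^ 2 - 1) * (√(n i) * A i / β i)) l
      (𝓝 0) := by
    have h1 := ((hgA.add ((hsgf.mul hA1).const_mul 2)).add
      (tendsto_zero_mul_of_eventually_abs_le hA3 hsfn)).sub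
      (tendsto_zero_mul_of_eventually_abs_le hA1 hsvh)
    have e : (0 : ℝ) + 2 * (0 * 0) + 0 - 0 = 0 := by norm_num
    rw [e] at h1
    refine h1.congr' ?_
    filter_upwards [hβ0] with i hi
    rw [hφ]
    field_simp
  have hsucc : ∀ᶠ i in l, IsPowerIteration (H i) (v i) (β i) p M Λ (u i) ∧
      1 / 3 ≤ |⟪u i (T i - 1), v i⟫| ∧ 1 / 3 ≤ |⟪u i (T i), v i⟫| ∧ T i - 1 + 1 = T i := by
    filter_upwards [hit, hq, hT] with i h1 h2 h3
    exact ⟨h1, h2 _ (by omega), h2 _ (by omega), by omega⟩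
  have hρeq : ∀ᶠ i in l, β i ^ 2 * ‖r i‖ ^ 2 =
      ((1 + ζ i)⁻¹) ^ 2 * (‖h i‖ ^ 2 - ⟪v i, h i⟫ ^ 2) := by
    filter_upwards [hsucc] with i ⟨h1, h2, h3, h4⟩
    have := h1.sq_mul_norm_chart_sub_sq h2
    rwa [h4] at this
  have hrn : ∀ᶠ i in l, ‖r i‖ ≤ C₁ / |β i| := by
    filter_upwards [hsucc] with i ⟨h1, h2, h3, h4⟩
    have := h1.norm_chart_succ_sub_le h2
    rwa [h4] at this
  have hδeq : ∀ᶠ i in l, β i * ⟪â i, r i⟫ = (1 + ζ i)⁻¹ * ⟪â i, h i⟫ := by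
    filter_upwards [hsucc, ha] with i ⟨h1, h2, h3, h4⟩ h5
    have := h1.chart_sub_eq h2
    rw [h4] at this
    rw [← real_inner_smul_right, this, real_inner_smul_right, inner_sub_right,
      real_inner_smul_right, h5.2.2.2.2, mul_zero, sub_zero]
  have hρ : Tendsto (fun i => β i ^ 2 * ‖r i‖ ^ 2) l (𝓝 1) := by
    have h1 : Tendsto (fun i => ((1 + ζ i)⁻¹) ^ 2 * (‖h i‖ ^ 2 - ⟪v i, h i⟫ ^ 2)) l (𝓝 1) := by
      simpa using (hμ.pow 2).mul hφ1
    refine h1.congr' ?_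
    filter_upwards [hρeq] with i hi using hi.symm
  have hρA : Tendsto (fun i => (β i ^ 2 * ‖r i‖ ^ 2 - 1) * (√(n i) * A i / β i)) l (𝓝 0) := by
    have h1 := ((hμ.pow 2).mul hφA).sub
      ((hζn.mul hA1).mul ((hζ.const_add 2).mul (hμ.pow 2)))
    have e : (1 : ℝ) ^ 2 * 0 - 0 * 0 * ((2 + 0) * 1 ^ 2) = 0 := by norm_num
    rw [e] at h1
    refine h1.congr' ?_
    filter_upwards [hρeq, (hζ.const_add 1).eventually_ne (by norm_num : (1 : ℝ) + 0 ≠ 0)]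
      with i h2 h3
    rw [h2]
    field_simp
    ring
  set e : ι → ℝ := fun i => (1 / √(1 + ‖r i‖ ^ 2)) ^ (p + 1) *
      (β i + ⟪chart (v i) (u i (T i)), H i (chart (v i) (u i (T i)))⟫) - β i with e_def
  set C₂ : ℝ := (p + 1) * (2 * M * 3 ^ p) ^ 2 + 2 * M * 3 ^ p * (M * 3 ^ p + Λ)
  have hebd : ∀ᶠ i in l, |e i| ≤ C₂ / |β i| + lam i := by
    filter_upwards [hsucc, hgv] with i ⟨h1, h2, h3, h4⟩ h5
    have := h1.abs_betaHat_error_le hΛ h2 (by rwa [h4]) h5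
    rwa [h4] at this
  have he : Tendsto (fun i => e i / β i) l (𝓝 0) := by
    have h1 := ((hβi.const_mul C₂).add hlam0).mul hβi
    rw [mul_zero] at h1
    refine squeeze_zero_norm' ?_ h1
    filter_upwards [hebd] with i hi
    rw [Real.norm_eq_abs, abs_div, div_eq_mul_inv]
    gcongr
    rwa [← div_eq_mul_inv]
  have heA : Tendsto (fun i => e i * (√(n i) * A i) / β i ^ 2) l (𝓝 0) := by
    have h1 := (hA3.abs.const_mul C₂).add (hlam1.mul hA1.abs)
    rw [abs_zero, mul_zero, mul_zero, add_zero] at h1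
    refine squeeze_zero_norm' ?_ h1
    filter_upwards [hebd, hβ0] with i hi h0
    have h0' : |β i| ≠ 0 := abs_ne_zero.mpr h0
    rw [Real.norm_eq_abs, abs_div, abs_mul, abs_mul, abs_div, abs_div, abs_mul, abs_pow, abs_pow,
      abs_of_nonneg (Real.sqrt_nonneg (n i))]
    calc _ ≤ (C₂ / |β i| + lam i) * (√(n i) * |A i|) / |β i| ^ 2 := by gcongr
      _ = _ := by field_simp
  have ho : Tendsto (fun i => (1 + ζ i)⁻¹ * (√(n i) * ⟪â i, f i⟫)) l (𝓝 0) := by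
    have h1 : Tendsto (fun i => √(n i) * ⟪â i, f i⟫) l (𝓝 0) := by
      refine squeeze_zero_norm' ?_ hψ
      filter_upwards [hfa] with i hi
      rw [Real.norm_eq_abs, abs_mul, abs_of_nonneg (Real.sqrt_nonneg _)]
      gcongr
    simpa using hμ.mul h1
  obtain ⟨μ', o', h1, h2, h3⟩ := studentized_scalar (l := l) (n := n) (B := β) (A := A) (b := b)
    (δ := fun i => ⟪â i, r i⟫) (ρ := fun i => ‖r i‖ ^ 2) (e := e)
    (G := fun i => √(n i) * ⟪â i, H i (v i)⟫) (μ := fun i => (1 + ζ i)⁻¹)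
    (o := fun i => (1 + ζ i)⁻¹ * (√(n i) * ⟪â i, f i⟫))
    (σ := fun i => Real.sign ⟪u i (T i), v i⟫)
    (τ := fun i => Real.sign ⟪u i (T i), v i⟫ ^ (p + 1)) (C := C₁) hβ hA1 hA3
    (by
      filter_upwards [ha, hit] with i ⟨h1, h2, h3, h4, h5⟩ h6
      refine ⟨h1, ?_⟩
      have h7 : ‖a i‖ ^ 2 = 1 := by rw [h3]; norm_num
      rw [h2, norm_smul, mul_pow, Real.norm_eq_abs, sq_abs, norm_add_sq_real, norm_smul,
        h6.norm_dir, h4, real_inner_smul_left, real_inner_comm, h5, Real.norm_eq_abs, mul_one,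
        sq_abs] at h7
      linarith)
    (by
      filter_upwards [hrn, ha, hβ0] with i h1 h2 h3
      have h4 := abs_real_inner_le_norm (â i) (r i)
      rw [h2.2.2.2.1, one_mul] at h4
      rw [abs_mul]
      have := h4.trans h1
      rwa [le_div_iff₀ (abs_pos.mpr h3), mul_comm] at this)
    (by
      filter_upwards [hδeq] with i h1
      rw [mul_assoc, h1, f_def, inner_sub_right]
      ring)
    hμ ho hρ hρA (Eventually.of_forall fun _ => sq_nonneg _) he heA
    (by
      filter_upwards [hsucc] with i ⟨h1, h2, h3, h4⟩
      have : ⟪u i (T i), v i⟫ ≠ 0 := abs_pos.mp (by linarith)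
      rcases Real.sign_apply_eq_of_ne_zero _ this with h | h <;> rw [h] <;> norm_num)
    (by
      filter_upwards [hsucc] with i ⟨h1, h2, h3, h4⟩
      have : ⟪u i (T i), v i⟫ ≠ 0 := abs_pos.mp (by linarith)
      rw [← pow_mul, mul_comm, pow_mul]
      rcases Real.sign_apply_eq_of_ne_zero _ this with h | h <;> rw [h] <;> norm_num)
  refine ⟨μ', o', h1, h2, ?_⟩
  filter_upwards [h3, hsucc, ha] with i h3 ⟨h4, h5, h6, h7⟩ ⟨h8, h9, h10, h11, h12⟩
  have hx : ⟪u i (T i), v i⟫ ≠ 0 := abs_pos.mp (by linarith)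
  have hbeta : β i * ⟪u i (T i), v i⟫ ^ (p + 1) + ⟪u i (T i), H i (u i (T i))⟫ =
      Real.sign ⟪u i (T i), v i⟫ ^ (p + 1) * (β i + e i) := by
    rw [h4.betaHat_eq hx, e_def]
    ring
  have hav : ⟪a i, v i⟫ = b i * A i := by
    rw [h9, real_inner_smul_left, inner_add_left, real_inner_smul_left,
      real_inner_self_eq_norm_sq, h4.norm_dir, h12]
    ring
  have hrv : ⟪v i, r i⟫ = 0 := by rw [real_inner_comm]; exact inner_chart_sub h4.norm_dir hx
  have hau : ⟪a i, u i (T i)⟫ = Real.sign ⟪u i (T i), v i⟫ * (b i * (A i + ⟪â i, r i⟫)) /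
      √(1 + ‖r i‖ ^ 2) := by
    have hu : u i (T i) = ⟪u i (T i), v i⟫ • (v i + r i) := by
      rw [r_def, add_sub_cancel, chart, smul_smul, mul_inv_cancel₀ hx, one_smul]
    have har : ⟪a i, r i⟫ = b i * ⟪â i, r i⟫ := by
      rw [h9, real_inner_smul_left, inner_add_left, real_inner_smul_left, hrv]
      ring
    have hs := h4.eq_sign_div hx
    conv_lhs => rw [hu, real_inner_smul_right, inner_add_right, hav, har, hs]
    ring
  have hden : ⟪a i, a i - ⟪u i (T i), a i⟫ • u i (T i)⟫ = 1 - ⟪a i, u i (T i)⟫ ^ 2 := by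
    rw [inner_sub_right, real_inner_smul_right, real_inner_self_eq_norm_sq, h10,
      real_inner_comm (a i)]
    ring
  rw [hden, hbeta, hau, real_inner_smul_right, hav, h3]

theorem tpow_succ {n : ℕ} (k : ℕ) (v : EuclideanSpace ℝ (Fin n)) :
    tpow (k + 1) v = outer v (tpow k v) := by
  ext J
  simp [tpow, outer, Fin.prod_univ_succ, Fin.tail]

theorem act_spiked {k n : ℕ} (β : ℝ) (v : EuclideanSpace ℝ (Fin n)) (Z : Tensor (k + 1) n)
    (x : EuclideanSpace ℝ (Fin n)) :
    act (spiked β v Z) (tpow k x) = (β * ⟪x, v⟫ ^ k) • v + act Z (tpow k x) := by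
  refine ext_inner_left ℝ fun b => ?_
  have h : tinner (spiked β v Z) (outer b (tpow k x)) =
      β * tinner (tpow (k + 1) v) (outer b (tpow k x)) + tinner Z (outer b (tpow k x)) := by
    rw [← tinner_smul_left]
    simp only [tinner, spiked, Pi.add_apply, add_mul, Finset.sum_add_distrib]
  rw [inner_add_right, inner_act, h, inner_act, tpow_succ, tinner_outer, tinner_tpow,
    real_inner_smul_right, real_inner_comm v b, real_inner_comm v x]
  ring

theorem betaHat_spiked {k n : ℕ} (β : ℝ) (v u : EuclideanSpace ℝ (Fin n)) (Z : Tensor (k + 1) n)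
    (T : ℕ) :
    betaHat (spiked β v Z) u T = β * ⟪powerIter (spiked β v Z) u T, v⟫ ^ (k + 1) +
      ⟪powerIter (spiked β v Z) u T, act Z (tpow k (powerIter (spiked β v Z) u T))⟫ := by
  rw [betaHat, tpow_succ, ← inner_act, act_spiked, inner_add_right, real_inner_smul_right]
  ring

/-- One step of power iteration, from the current point and the noise in its direction. -/
def powerStep {n : ℕ} (k : ℕ) (β : ℝ) (v x y : EuclideanSpace ℝ (Fin n)) :
    EuclideanSpace ℝ (Fin n) :=
  ‖(β * ⟪x, v⟫ ^ k) • v + y‖⁻¹ • ((β * ⟪x, v⟫ ^ k) • v + y)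

theorem powerIter_succ_spiked {k n : ℕ} (β : ℝ) (v u : EuclideanSpace ℝ (Fin n))
    (Z : Tensor (k + 1) n) (t : ℕ) :
    powerIter (spiked β v Z) u (t + 1) = powerStep k β v (powerIter (spiked β v Z) u t)
      (act Z (tpow k (powerIter (spiked β v Z) u t))) := by
  rw [powerIter, act_spiked, powerStep]

theorem run_powerStep {k n : ℕ} (β : ℝ) (v u : EuclideanSpace ℝ (Fin n)) (Z : Tensor (k + 1) n)
    (t : ℕ) : run (tpow k) (powerStep k β v) Z u t = powerIter (spiked β v Z) u t := by
  induction t with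
  | zero => rfl
  | succ t ih => rw [powerIter_succ_spiked, run, ih]

@[fun_prop]
theorem measurable_tpow {n : ℕ} (k : ℕ) :
    Measurable (tpow k : EuclideanSpace ℝ (Fin n) → Tensor k n) := by
  unfold tpow; fun_prop

theorem measurable_powerStep {n : ℕ} (k : ℕ) (β : ℝ) (v : EuclideanSpace ℝ (Fin n)) :
    Measurable fun p : EuclideanSpace ℝ (Fin n) × EuclideanSpace ℝ (Fin n) =>
      powerStep k β v p.1 p.2 := by
  unfold powerStep; fun_prop

theorem tinner_tpow_self {k n : ℕ} {v : EuclideanSpace ℝ (Fin n)} (hv : ‖v‖ = 1) :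
    tinner (tpow k v) (tpow k v) = 1 := by
  rw [tinner_tpow, real_inner_self_eq_norm_sq, hv, one_pow, one_pow]

/-- Along power iteration, the noise orthogonal to its value at `v` behaves, in directions that
depend only on this value, like noise independent of the iteration. -/
theorem noise_abs_inner_act_powerIter_le {k n : ℕ} (β : ℝ) {v u : EuclideanSpace ℝ (Fin n)}
    (hv : ‖v‖ = 1) (hu : ‖u‖ = 1) {L : ℝ} (hL : 0 < L) (K : ℕ)
    {b : EuclideanSpace ℝ (Fin n) → EuclideanSpace ℝ (Fin n)} (hb : Measurable b)
    (hb1 : ∀ γ, ‖b γ‖ ≤ 1) :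
    noise (k + 1) n {Z | ∀ t < K, |⟪b (act Z (tpow k v)),
        act Z (tpow k (powerIter (spiked β v Z) u t)) -
          ⟪powerIter (spiked β v Z) u t, v⟫ ^ k • act Z (tpow k v)⟫| ≤
      K * L * √(1 - ⟪powerIter (spiked β v Z) u t, v⟫ ^ (2 * k))}ᶜ ≤
      K * ENNReal.ofReal (1 / n / L ^ 2) := by
  have he : tinner (tpow k v) (tpow k v) • tpow k v = tpow k v := by
    rw [tinner_tpow_self hv, one_smul]
  have hQ := measurable_tpow (n := n) k
  have hU := measurable_frozenUpdate (tpow k v) hQ (measurable_powerStep k β v)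
  have h := noise_frozen_atypical_le he (hQ.comp measurable_fst) hU (L := L) (K := K)
    (σ := fun γ => (u, γ)) (by fun_prop) hb fun γ => noise_atypical_le
      ((measurable_projT _).comp (hQ.comp measurable_fst)) hU hL K (u, γ) (hb1 γ)
  refine (measure_mono ?_).trans h
  intro Z hZ
  by_contra hZ'
  refine hZ fun t ht => ?_
  simp only [atypical, Set.mem_ofPred_eq, not_exists, not_and, not_lt] at hZ'
  have h1 := hZ' t ht
  have h2 := run_frozen (tpow k v) (tpow k) (powerStep k β v) Z u t
  simp only [Function.comp_apply] at h1
  rw [h2, run_powerStep] at h1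
  set x := powerIter (spiked β v Z) u t with hx
  have h3 : act Z (projT (tpow k v) (tpow k x)) =
      act Z (tpow k x) - ⟪x, v⟫ ^ k • act Z (tpow k v) := by
    rw [← act_projT_add (tpow k v) Z (tpow k x), tinner_tpow, real_inner_comm, add_sub_cancel_right]
  have hx1 : ‖x‖ ≤ 1 := by
    rw [hx]
    cases t with
    | zero => exact hu.le
    | succ t =>
      rw [powerIter, norm_smul, norm_inv, norm_norm]
      exact inv_mul_le_one
  have h4 : tinner (projT (tpow k v) (tpow k x)) (projT (tpow k v) (tpow k x)) ≤
      1 - ⟪x, v⟫ ^ (2 * k) := by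
    rw [tinner_projT_self he, tinner_tpow, tinner_tpow, real_inner_comm x v, ← pow_mul, mul_comm k 2,
      real_inner_self_eq_norm_sq]
    gcongr
    exact pow_le_one₀ (by positivity) (pow_le_one₀ (norm_nonneg _) hx1)
  rw [h3] at h1
  refine h1.trans ?_
  have h5 : (t : ℝ) + 1 ≤ K := by exact_mod_cast ht
  gcongr

/-- The noise tensors on which the analysis of power iteration applies up to time `K`. -/
structure IsTypical {k n : ℕ} (β : ℝ) (v u b : EuclideanSpace ℝ (Fin n)) (K : ℕ) (M lam δ : ℝ)
    (Z : Tensor (k + 1) n) : Prop where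
  bound : ∀ x, |mform Z x| ≤ M * ∏ j, ‖x j‖
  dir : |⟪v, act Z (tpow k v)⟫| ≤ lam
  along_dir : ∀ t < K, |⟪v, act Z (tpow k (powerIter (spiked β v Z) u t)) -
      ⟪powerIter (spiked β v Z) u t, v⟫ ^ k • act Z (tpow k v)⟫| ≤
    lam * √(1 - ⟪powerIter (spiked β v Z) u t, v⟫ ^ (2 * k))
  along_perp : ∀ t < K, |⟪b, act Z (tpow k (powerIter (spiked β v Z) u t)) -
      ⟪powerIter (spiked β v Z) u t, v⟫ ^ k • act Z (tpow k v)⟫| ≤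
    lam * √(1 - ⟪powerIter (spiked β v Z) u t, v⟫ ^ (2 * k))
  along_act : ∀ t < K, |⟪act Z (tpow k v), act Z (tpow k (powerIter (spiked β v Z) u t)) -
      ⟪powerIter (spiked β v Z) u t, v⟫ ^ k • act Z (tpow k v)⟫| ≤
    lam * ‖act Z (tpow k v)‖ * √(1 - ⟪powerIter (spiked β v Z) u t, v⟫ ^ (2 * k))
  norm_act : |‖act Z (tpow k v)‖ ^ 2 - 1| ≤ δ

theorem noise_not_isTypical_le {k n : ℕ} (hn : 1 ≤ n) (β : ℝ)
    {v u b : EuclideanSpace ℝ (Fin n)} (hv : ‖v‖ = 1) (hu : ‖u‖ = 1) (hb : ‖b‖ ≤ 1) {K : ℕ}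
    (hK : 1 ≤ K) {M lam δ : ℝ} (hlam : 0 < lam) (hδ : 0 < δ) {B : ENNReal}
    (hM : noise (k + 1) n {Z | ∀ x, |mform Z x| ≤ M * ∏ j, ‖x j‖}ᶜ ≤ B) :
    noise (k + 1) n {Z | IsTypical β v u b K M lam δ Z}ᶜ ≤
      B + ENNReal.ofReal (1 / n / lam ^ 2) + 3 * (K * ENNReal.ofReal (1 / n / (lam / K) ^ 2)) +
        ENNReal.ofReal (Var[fun x => x ^ 2; gaussianReal 0 1] / n / δ ^ 2) := by
  have hK0 : (0 : ℝ) < K := by exact_mod_cast hK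
  have hL : 0 < lam / K := by positivity
  have hKL : K * (lam / K) = lam := by field_simp
  have hdir := noise_tinner_chebyshev (outer v (tpow k v)) hlam
  rw [tinner_outer, tinner_tpow_self hv, real_inner_self_eq_norm_sq, hv, one_pow, one_mul] at hdir
  have h1 := noise_abs_inner_act_powerIter_le (k := k) β hv hu hL K (b := fun _ => v)
    measurable_const fun _ => hv.le
  have h2 := noise_abs_inner_act_powerIter_le (k := k) β hv hu hL K (b := fun _ => b)
    measurable_const fun _ => hb
  have h3 := noise_abs_inner_act_powerIter_le (k := k) β hv hu hL K (b := fun γ => ‖γ‖⁻¹ • γ)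
    (by fun_prop) fun γ => by
      rw [norm_smul, norm_inv, norm_norm]; exact inv_mul_le_one
  have h4 := noise_norm_act_sq (k := k) (n := n) (by omega) (tinner_tpow_self hv) hδ
  rw [hKL] at h1 h2 h3
  refine (measure_mono ?_).trans ((measure_union_le _ _).trans (add_le_add ((measure_union_le _ _).trans
    (add_le_add ((measure_union_le _ _).trans (add_le_add hM hdir)) ((measure_union_le _ _).trans
      (add_le_add ((measure_union_le _ _).trans (add_le_add h1 h2)) h3)))) h4)) |>.trans
    (le_of_eq ?_)
  · intro Z hZ
    by_contra hZ'
    simp only [Set.mem_union, not_or, Set.mem_compl_iff, not_not, Set.mem_ofPred_eq, not_le]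
      at hZ'
    obtain ⟨⟨⟨hM', hdir'⟩, ⟨h1', h2'⟩, h3'⟩, h4'⟩ := hZ'
    refine hZ ⟨hM', ?_, h1', h2', fun t ht => ?_, h4'.le⟩
    · rw [inner_act]; exact hdir'.le
    · rcases eq_or_ne (act Z (tpow k v)) 0 with h0 | h0
      · rw [h0]; simp
      · have h5 : 0 < ‖act Z (tpow k v)‖ := norm_pos_iff.mpr h0
        have h6 := mul_le_mul_of_nonneg_left (h3' t ht) h5.le
        rw [real_inner_smul_left, abs_mul, abs_inv, abs_norm, mul_inv_cancel_left₀ h5.ne'] at h6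
        exact h6.trans (le_of_eq (by ring))
  · ring

theorem IsTypical.isPowerIteration {k n : ℕ} {β : ℝ} {v u b : EuclideanSpace ℝ (Fin n)} {K : ℕ}
    {M lam δ : ℝ} {Z : Tensor (k + 1) n} (h : IsTypical β v u b K M lam δ Z) (hv : ‖v‖ = 1)
    (hu : ‖u‖ = 1) (hM : 1 ≤ M) (hβ : 8 * M * 3 ^ k ≤ |β|) :
    IsPowerIteration (fun x => act Z (tpow k x)) v β k M (M * (k + 1) * 3 ^ k)
      (powerIter (spiked β v Z) u) where
  norm_dir := hv
  hom c x := by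
    rw [← act_smul_right]
    congr 1
    ext I
    simp [tpow, Finset.prod_mul_distrib]
  bound := norm_act_tpow_le (by linarith) h.bound
  lip x y hx hy := norm_act_tpow_sub_le (by linarith) h.bound (by norm_num) hx hy
  norm_zero := hu
  step := powerIter_succ_spiked β v u Z
  one_le := hM
  large := hβ

theorem tendsto_natCast_rpow_zero {s : ℝ} (hs : s < 0) :
    Tendsto (fun n : ℕ => (n : ℝ) ^ s) atTop (𝓝 0) := by
  have := (tendsto_rpow_neg_atTop (neg_pos.mpr hs)).comp tendsto_natCast_atTop_atTop
  rwa [neg_neg] at this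

theorem tendsto_natCast_rpow_atTop {s : ℝ} (hs : 0 < s) :
    Tendsto (fun n : ℕ => (n : ℝ) ^ s) atTop atTop :=
  (tendsto_rpow_atTop hs).comp tendsto_natCast_atTop_atTop

/-- A scale slightly larger than `n^{-1/2}`, compared with signals of size at least `n^ε`. -/
theorem exists_noise_scale {ε c : ℝ} (hε : 0 < ε) (hc : 0 < c) {β : ℕ → ℝ}
    (hβ : ∀ᶠ n : ℕ in atTop, (n : ℝ) ^ ε ≤ |β n|) :
    ∃ lam : ℕ → ℝ, (∀ᶠ n in atTop, 0 < lam n) ∧ Tendsto lam atTop (𝓝 0) ∧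
      Tendsto (fun n : ℕ => √(n : ℝ) * lam n / |β n|) atTop (𝓝 0) ∧
      (∀ᶠ n : ℕ in atTop, √(n : ℝ) * lam n ^ 2 ≤ 1) ∧
      Tendsto (fun n : ℕ => 1 / (n : ℝ) / lam n ^ 2) atTop (𝓝 0) ∧
      ∀ᶠ n : ℕ in atTop, 2 * lam n ≤ (n : ℝ) ^ ε * (c / √(n : ℝ)) / 8 := by
  set s : ℝ := min (ε / 2) (1 / 4) with s_def
  have hs0 : 0 < s := lt_min (by linarith) (by norm_num)
  have hs1 : s ≤ ε / 2 := min_le_left _ _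
  have hs2 : s ≤ 1 / 4 := min_le_right _ _
  have hpos : ∀ᶠ n : ℕ in atTop, (1 : ℝ) ≤ n := by
    filter_upwards [eventually_ge_atTop 1] with n hn using by exact_mod_cast hn
  have hmul : ∀ n : ℝ, 1 ≤ n → √n * n ^ (s - 1 / 2) = n ^ s := fun n hn => by
    rw [Real.sqrt_eq_rpow, ← Real.rpow_add (by linarith)]
    congr 1
    ring
  refine ⟨fun n => (n : ℝ) ^ (s - 1 / 2), ?_, tendsto_natCast_rpow_zero (by linarith), ?_, ?_, ?_,
    ?_⟩
  · filter_upwards [hpos] with n hn using Real.rpow_pos_of_pos (by linarith) _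
  · refine squeeze_zero_norm' ?_ (tendsto_natCast_rpow_zero (s := s - ε) (by linarith))
    filter_upwards [hpos, hβ] with n hn hb
    have hn0 : (0 : ℝ) < n := by linarith
    have h1 : (0 : ℝ) < (n : ℝ) ^ ε := Real.rpow_pos_of_pos hn0 _
    rw [hmul n hn, Real.norm_of_nonneg (by positivity), Real.rpow_sub hn0]
    gcongr
  · filter_upwards [hpos] with n hn
    have hn0 : (0 : ℝ) < n := by linarith
    rw [sq, ← mul_assoc, hmul n hn, ← Real.rpow_add hn0]
    exact Real.rpow_le_one_of_one_le_of_nonpos hn (by linarith)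
  · refine (tendsto_natCast_rpow_zero (s := -(2 * s)) (by linarith)).congr' ?_
    filter_upwards [hpos] with n hn
    have hn0 : (0 : ℝ) < n := by linarith
    rw [div_div, ← Real.rpow_natCast, ← Real.rpow_mul hn0.le, one_div, ← Real.rpow_one_add' hn0.le,
      ← Real.rpow_neg hn0.le]
    · congr 1
      push_cast
      ring
    · push_cast
      linarith
  · have h1 := (tendsto_natCast_rpow_atTop (s := ε - s) (by linarith)).eventually_ge_atTop (16 / c)
    filter_upwards [hpos, h1] with n hn h2
    have hn0 : (0 : ℝ) < n := by linarith
    have hsn : 0 < √(n : ℝ) := Real.sqrt_pos.mpr hn0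
    have h3 : (n : ℝ) ^ ε = (n : ℝ) ^ (ε - s) * (n : ℝ) ^ s := by
      rw [← Real.rpow_add hn0, sub_add_cancel]
    have h4 : 0 < (n : ℝ) ^ s := Real.rpow_pos_of_pos hn0 _
    rw [div_le_iff₀ hc] at h2
    have h5 : (n : ℝ) ^ (s - 1 / 2) = (n : ℝ) ^ s / √(n : ℝ) := by
      rw [← hmul n hn]; field_simp
    rw [h5, h3]
    calc 2 * ((n : ℝ) ^ s / √(n : ℝ)) = 16 * (n : ℝ) ^ s / √(n : ℝ) / 8 := by ring
      _ ≤ ((n : ℝ) ^ (ε - s) * c) * (n : ℝ) ^ s / √(n : ℝ) / 8 := by gcongr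
      _ = _ := by ring

/-- A null sequence larger than `n^{-1/2}` and smaller than `(√n r)⁻¹`. -/
theorem exists_norm_scale {r : ℕ → ℝ} (hr : Tendsto r atTop (𝓝 0)) :
    ∃ δ : ℕ → ℝ, (∀ᶠ n in atTop, 0 < δ n) ∧ Tendsto δ atTop (𝓝 0) ∧
      Tendsto (fun n : ℕ => δ n * (√(n : ℝ) * |r n|)) atTop (𝓝 0) ∧
      Tendsto (fun n : ℕ => 1 / (n : ℝ) / δ n ^ 2) atTop (𝓝 0) := by
  set R : ℕ → ℝ := fun n => |r n| + (√(n : ℝ))⁻¹ with R_def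
  have hinv : Tendsto (fun n : ℕ => (√(n : ℝ))⁻¹) atTop (𝓝 0) :=
    tendsto_inv_atTop_zero.comp (Real.tendsto_sqrt_atTop.comp tendsto_natCast_atTop_atTop)
  have hR : Tendsto R atTop (𝓝 0) := by simpa using hr.abs.add hinv
  have hsn : ∀ᶠ n : ℕ in atTop, 0 < √(n : ℝ) := by
    filter_upwards [eventually_ge_atTop 1] with n hn
    exact Real.sqrt_pos.mpr (by exact_mod_cast hn)
  have hR0 : ∀ᶠ n in atTop, 0 < R n := by
    filter_upwards [hsn] with n hn
    have := inv_pos.mpr hn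
    have := abs_nonneg (r n)
    rw [R_def]
    positivity
  have hsR : Tendsto (fun n => √(R n)) atTop (𝓝 0) := by simpa using hR.sqrt
  refine ⟨fun n => (√(n : ℝ) * √(R n))⁻¹, ?_, ?_, ?_, ?_⟩
  · filter_upwards [hsn, hR0] with n h1 h2
    have := Real.sqrt_pos.mpr h2
    positivity
  · have h1 : Tendsto (fun n : ℕ => √((√(n : ℝ))⁻¹)) atTop (𝓝 0) := by simpa using hinv.sqrt
    refine squeeze_zero' (Eventually.of_forall fun n => by positivity) ?_ h1
    filter_upwards [hsn] with n h1
    have h2 : (√(n : ℝ))⁻¹ ≤ R n := le_add_of_nonneg_left (abs_nonneg _)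
    have h3 : 0 < (√(n : ℝ))⁻¹ := inv_pos.mpr h1
    have h4 : √((√(n : ℝ))⁻¹) ≤ √(R n) := Real.sqrt_le_sqrt h2
    have h5 : 0 < √((√(n : ℝ))⁻¹) := Real.sqrt_pos.mpr h3
    calc (√(n : ℝ) * √(R n))⁻¹ ≤ (√(n : ℝ) * √((√(n : ℝ))⁻¹))⁻¹ := by gcongr
      _ = √((√(n : ℝ))⁻¹) := by
        rw [inv_eq_iff_eq_inv, Real.sqrt_inv, inv_inv]
        have h6 : 0 < √√(n : ℝ) := Real.sqrt_pos.mpr h1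
        have h7 : √√(n : ℝ) * √√(n : ℝ) = √(n : ℝ) := Real.mul_self_sqrt h1.le
        rw [← div_eq_mul_inv, div_eq_iff h6.ne', h7]
  · refine squeeze_zero' (Eventually.of_forall fun n => by positivity) ?_ hsR
    filter_upwards [hsn, hR0] with n h1 h2
    have h3 : |r n| ≤ R n := le_add_of_nonneg_right (inv_nonneg.mpr h1.le)
    have h4 : 0 < √(R n) := Real.sqrt_pos.mpr h2
    calc (√(n : ℝ) * √(R n))⁻¹ * (√(n : ℝ) * |r n|)
        ≤ (√(n : ℝ) * √(R n))⁻¹ * (√(n : ℝ) * R n) := by gcongr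
      _ = (√(R n))⁻¹ * R n := by field_simp
      _ = √(R n) := by
        nth_rw 2 [← Real.mul_self_sqrt h2.le]
        field_simp
  · refine hR.congr' ?_
    filter_upwards [hsn, hR0] with n h1 h2
    have h3 : (0 : ℝ) < n := Real.sqrt_pos.mp h1
    rw [inv_pow, mul_pow, Real.sq_sqrt h3.le, Real.sq_sqrt h2.le]
    field_simp

theorem norm_perp_pos {E : Type*} [NormedAddCommGroup E] [InnerProductSpace ℝ E] {a v : E} {B : ℝ}
    (ha : ‖a‖ = 1) (h : |⟪a, v⟫| ≤ |B * ‖a - ⟪a, v⟫ • v‖|) : 0 < ‖a - ⟪a, v⟫ • v‖ := by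
  refine (norm_nonneg _).lt_of_ne' fun h0 => ?_
  rw [h0, mul_zero, abs_zero] at h
  have h1 : ⟪a, v⟫ = 0 := abs_eq_zero.mp (le_antisymm h (abs_nonneg _))
  rw [h1, zero_smul, sub_zero, ha] at h0
  exact one_ne_zero h0

theorem perp_decomposition {E : Type*} [NormedAddCommGroup E] [InnerProductSpace ℝ E] {a v : E}
    (hv : ‖v‖ = 1) (h : 0 < ‖a - ⟪a, v⟫ • v‖) :
    a = ‖a - ⟪a, v⟫ • v‖ • ((⟪a, v⟫ / ‖a - ⟪a, v⟫ • v‖) • v +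
        ‖a - ⟪a, v⟫ • v‖⁻¹ • (a - ⟪a, v⟫ • v)) ∧
      ‖‖a - ⟪a, v⟫ • v‖⁻¹ • (a - ⟪a, v⟫ • v)‖ = 1 ∧
      ⟪‖a - ⟪a, v⟫ • v‖⁻¹ • (a - ⟪a, v⟫ • v), v⟫ = 0 := by
  refine ⟨?_, ?_, ?_⟩
  · rw [smul_add, smul_smul, smul_smul, mul_div_cancel₀ _ h.ne', mul_inv_cancel₀ h.ne', one_smul,
      add_sub_cancel]
  · rw [norm_smul, norm_inv, norm_norm, inv_mul_cancel₀ h.ne']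
  · rw [real_inner_smul_left, inner_sub_left, real_inner_smul_left, real_inner_self_eq_norm_sq, hv]
    ring

/-- The number of steps before the iteration reaches the direction of the signal. -/
theorem floor_add_three_le {ε x y : ℝ} {T : ℕ} (hε : 0 < ε) (hx : 1 < x) (hy : x ^ ε ≤ y)
    (hT : 1 + 1 / ε * (1 / 2 + 2 * Real.log y / Real.log x) ≤ (T : ℝ)) :
    ⌊1 / (2 * ε)⌋₊ + 3 ≤ T := by
  have h1 : 0 < Real.log x := Real.log_pos hx
  have h2 : ε * Real.log x ≤ Real.log y := by
    rw [← Real.log_rpow (by linarith)]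
    exact Real.log_le_log (Real.rpow_pos_of_pos (by linarith) _) hy
  have h3 : 2 * ε ≤ 2 * Real.log y / Real.log x := by
    rw [le_div_iff₀ h1]; linarith
  have h4 : (⌊1 / (2 * ε)⌋₊ : ℝ) ≤ 1 / (2 * ε) := Nat.floor_le (by positivity)
  have h5 : 1 / ε * (1 / 2 + 2 * ε) ≤ 1 / ε * (1 / 2 + 2 * Real.log y / Real.log x) := by gcongr
  have h6 : 1 / ε * (1 / 2 + 2 * ε) = 1 / (2 * ε) + 2 := by field_simp
  have : ((⌊1 / (2 * ε)⌋₊ + 3 : ℕ) : ℝ) ≤ T := by push_cast; linarith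
  exact_mod_cast this

/-- The overlap multiplied by `n^ε / 4M` at each step exceeds a constant in time. -/
theorem eventually_le_growth {ε c M : ℝ} (hε : 0 < ε) (hc : 0 < c) (hM : 1 ≤ M) :
    ∀ᶠ n : ℕ in atTop, M ≤ (n : ℝ) ^ ε *
      (c / √(n : ℝ) * ((n : ℝ) ^ ε / (4 * M)) ^ ⌊1 / (2 * ε)⌋₊) := by
  set q := ⌊1 / (2 * ε)⌋₊ with hq
  have h1 : 1 / (2 * ε) < q + 1 := Nat.lt_floor_add_one _
  have h2 : 0 < ε * (q + 1) - 1 / 2 := by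
    rw [div_lt_iff₀ (by positivity)] at h1
    linarith
  have h3 := (tendsto_natCast_rpow_atTop h2).eventually_ge_atTop (M * (4 * M) ^ q / c)
  filter_upwards [h3, eventually_ge_atTop 1] with n h4 hn
  have hn0 : (0 : ℝ) < n := by exact_mod_cast hn
  have h5 : (n : ℝ) ^ (ε * (q + 1) - 1 / 2) = ((n : ℝ) ^ ε) ^ (q + 1) / √(n : ℝ) := by
    rw [Real.rpow_sub hn0, ← Real.sqrt_eq_rpow, Real.rpow_mul hn0.le, ← Real.rpow_natCast]
    push_cast
    rfl
  rw [h5, div_le_iff₀ hc] at h4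
  have h6 : (0 : ℝ) < (4 * M) ^ q := by positivity
  rw [div_pow]
  calc M = M * (4 * M) ^ q / (4 * M) ^ q := by field_simp
    _ ≤ (((n : ℝ) ^ ε) ^ (q + 1) / √(n : ℝ) * c) / (4 * M) ^ q := by gcongr
    _ = _ := by rw [pow_succ]; ring

theorem exists_tendsto_sqrt_mul_pow {ε : ℝ} (hε : 0 < ε) {β : ℕ → ℝ}
    (hβ : ∀ᶠ n : ℕ in atTop, (n : ℝ) ^ ε ≤ |β n|) {C : ℝ} (hC : 0 ≤ C) :
    ∃ J : ℕ, Tendsto (fun n : ℕ => √(n : ℝ) * (C / |β n|) ^ J) atTop (𝓝 0) := by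
  obtain ⟨J, hJ⟩ := exists_nat_gt (1 / (2 * ε))
  have h2 : 1 / 2 - ε * J < 0 := by
    rw [div_lt_iff₀ (by positivity)] at hJ
    linarith
  have h3 := (tendsto_natCast_rpow_zero h2).const_mul (C ^ J)
  rw [mul_zero] at h3
  refine ⟨J, squeeze_zero' (Eventually.of_forall fun n => by positivity) ?_ h3⟩
  filter_upwards [hβ, eventually_ge_atTop 1] with n h4 hn
  have hn0 : (0 : ℝ) < n := by exact_mod_cast hn
  have h1 : (0 : ℝ) < (n : ℝ) ^ ε := Real.rpow_pos_of_pos hn0 _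
  rw [Real.rpow_sub hn0, ← Real.sqrt_eq_rpow, Real.rpow_mul hn0.le, Real.rpow_natCast]
  calc √(n : ℝ) * (C / |β n|) ^ J ≤ √(n : ℝ) * (C / (n : ℝ) ^ ε) ^ J := by gcongr
    _ = _ := by rw [div_pow]; ring

theorem tendsto_noise_not_isTypical {k K : ℕ} (hK : 1 ≤ K) {β : ℕ → ℝ}
    {u v b : ∀ n : ℕ, EuclideanSpace ℝ (Fin n)} (hv : ∀ᶠ n in atTop, ‖v n‖ = 1)
    (hu : ∀ᶠ n in atTop, ‖u n‖ = 1) (hb : ∀ᶠ n in atTop, ‖b n‖ = 1) {M : ℝ}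
    (hM : ∀ n : ℕ, 1 ≤ n → noise (k + 1) n {Z | ∀ x, |mform Z x| ≤ M * ∏ j, ‖x j‖}ᶜ ≤
      ENNReal.ofReal (2 * Real.exp (-n)))
    {lam δ : ℕ → ℝ} (hlam : ∀ᶠ n in atTop, 0 < lam n) (hδ : ∀ᶠ n in atTop, 0 < δ n)
    (hlam' : Tendsto (fun n : ℕ => 1 / (n : ℝ) / lam n ^ 2) atTop (𝓝 0))
    (hδ' : Tendsto (fun n : ℕ => 1 / (n : ℝ) / δ n ^ 2) atTop (𝓝 0)) :
    Tendsto (fun n => noise (k + 1) n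
      {Z | IsTypical (β n) (v n) (u n) (b n) K M (lam n) (δ n) Z}ᶜ) atTop (𝓝 0) := by
  have key : ∀ f : ℕ → ℝ, Tendsto f atTop (𝓝 0) →
      Tendsto (fun n => ENNReal.ofReal (f n)) atTop (𝓝 0) := fun f hf => by
    simpa using ENNReal.tendsto_ofReal hf
  have h1 : Tendsto (fun n : ℕ => ENNReal.ofReal (2 * Real.exp (-n))) atTop (𝓝 0) := by
    refine key _ ?_
    simpa using ((Real.tendsto_exp_neg_atTop_nhds_zero.comp
      tendsto_natCast_atTop_atTop).const_mul (2 : ℝ))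
  have h2 : Tendsto (fun n : ℕ => 3 * (K * ENNReal.ofReal (1 / (n : ℝ) / (lam n / K) ^ 2))) atTop
      (𝓝 0) := by
    have h : Tendsto (fun n : ℕ => 1 / (n : ℝ) / (lam n / K) ^ 2) atTop (𝓝 0) := by
      have := hlam'.mul_const ((K : ℝ) ^ 2)
      rw [zero_mul] at this
      refine this.congr fun n => ?_
      rw [div_pow, div_div_eq_mul_div, div_mul_eq_mul_div]
    have h' := ENNReal.Tendsto.const_mul (ENNReal.Tendsto.const_mul (key _ h)
      (Or.inr (ENNReal.natCast_ne_top K))) (Or.inr (by norm_num : (3 : ENNReal) ≠ ⊤))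
    simpa using h'
  have h3 : Tendsto (fun n : ℕ => ENNReal.ofReal
      (Var[fun x => x ^ 2; gaussianReal 0 1] / (n : ℝ) / δ n ^ 2)) atTop (𝓝 0) := by
    refine key _ ?_
    have := hδ'.const_mul Var[fun x => x ^ 2; gaussianReal 0 1]
    rw [mul_zero] at this
    refine this.congr fun n => ?_
    ring
  have h4 := ((h1.add (key _ hlam')).add h2).add h3
  simp only [add_zero] at h4
  refine tendsto_of_tendsto_of_tendsto_of_le_of_le' tendsto_const_nhds h4
    (Eventually.of_forall fun _ => zero_le) ?_
  filter_upwards [hv, hu, hb, hlam, hδ, eventually_ge_atTop 1] with n e1 e2 e3 e4 e5 hn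
  exact noise_not_isTypical_le hn (β n) e1 e2 e3.le hK e4 e5 (hM n hn)

theorem IsTypical.overlap_growth {m n : ℕ} {β : ℝ} {v u b : EuclideanSpace ℝ (Fin n)} {K q : ℕ}
    {M lam δ F ξ : ℝ} {Z : Tensor (m + 1 + 1) n} (h : IsTypical β v u b K M lam δ Z)
    (hv : ‖v‖ = 1) (hu : ‖u‖ = 1) (hM : 1 ≤ M) (hβ : 8 * M * 3 ^ (m + 1) ≤ |β|)
    (hlam : 0 ≤ lam) (hF : 4 * M ≤ F) (hξ : 0 < ξ) (h0 : ξ ≤ |⟪u, v⟫|)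
    (hβF : F ≤ |β * ⟪u, v⟫ ^ m|) (hη : 2 * lam ≤ F * ξ / 8)
    (hq : M ≤ F * (ξ * (F / (4 * M)) ^ q)) (hqK : q < K) :
    (∀ t, q + 1 ≤ t → 1 / 3 ≤ |⟪powerIter (spiked β v Z) u t, v⟫|) ∧
      (∀ t, ⟪powerIter (spiked β v Z) u t, v⟫ ≠ 0) ∧
      ∀ t, Real.sign ⟪powerIter (spiked β v Z) u (t + 1), v⟫ =
        Real.sign (β * ⟪powerIter (spiked β v Z) u t, v⟫ ^ (m + 1)) := by
  have hit := h.isPowerIteration hv hu hM hβ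
  refine hit.overlap_growth hF hξ h0 hβF hη hq fun t ht => ?_
  have h1 := h.along_dir t (by omega)
  set x := powerIter (spiked β v Z) u t with hx
  have hx1 : |⟪x, v⟫| ≤ 1 := by
    have := abs_real_inner_le_norm x v
    rw [hv, mul_one] at this
    exact this.trans (hit.norm_le_one t)
  have h2 : √(1 - ⟪x, v⟫ ^ (2 * (m + 1))) ≤ 1 := by
    rw [Real.sqrt_le_one, pow_mul]
    have : 0 ≤ (⟪x, v⟫ ^ 2) ^ (m + 1) := by positivity
    linarith
  have h3 : |⟪v, ⟪x, v⟫ ^ (m + 1) • act Z (tpow (m + 1) v)⟫| ≤ lam := by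
    rw [real_inner_smul_right, abs_mul, abs_pow]
    calc _ ≤ 1 * lam :=
          mul_le_mul (pow_le_one₀ (abs_nonneg _) hx1) h.dir (abs_nonneg _) zero_le_one
      _ = lam := one_mul _
  have h4 : |⟪v, act Z (tpow (m + 1) x)⟫| ≤
      |⟪v, act Z (tpow (m + 1) x) - ⟪x, v⟫ ^ (m + 1) • act Z (tpow (m + 1) v)⟫| +
        |⟪v, ⟪x, v⟫ ^ (m + 1) • act Z (tpow (m + 1) v)⟫| := by
    refine le_trans (le_of_eq ?_) (abs_add_le _ _)
    rw [← inner_add_right, sub_add_cancel]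
  have h5 := mul_le_of_le_one_right hlam h2
  linarith

/-- On an event of probability tending to one, the studentized statistic is, up to its sign and up
to small errors, a linear function of the noise; the sign of the overlap is deterministic there. -/
theorem exists_studentized_expansion (m : ℕ) {ε c : ℝ} (hε : 0 < ε) (hc : 0 < c)
    {β : ℕ → ℝ} {u v a : ∀ n : ℕ, EuclideanSpace ℝ (Fin n)} {T : ℕ → ℕ}
    (hu : ∀ n, 1 ≤ n → ‖u n‖ = 1) (hv : ∀ n, 1 ≤ n → ‖v n‖ = 1) (ha : ∀ n, 1 ≤ n → ‖a n‖ = 1)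
    (huv : ∀ᶠ n : ℕ in atTop, c / √(n : ℝ) ≤ |⟪u n, v n⟫|)
    (hβ : ∀ᶠ n : ℕ in atTop, (n : ℝ) ^ ε ≤ |β n * ⟪u n, v n⟫ ^ m|)
    (hav : (fun n : ℕ => ⟪a n, v n⟫) =o[atTop]
      fun n : ℕ => |β n| ^ 3 / √(n : ℝ) * ‖a n - ⟪a n, v n⟫ • v n‖)
    (hav' : (fun n : ℕ => ⟪a n, v n⟫) =o[atTop]
      fun n : ℕ => |β n| * ‖a n - ⟪a n, v n⟫ • v n‖)
    (hT : ∀ᶠ n : ℕ in atTop,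
      1 + 1 / ε * (1 / 2 + 2 * Real.log |β n| / Real.log (n : ℝ)) ≤ (T n : ℝ)) :
    ∃ (b : ∀ n : ℕ, EuclideanSpace ℝ (Fin n)) (G : ∀ n, Set (Tensor (m + 1 + 1) n)),
      (∀ᶠ n in atTop, ‖b n‖ = 1) ∧
      Tendsto (fun n => noise (m + 1 + 1) n (G n)ᶜ) atTop (𝓝 0) ∧
      (∀ᶠ n in atTop, 1 ≤ T n) ∧ (∀ᶠ n in atTop, ∀ Z ∈ G n,
        (∀ t, ⟪powerIter (spiked (β n) (v n) Z) (u n) t, v n⟫ ≠ 0) ∧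
        ∀ t, Real.sign ⟪powerIter (spiked (β n) (v n) Z) (u n) (t + 1), v n⟫ =
          Real.sign (β n * ⟪powerIter (spiked (β n) (v n) Z) (u n) t, v n⟫ ^ (m + 1))) ∧
      ∀ η : ℝ, 0 < η → ∀ᶠ n in atTop, ∀ Z ∈ G n,
        |studentized (spiked (β n) (v n) Z) (u n) (T n) (a n)
            (Real.sign ⟪powerIter (spiked (β n) (v n) Z) (u n) (T n), v n⟫ • v n) -
          Real.sign ⟪powerIter (spiked (β n) (v n) Z) (u n) (T n), v n⟫ *
            Real.sign ⟪powerIter (spiked (β n) (v n) Z) (u n) (T n), v n⟫ ^ (m + 1 + 1) *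
            (√(n : ℝ) * ⟪b n, act Z (tpow (m + 1) (v n))⟫)| ≤
          η * (|√(n : ℝ) * ⟪b n, act Z (tpow (m + 1) (v n))⟫| + 1) := by
  have hu' : ∀ᶠ n in atTop, ‖u n‖ = 1 := by
    filter_upwards [eventually_ge_atTop 1] with n hn using hu n hn
  have hv' : ∀ᶠ n in atTop, ‖v n‖ = 1 := by
    filter_upwards [eventually_ge_atTop 1] with n hn using hv n hn
  have hβ' : ∀ᶠ n : ℕ in atTop, (n : ℝ) ^ ε ≤ |β n| := by
    filter_upwards [hβ, hu', hv'] with n h1 h2 h3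
    refine h1.trans ?_
    have h4 := abs_real_inner_le_norm (u n) (v n)
    rw [h2, h3, one_mul] at h4
    rw [abs_mul, abs_pow]
    exact mul_le_of_le_one_right (abs_nonneg _) (pow_le_one₀ (abs_nonneg _) h4)
  have hF := tendsto_natCast_rpow_atTop hε
  have hβtop : Tendsto (fun n => |β n|) atTop atTop := tendsto_atTop_mono' _ hβ' hF
  obtain ⟨M, hM1, hM⟩ := exists_noise_mform_le (m + 1 + 1)
  set Λ : ℝ := M * ((m + 1 : ℕ) + 1) * 3 ^ (m + 1) with Λ_def
  have hΛ : 0 ≤ Λ := by positivity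
  obtain ⟨J, hJ⟩ := exists_tendsto_sqrt_mul_pow hε hβ' (C := 3 * Λ) (by positivity)
  set q := ⌊1 / (2 * ε)⌋₊ with q_def
  obtain ⟨lam, hlam, hlam0, hlam1, hlam2, hlam3, hlam4⟩ := exists_noise_scale hε hc hβ'
  set w : ∀ n, EuclideanSpace ℝ (Fin n) := fun n => a n - ⟪a n, v n⟫ • v n with w_def
  have hw : ∀ᶠ n in atTop, 0 < ‖w n‖ := by
    filter_upwards [hav'.bound one_pos, eventually_ge_atTop 1] with n h1 hn
    rw [one_mul] at h1
    exact norm_perp_pos (ha n hn) h1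
  set A : ℕ → ℝ := fun n => ⟪a n, v n⟫ / ‖w n‖ with A_def
  set b : ∀ n, EuclideanSpace ℝ (Fin n) := fun n => ‖w n‖⁻¹ • w n with b_def
  have hdec : ∀ᶠ n in atTop, 0 < ‖w n‖ ∧ a n = ‖w n‖ • (A n • v n + b n) ∧ ‖a n‖ = 1 ∧
      ‖b n‖ = 1 ∧ ⟪b n, v n⟫ = 0 := by
    filter_upwards [hw, hv', eventually_ge_atTop 1] with n h1 h2 hn
    obtain ⟨h3, h4, h5⟩ := perp_decomposition h2 h1
    exact ⟨h1, h3, ha n hn, h4, h5⟩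
  have hA1 : Tendsto (fun n => A n / β n) atTop (𝓝 0) := by
    rw [tendsto_zero_iff_abs_tendsto_zero]
    refine hav'.tendsto_div_nhds_zero.abs.congr' ?_ |>.trans (by rw [abs_zero])
    filter_upwards with n
    simp only [Function.comp_apply, A_def, abs_div, abs_mul, abs_abs, abs_norm]
    rw [div_div, mul_comm]
  have hA3 : Tendsto (fun n : ℕ => √(n : ℝ) * A n / β n ^ 3) atTop (𝓝 0) := by
    rw [tendsto_zero_iff_abs_tendsto_zero]
    refine hav.tendsto_div_nhds_zero.abs.congr' ?_ |>.trans (by rw [abs_zero])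
    filter_upwards [hβtop.eventually_gt_atTop 0, hw] with n h1 h2
    simp only [Function.comp_apply, A_def, abs_div, abs_mul, abs_pow, abs_abs, abs_norm,
      abs_of_nonneg (Real.sqrt_nonneg _)]
    change _ / (_ * ‖w n‖) = _
    field_simp
  obtain ⟨δ, hδ, hδ0, hδ1, hδ2⟩ := exists_norm_scale hA1
  set K := q + 1 + 1 + J + 1 with K_def
  set G : ∀ n, Set (Tensor (m + 1 + 1) n) := fun n =>
    {Z | IsTypical (β n) (v n) (u n) (b n) K M (lam n) (δ n) Z} with G_def
  have hlarge : ∀ᶠ n in atTop, 8 * M * 3 ^ (m + 1) ≤ |β n| := hβtop.eventually_ge_atTop _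
  have hT' : ∀ᶠ n in atTop, q + 3 ≤ T n := by
    filter_upwards [hT, hβ', eventually_ge_atTop 2] with n h1 h2 hn
    exact floor_add_three_le hε (by exact_mod_cast hn) h2 h1
  have hgrow : ∀ᶠ n in atTop, ∀ Z ∈ G n,
      (∀ t, q + 1 ≤ t → 1 / 3 ≤ |⟪powerIter (spiked (β n) (v n) Z) (u n) t, v n⟫|) ∧
        (∀ t, ⟪powerIter (spiked (β n) (v n) Z) (u n) t, v n⟫ ≠ 0) ∧
        ∀ t, Real.sign ⟪powerIter (spiked (β n) (v n) Z) (u n) (t + 1), v n⟫ =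
          Real.sign (β n * ⟪powerIter (spiked (β n) (v n) Z) (u n) t, v n⟫ ^ (m + 1)) := by
    filter_upwards [hu', hv', hlarge, hlam, hF.eventually_ge_atTop (4 * M), huv, hβ, hlam4,
      eventually_le_growth hε hc hM1, eventually_ge_atTop 1]
      with n h1 h2 h3 h4 h5 h6 h7 h8 h9 hn Z hZ
    have hn0 : (0 : ℝ) < n := by exact_mod_cast hn
    exact IsTypical.overlap_growth hZ h2 h1 hM1 h3 h4.le h5 (by positivity) h6 h7 h8 h9
      (by omega)
  refine ⟨b, G, hdec.mono fun n h => h.2.2.2.1, tendsto_noise_not_isTypical (by omega) hv' hu'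
    (hdec.mono fun n h => h.2.2.2.1) hM hlam hδ hlam3 hδ2, hT'.mono fun n h => by omega,
    hgrow.mono fun n h Z hZ => (h Z hZ).2, ?_⟩
  set l : Filter (Σ n, Tensor (m + 1 + 1) n) := comap Sigma.fst atTop ⊓ 𝓟 {p | p.2 ∈ G p.1}
    with l_def
  have hfst : Tendsto (Sigma.fst : (Σ n, Tensor (m + 1 + 1) n) → ℕ) l atTop :=
    tendsto_comap.mono_left inf_le_left
  have hl : ∀ {Q : (Σ n, Tensor (m + 1 + 1) n) → Prop},
      (∀ᶠ p in l, Q p) ↔ ∀ᶠ n in atTop, ∀ Z ∈ G n, Q ⟨n, Z⟩ := by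
    intro Q
    rw [l_def, eventually_inf_principal, eventually_comap]
    refine eventually_congr (Eventually.of_forall fun n => ⟨fun h Z hZ => h ⟨n, Z⟩ rfl hZ, ?_⟩)
    rintro h ⟨n', Z⟩ rfl hZ
    exact h Z hZ
  have hG : ∀ᶠ p in l, p.2 ∈ G p.1 := hl.mpr (Eventually.of_forall fun n Z hZ => hZ)
  have hgδ : ∀ᶠ p in l, |‖act p.2 (tpow (m + 1) (v p.1))‖ ^ 2 - 1| ≤ δ p.1 :=
    hG.mono fun p hp => hp.norm_act
  obtain ⟨μ', o', hμ, ho, hexp⟩ := studentized_expansion (l := l)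
    (E := fun p => EuclideanSpace ℝ (Fin p.1)) (H := fun p x => act p.2 (tpow (m + 1) x))
    (v := fun p => v p.1) (a := fun p => a p.1) (â := fun p => b p.1)
    (u := fun p => powerIter (spiked (β p.1) (v p.1) p.2) (u p.1)) (T := fun p => T p.1)
    (n := fun p => (p.1 : ℝ)) (β := fun p => β p.1) (A := fun p => A p.1) (b := fun p => ‖w p.1‖)
    (lam := fun p => lam p.1) (M := M) (Λ := Λ) (C := 1) (p := m + 1) (q := q + 1) (J := J)
    (by omega) hΛ
    (by
      filter_upwards [hG, hfst.eventually hv', hfst.eventually hu', hfst.eventually hlarge]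
        with p h1 h2 h3 h4 using h1.isPowerIteration h2 h3 hM1 h4)
    (hl.mpr (hgrow.mono fun n h Z hZ => (h Z hZ).1))
    (hfst.eventually hT') (hfst.eventually (hlam.mono fun n h => h.le))
    (hG.mono fun p hp => hp.dir)
    (hG.mono fun p hp t ht => hp.along_dir t (by omega))
    (hG.mono fun p hp t ht => hp.along_perp t (by omega))
    (hG.mono fun p hp t ht => hp.along_act t (by omega))
    (squeeze_zero_norm' hgδ (hδ0.comp hfst))
    (by
      refine squeeze_zero_norm' ?_ (hδ1.comp hfst)
      filter_upwards [hgδ] with p hp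
      rw [norm_mul, Real.norm_eq_abs, mul_div_assoc, norm_mul, Real.norm_eq_abs,
        abs_of_nonneg (Real.sqrt_nonneg _), Real.norm_eq_abs]
      exact mul_le_mul_of_nonneg_right hp (by positivity))
    (hfst.eventually hdec) (hβtop.comp hfst) (hA1.comp hfst) (hA3.comp hfst) (hlam0.comp hfst)
    (hlam1.comp hfst) (hfst.eventually hlam2) (hJ.comp hfst)
    (hfst.eventually ((eventually_ge_atTop 1).mono fun n hn => Nat.one_le_cast.mpr hn))
  intro η hη
  have hμ' : ∀ᶠ p in l, |μ' p - 1| ≤ η := by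
    have : Tendsto (fun p => |μ' p - 1|) l (𝓝 0) := by simpa using (hμ.sub_const 1).abs
    exact this.eventually_le_const hη
  have ho' : ∀ᶠ p in l, |o' p| ≤ η := by
    have : Tendsto (fun p => |o' p|) l (𝓝 0) := by simpa using ho.abs
    exact this.eventually_le_const hη
  refine (hl (Q := fun p =>
    |studentized (spiked (β p.1) (v p.1) p.2) (u p.1) (T p.1) (a p.1)
        (Real.sign ⟪powerIter (spiked (β p.1) (v p.1) p.2) (u p.1) (T p.1), v p.1⟫ • v p.1) -
      Real.sign ⟪powerIter (spiked (β p.1) (v p.1) p.2) (u p.1) (T p.1), v p.1⟫ *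
        Real.sign ⟪powerIter (spiked (β p.1) (v p.1) p.2) (u p.1) (T p.1), v p.1⟫ ^ (m + 1 + 1) *
        (√(p.1 : ℝ) * ⟪b p.1, act p.2 (tpow (m + 1) (v p.1))⟫)| ≤
      η * (|√(p.1 : ℝ) * ⟪b p.1, act p.2 (tpow (m + 1) (v p.1))⟫| + 1))).mp ?_
  filter_upwards [hexp, hμ', ho'] with p h1 h2 h3
  rw [studentized, betaHat_spiked, h1]
  set s := Real.sign ⟪powerIter (spiked (β p.1) (v p.1) p.2) (u p.1) (T p.1), v p.1⟫ with s_def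
  set g := √(p.1 : ℝ) * ⟪b p.1, act p.2 (tpow (m + 1) (v p.1))⟫ with g_def
  have hs : |s| ≤ 1 := by
    rcases Real.sign_apply_eq ⟪powerIter (spiked (β p.1) (v p.1) p.2) (u p.1) (T p.1), v p.1⟫
      with h | h | h <;> rw [s_def, h] <;> norm_num
  have hs' : |s * s ^ (m + 1 + 1)| ≤ 1 := by
    rw [← pow_succ', abs_pow]
    exact pow_le_one₀ (abs_nonneg _) hs
  calc |s * s ^ (m + 1 + 1) * (μ' p * g + o' p) - s * s ^ (m + 1 + 1) * g|
      = |s * s ^ (m + 1 + 1)| * |(μ' p - 1) * g + o' p| := by rw [← abs_mul]; congr 1; ring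
    _ ≤ 1 * |(μ' p - 1) * g + o' p| := by gcongr
    _ ≤ |μ' p - 1| * |g| + |o' p| := by
      rw [one_mul, ← abs_mul]; exact abs_add_le _ _
    _ ≤ η * |g| + η := by gcongr
    _ = η * (|g| + 1) := by ring

theorem measurable_powerIter {k n : ℕ} (u : EuclideanSpace ℝ (Fin n)) (t : ℕ) :
    Measurable fun X : Tensor (k + 1) n => powerIter X u t := by
  induction t with
  | zero => exact measurable_const
  | succ t ih =>
    have h : Measurable fun X : Tensor (k + 1) n => act X (tpow k (powerIter X u t)) :=
      measurable_act_uncurry.comp (measurable_id.prodMk ((measurable_tpow k).comp ih))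
    simp only [powerIter]
    fun_prop

theorem measurable_studentized {k n : ℕ} (u a w : EuclideanSpace ℝ (Fin n)) (T : ℕ) :
    Measurable fun X : Tensor (k + 1) n => studentized X u T a w := by
  have h1 := measurable_powerIter (k := k) u T
  have h2 : Measurable fun X : Tensor (k + 1) n => betaHat X u T :=
    measurable_tinner_uncurry.comp (measurable_id.prodMk ((measurable_tpow (k + 1)).comp h1))
  unfold studentized
  fun_prop

theorem measurable_spiked {k n : ℕ} (β : ℝ) (v : EuclideanSpace ℝ (Fin n)) :
    Measurable (spiked (k := k) β v) := by
  unfold spiked; fun_prop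

/-- A sequence that is close, on events of probability tending to one, to standard Gaussian
variables, is asymptotically standard Gaussian. -/
theorem tendstoStdNormal_of_close {Ω : ℕ → Type*} [∀ n, MeasurableSpace (Ω n)]
    {P : ∀ n, Measure (Ω n)} [∀ n, IsProbabilityMeasure (P n)] {S g : ∀ n, Ω n → ℝ}
    (hS : ∀ n, AEMeasurable (S n) (P n))
    (hg : ∀ᶠ n in atTop, HasLaw (g n) (gaussianReal 0 1) (P n)) {G : ∀ n, Set (Ω n)}
    (hG : Tendsto (fun n => P n (G n)ᶜ) atTop (𝓝 0))
    (h : ∀ η : ℝ, 0 < η → ∀ᶠ n in atTop, ∀ ω ∈ G n, |S n ω - g n ω| ≤ η * (|g n ω| + 1)) :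
    TendstoStdNormal P S where
  forall_aemeasurable := hS
  tendsto := by
    refine tendsto_iff_forall_lipschitz_integral_tendsto.mpr ?_
    rintro f ⟨C, hC⟩ ⟨L, hL⟩
    have hfc : Continuous f := hL.continuous
    have hC0 : 0 ≤ C := (dist_nonneg).trans (hC 0 0)
    simp only [ProbabilityMeasure.coe_mk, Measure.map_id]
    have hfS : ∀ n, ∫ x, f x ∂(P n).map (S n) = ∫ ω, f (S n ω) ∂P n := fun n =>
      integral_map (hS n) hfc.aestronglyMeasurable
    simp only [hfS]
    have hbdd : ∀ x, ‖f x‖ ≤ ‖f 0‖ + C := fun x => by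
      have h1 := hC x 0
      rw [dist_eq_norm] at h1
      have h2 := norm_add_le (f x - f 0) (f 0)
      rw [sub_add_cancel] at h2
      linarith
    set I : ℝ := ∫ x, |x| ∂gaussianReal 0 1 with I_def
    have hI : 0 ≤ I := integral_nonneg fun _ => abs_nonneg _
    have hint : Integrable (fun x : ℝ => |x|) (gaussianReal 0 1) :=
      ((memLp_id_gaussianReal' (μ := 0) (v := 1) 1 (by simp)).integrable le_rfl).abs
    have hbound : ∀ η : ℝ, 0 < η → ∀ᶠ n in atTop,
        |∫ ω, f (S n ω) ∂P n - ∫ x, f x ∂gaussianReal 0 1| ≤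
          (P n).real (G n)ᶜ * C + L * η * (I + 1) := by
      intro η hη
      filter_upwards [hg, h η hη] with n h1 h2
      have e1 : ∫ x, f x ∂gaussianReal 0 1 = ∫ ω, f (g n ω) ∂P n :=
        (h1.integral_comp hfc.aestronglyMeasurable).symm
      have e2 : I = ∫ ω, |g n ω| ∂P n :=
        (h1.integral_comp continuous_abs.aestronglyMeasurable).symm
      have i0 : Integrable (fun ω => |g n ω|) (P n) := by
        have := hint
        rw [← h1.map_eq] at this
        exact this.comp_aemeasurable h1.aemeasurable
      have i1 : Integrable (fun ω => f (S n ω)) (P n) :=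
        .of_bound (hfc.comp_aestronglyMeasurable (hS n).aestronglyMeasurable) _
          (Eventually.of_forall fun ω => hbdd _)
      have i2 : Integrable (fun ω => f (g n ω)) (P n) :=
        .of_bound (hfc.comp_aestronglyMeasurable h1.aemeasurable.aestronglyMeasurable) _
          (Eventually.of_forall fun ω => hbdd _)
      set B := toMeasurable (P n) (G n)ᶜ with B_def
      have hB : MeasurableSet B := measurableSet_toMeasurable _ _
      have i3 : Integrable (B.indicator fun _ => C) (P n) :=
        (integrable_const C).indicator hB
      have i4 : Integrable (fun ω => L * η * (|g n ω| + 1)) (P n) :=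
        (i0.add (integrable_const 1)).const_mul _
      have key : ∀ ω, ‖f (S n ω) - f (g n ω)‖ ≤
          B.indicator (fun _ => C) ω + L * η * (|g n ω| + 1) := by
        intro ω
        have hnn : 0 ≤ L * η * (|g n ω| + 1) := by positivity
        by_cases hω : ω ∈ G n
        · have h3 := hL.dist_le_mul (S n ω) (g n ω)
          rw [dist_eq_norm, Real.dist_eq] at h3
          have h4 : (L : ℝ) * |S n ω - g n ω| ≤ L * (η * (|g n ω| + 1)) := by
            gcongr
            exact h2 ω hω
          have h5 : 0 ≤ B.indicator (fun _ => C) ω := Set.indicator_nonneg (fun _ _ => hC0) ω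
          linarith
        · have h3 : ω ∈ B := subset_toMeasurable _ _ hω
          have h4 := hC (S n ω) (g n ω)
          rw [dist_eq_norm] at h4
          rw [Set.indicator_of_mem h3]
          linarith
      rw [e1, e2, ← integral_sub i1 i2, ← Real.norm_eq_abs]
      refine (norm_integral_le_of_norm_le (i3.add i4) (Eventually.of_forall key)).trans
        (le_of_eq ?_)
      simp only [Pi.add_apply]
      rw [integral_add i3 i4, integral_indicator_const C hB, integral_const_mul,
        integral_add i0 (integrable_const 1), integral_const, B_def, measureReal_def,
        measure_toMeasurable, ← measureReal_def]
      simp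
    have hG' : Tendsto (fun n => (P n).real (G n)ᶜ * C) atTop (𝓝 0) := by
      have := ((ENNReal.tendsto_toReal ENNReal.zero_ne_top).comp hG).mul_const C
      simpa [Function.comp_def, ← measureReal_def] using this
    rw [Metric.tendsto_nhds]
    intro e he
    have hη : 0 < e / (2 * (L * (I + 1) + 1)) := by positivity
    filter_upwards [hbound _ hη, hG'.eventually_lt_const (half_pos he)] with n h1 h2
    rw [Real.dist_eq]
    have h3 : L * (e / (2 * (L * (I + 1) + 1))) * (I + 1) ≤ e / 2 := by
      have h4 : 0 ≤ L * (I + 1) := by positivity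
      rw [show L * (e / (2 * (L * (I + 1) + 1))) * (I + 1) =
        e / 2 * ((L * (I + 1)) / (L * (I + 1) + 1)) by field_simp]
      exact mul_le_of_le_one_right (by linarith) ((div_le_one (by linarith)).mpr (by linarith))
    linarith

theorem hasLaw_sqrt_mul_inner_act {k n : ℕ} (hn : 1 ≤ n) {b v : EuclideanSpace ℝ (Fin n)}
    (hb : ‖b‖ = 1) (hv : ‖v‖ = 1) {s : ℝ} (hs : |s| = 1) :
    HasLaw (fun Z : Tensor (k + 1) n => s * (√(n : ℝ) * ⟪b, act Z (tpow k v)⟫))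
      (gaussianReal 0 1) (noise (k + 1) n) := by
  have hn0 : (0 : ℝ) < n := by exact_mod_cast hn
  have h := hasLaw_tinner_noise ((s * √(n : ℝ)) • outer b (tpow k v))
  have e : tinner ((s * √(n : ℝ)) • outer b (tpow k v)) ((s * √(n : ℝ)) • outer b (tpow k v)) =
      n := by
    rw [tinner_smul_left, tinner_smul_right, tinner_outer, tinner_tpow_self hv,
      real_inner_self_eq_norm_sq, hb]
    have h1 : s ^ 2 = 1 := by rw [← sq_abs, hs, one_pow]
    have h2 : √(n : ℝ) ^ 2 = n := Real.sq_sqrt hn0.le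
    linear_combination √(n : ℝ) ^ 2 * h1 + h2
  rw [e, div_self hn0.ne', Real.toNNReal_one] at h
  refine h.congr (Eventually.of_forall fun Z => ?_)
  simp only [inner_act, tinner_smul_right]
  ring

theorem sign_mul_even_pow {β x : ℝ} (hx : x ≠ 0) {p : ℕ} (hp : Even p) :
    Real.sign (β * x ^ p) = Real.sign β := by
  have h := hp.pow_pos hx
  rcases lt_trichotomy β 0 with h0 | rfl | h0
  · rw [Real.sign_of_neg h0, Real.sign_of_neg (mul_neg_of_neg_of_pos h0 h)]
  · rw [zero_mul]
  · rw [Real.sign_of_pos h0, Real.sign_of_pos (mul_pos h0 h)]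

theorem sign_mul_odd_pow {β x : ℝ} {p : ℕ} (hp : Odd p) :
    Real.sign (β * x ^ p) = Real.sign β * Real.sign x := by
  have h1 : ∀ y : ℝ, 0 < y → Real.sign (β * y) = Real.sign β := fun y hy => by
    simpa only [Real.sq_sqrt hy.le] using
      sign_mul_even_pow (β := β) (Real.sqrt_ne_zero'.mpr hy) even_two
  rcases lt_trichotomy x 0 with h0 | rfl | h0
  · have h2 := hp.pow_neg h0
    have h3 := h1 _ (neg_pos.mpr h2)
    rw [mul_neg, Real.sign_neg] at h3
    rw [Real.sign_of_neg h0]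
    linarith
  · rw [zero_pow hp.pos.ne', mul_zero, Real.sign_zero, mul_zero]
  · rw [h1 _ (pow_pos h0 p), Real.sign_of_pos h0, mul_one]

/-- The central limit theorem for the comparison vector `ς v`, if `ς` is the sign of the overlap of
`u_T` with `v` predicted by the iteration without noise. -/
theorem tendstoStdNormal_studentized (m : ℕ) {ε c : ℝ} (hε : 0 < ε) (hc : 0 < c)
    {β : ℕ → ℝ} {u v a : ∀ n : ℕ, EuclideanSpace ℝ (Fin n)} {T : ℕ → ℕ}
    (hu : ∀ n, 1 ≤ n → ‖u n‖ = 1) (hv : ∀ n, 1 ≤ n → ‖v n‖ = 1) (ha : ∀ n, 1 ≤ n → ‖a n‖ = 1)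
    (huv : ∀ᶠ n : ℕ in atTop, c / √(n : ℝ) ≤ |⟪u n, v n⟫|)
    (hβ : ∀ᶠ n : ℕ in atTop, (n : ℝ) ^ ε ≤ |β n * ⟪u n, v n⟫ ^ m|)
    (hav : (fun n : ℕ => ⟪a n, v n⟫) =o[atTop]
      fun n : ℕ => |β n| ^ 3 / √(n : ℝ) * ‖a n - ⟪a n, v n⟫ • v n‖)
    (hav' : (fun n : ℕ => ⟪a n, v n⟫) =o[atTop]
      fun n : ℕ => |β n| * ‖a n - ⟪a n, v n⟫ • v n‖)
    (hT : ∀ᶠ n : ℕ in atTop,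
      1 + 1 / ε * (1 / 2 + 2 * Real.log |β n| / Real.log (n : ℝ)) ≤ (T n : ℝ))
    {Ω : ℕ → Type*} [∀ n, MeasurableSpace (Ω n)] {P : ∀ n, Measure (Ω n)}
    [∀ n, IsProbabilityMeasure (P n)] {Z : ∀ n, Ω n → Tensor (m + 2) n}
    (hZ : ∀ n, IsNoise (Z n) (P n)) {ς : ℕ → ℝ} {w : ∀ n : ℕ, EuclideanSpace ℝ (Fin n)}
    (hw : ∀ n, w n = ς n • v n) (hς : ∀ᶠ n in atTop, |ς n| = 1)
    (hsign : ∀ᶠ n in atTop, ∀ x : ℕ → ℝ, x 0 = ⟪u n, v n⟫ → (∀ t, x t ≠ 0) →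
      (∀ t, Real.sign (x (t + 1)) = Real.sign (β n * x t ^ (m + 1))) → 1 ≤ T n →
        Real.sign (x (T n)) = ς n) :
    TendstoStdNormal P fun n ω =>
      studentized (spiked (β n) (v n) (Z n ω)) (u n) (T n) (a n) (w n) := by
  obtain ⟨b, G, hb, hG, hT1, hrec, hexp⟩ :=
    exists_studentized_expansion m hε hc hu hv ha huv hβ hav hav' hT
  have hsT : ∀ᶠ n in atTop, ∀ Z ∈ G n,
      Real.sign ⟪powerIter (spiked (β n) (v n) Z) (u n) (T n), v n⟫ = ς n := by
    filter_upwards [hsign, hT1, hrec] with n h1 h2 h3 Z' hZ'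
    exact h1 (fun t => ⟪powerIter (spiked (β n) (v n) Z') (u n) t, v n⟫) rfl (h3 Z' hZ').1
      (h3 Z' hZ').2 h2
  refine tendstoStdNormal_of_close (G := fun n => Z n ⁻¹' G n)
    (g := fun n ω => ς n * ς n ^ (m + 1 + 1) *
      (√(n : ℝ) * ⟪b n, act (Z n ω) (tpow (m + 1) (v n))⟫))
    (fun n => ((measurable_studentized _ _ _ _).comp (measurable_spiked _ _)).comp_aemeasurable
      (hZ n).hasLaw.aemeasurable) ?_ ?_ ?_
  · filter_upwards [hb, hς, eventually_ge_atTop 1] with n h1 h2 hn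
    refine (hasLaw_sqrt_mul_inner_act hn h1 (hv n hn) ?_).fun_comp (hZ n).hasLaw
    rw [← pow_succ', abs_pow, h2, one_pow]
  · refine tendsto_of_tendsto_of_tendsto_of_le_of_le tendsto_const_nhds hG
      (fun _ => zero_le) fun n => ?_
    rw [← Set.preimage_compl]
    refine (Measure.le_map_apply (hZ n).hasLaw.aemeasurable _).trans (le_of_eq ?_)
    rw [(hZ n).hasLaw.map_eq]
  · intro η hη
    filter_upwards [hexp η hη, hsT, hς] with n h1 h2 h3 ω hω
    have h4 := h1 _ hω
    rw [h2 _ hω, ← hw] at h4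
    rwa [abs_mul (ς n * _), ← pow_succ', abs_pow, h3, one_pow, one_mul, pow_succ' (ς n)]

end SpikedTensor

end

/-- The order of the tensors is `k = m + 2` (so every `k ≥ 2`, and `k - 2 = m`), fixed as the
dimension `n` tends to infinity; the four cases are those of the parity of `k` and the sign of `β`.
Here `‖a n - ⟪a n, v n⟫ • v n‖ = √(1 - ⟪a n, v n⟫²)`. -/
theorem corollary2p3 (m : ℕ) (ε c : ℝ) (hε : 0 < ε) (hc : 0 < c)
    (β : ℕ → ℝ) (u v a : ∀ n : ℕ, EuclideanSpace ℝ (Fin n)) (T : ℕ → ℕ)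
    (hu : ∀ n, 1 ≤ n → ‖u n‖ = 1) (hv : ∀ n, 1 ≤ n → ‖v n‖ = 1) (ha : ∀ n, 1 ≤ n → ‖a n‖ = 1)
    (huv : ∀ᶠ n : ℕ in atTop, c / √(n : ℝ) ≤ |⟪u n, v n⟫|)
    (hβ : ∀ᶠ n : ℕ in atTop, (n : ℝ) ^ ε ≤ |β n * ⟪u n, v n⟫ ^ m|)
    (hav : (fun n : ℕ => ⟪a n, v n⟫) =o[atTop]
      fun n : ℕ => |β n| ^ 3 / √(n : ℝ) * ‖a n - ⟪a n, v n⟫ • v n‖)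
    (hav' : (fun n : ℕ => ⟪a n, v n⟫) =o[atTop]
      fun n : ℕ => |β n| * ‖a n - ⟪a n, v n⟫ • v n‖)
    (hT : ∀ᶠ n : ℕ in atTop,
      1 + 1 / ε * (1 / 2 + 2 * Real.log |β n| / Real.log (n : ℝ)) ≤ (T n : ℝ))
    {Ω : ℕ → Type*} [∀ n, MeasurableSpace (Ω n)] (P : ∀ n, Measure (Ω n))
    [∀ n, IsProbabilityMeasure (P n)] (Z : ∀ n, Ω n → SpikedTensor.Tensor (m + 2) n)
    (hZ : ∀ n, SpikedTensor.IsNoise (Z n) (P n)) :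
    (Odd (m + 2) → (∀ᶠ n in atTop, 0 < β n) →
      SpikedTensor.TendstoStdNormal P fun n ω =>
        SpikedTensor.studentized (SpikedTensor.spiked (β n) (v n) (Z n ω)) (u n) (T n) (a n)
          (v n)) ∧
    (Odd (m + 2) → (∀ᶠ n in atTop, β n < 0) →
      SpikedTensor.TendstoStdNormal P fun n ω =>
        SpikedTensor.studentized (SpikedTensor.spiked (β n) (v n) (Z n ω)) (u n) (T n) (a n)
          (-v n)) ∧
    (Even (m + 2) → (∀ᶠ n in atTop, 0 < β n) →
      SpikedTensor.TendstoStdNormal P fun n ω =>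
        SpikedTensor.studentized (SpikedTensor.spiked (β n) (v n) (Z n ω)) (u n) (T n) (a n)
          (Real.sign ⟪u n, v n⟫ • v n)) ∧
    (Even (m + 2) → (∀ᶠ n in atTop, β n < 0) →
      SpikedTensor.TendstoStdNormal P fun n ω =>
        SpikedTensor.studentized (SpikedTensor.spiked (β n) (v n) (Z n ω)) (u n) (T n) (a n)
          (((-1) ^ T n * Real.sign ⟪u n, v n⟫) • v n)) := by
  have hv' : ∀ᶠ n in atTop, ⟪u n, v n⟫ ≠ 0 := by
    filter_upwards [huv, eventually_ge_atTop 1] with n h1 hn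
    have hn0 : (0 : ℝ) < n := by exact_mod_cast hn
    exact abs_pos.mp ((by positivity : 0 < c / √(n : ℝ)).trans_le h1)
  refine ⟨fun hm hpos => ?_, fun hm hneg => ?_, fun hm hpos => ?_, fun hm hneg => ?_⟩
  · refine SpikedTensor.tendstoStdNormal_studentized m hε hc hu hv ha huv hβ hav hav' hT hZ
      (ς := fun _ => 1) (fun n => (one_smul ℝ _).symm) (by simp) ?_
    filter_upwards [hpos] with n h1 x _ h2 h3 h4
    obtain ⟨t, ht⟩ := Nat.exists_eq_succ_of_ne_zero (by omega : T n ≠ 0)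
    rw [ht, h3, SpikedTensor.sign_mul_even_pow (h2 t) (by grind), Real.sign_of_pos h1]
  · refine SpikedTensor.tendstoStdNormal_studentized m hε hc hu hv ha huv hβ hav hav' hT hZ
      (ς := fun _ => -1) (fun n => (neg_one_smul ℝ _).symm) (by simp) ?_
    filter_upwards [hneg] with n h1 x _ h2 h3 h4
    obtain ⟨t, ht⟩ := Nat.exists_eq_succ_of_ne_zero (by omega : T n ≠ 0)
    rw [ht, h3, SpikedTensor.sign_mul_even_pow (h2 t) (by grind), Real.sign_of_neg h1]
  · refine SpikedTensor.tendstoStdNormal_studentized m hε hc hu hv ha huv hβ hav hav' hT hZ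
      (ς := fun n => Real.sign ⟪u n, v n⟫) (fun n => rfl) ?_ ?_
    · filter_upwards [hv'] with n h1
      rcases Real.sign_apply_eq_of_ne_zero _ h1 with h | h <;> simp [h]
    · filter_upwards [hpos] with n h1 x h0 h2 h3 h4
      have key : ∀ t, Real.sign (x t) = Real.sign (x 0) := fun t => by
        induction t with
        | zero => rfl
        | succ t ih =>
          rw [h3, SpikedTensor.sign_mul_odd_pow (by grind), Real.sign_of_pos h1, one_mul, ih]
      rw [key, h0]
  · refine SpikedTensor.tendstoStdNormal_studentized m hε hc hu hv ha huv hβ hav hav' hT hZ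
      (ς := fun n => (-1) ^ T n * Real.sign ⟪u n, v n⟫) (fun n => rfl) ?_ ?_
    · filter_upwards [hv'] with n h1
      rcases Real.sign_apply_eq_of_ne_zero _ h1 with h | h <;> simp [h]
    · filter_upwards [hneg] with n h1 x h0 h2 h3 h4
      have key : ∀ t, Real.sign (x t) = (-1) ^ t * Real.sign (x 0) := fun t => by
        induction t with
        | zero => rw [pow_zero, one_mul]
        | succ t ih =>
          rw [h3, SpikedTensor.sign_mul_odd_pow (by grind), Real.sign_of_neg h1, ih, pow_succ']
          ring
      rw [key, h0]
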